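/- **Setting.** Curves are $1$-periodic $C^1$ maps $\gamma:\mathbb R/\mathbb Z\to\mathbb R^2$; the space of these carries the $C^1$-norm. A *generic immersion* is a regular curve ($\gamma'\ne 0$) with finitely many self-intersections, all of them transverse and of multiplicity two. Write $S(\gamma)=\{(u,v): u<v,\ \gamma(u)=\gamma(v)\}=\{(u_1,v_1),\dots,(u_n,v_n)\}$ (with parameters represented in $[0,1)$), $T(\gamma)=\{u_1,v_1,\dots,u_n,v_n\}$, let $d_\gamma$ be the intrinsic distance of parameters along the curve and $\Lambda(\gamma)=\min\{d_\gamma(a,b): a\neq b\in T(\gamma)\}$ ($=\infty$ if $n=0$). The angle $\alpha_i(\gamma)\in(0,\frac\pi2]$ is the angle between the two tangent lines at the $i$-th self-intersection. Let $W$ be the winding number (rotation number of $\gamma'$), and let $J^+,J^-,\mathrm{St}$ be Arnold's invariants: they are constant along regular homotopies through generic immersions; $J^+$ increases by $2$ at a positive crossing (the number of double points increases) of a direct self-tangency, $J^-$ increases by $-2$ at a positive crossing of an inverse self-tangency, $\mathrm{St}$ increases by $1$ at a positive crossing of a transverse triple point (the newborn triangle has sign $+1$ in Arnold's convention), and no other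 crossing changes them; they are normalized on Arnold's standard curve of winding number $\omega$ (for $\omega\ne0$: a circle with $|\omega|-1$ small inner loops; for $\omega=0$: the figure eight) by $J^+=-2(|\omega|-1)$, $J^-=-3(|\omega|-1)$, $\mathrm{St}=|\omega|-1$ if $\omega\ne 0$, and $J^+=0$, $J^-=-1$, $\mathrm{St}=0$ if $\omega=0$. For integers $j_+,j_-,s,\omega$, a *compartment* $\mathcal C=\mathcal C(j_\pm,s,\omega)$ is a path component, with respect to regular homotopy, of the set of all generic immersions with $J^+=j_+$, $J^-=j_-$, $\mathrm{St}=s$, $W=\omega$. For $\eta\in(0,1)$ let $\mathcal F(\eta,j_\pm,s,\omega)$ be the set of all arclength parametrized generic immersions with these invariants, with $\Lambda(\gamma)\ge 2\eta$, and such that $\gamma$ is affine linear on $(u-\eta,u+\eta)$ for every $u\in T(\gamma)$. For $q>2$ and $\delta>0$ let $Y_\delta(\gamma)$ be the set of all $(x,y)\in(\mathbb R/\mathbb Z)^2$ such that, for some $i$, either $d_\gamma(x,u_i)<\delta$ and $d_\gamma(y,v_i)<\delta$, or $d_\gamma(x,v_i)<\delta$ and $d_\gamma(y,u_i)<\delta$.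 The truncated tangent-point energy is $$\mathrm{TP}_{q,\delta}(\gamma)=\iint_{(\mathbb R/\mathbb Z)^2\setminus Y_\delta(\gamma)}\left(\frac{2\,\mathrm{dist}(\gamma(t)+\mathbb R\gamma'(t),\gamma(s))}{|\gamma(t)-\gamma(s)|^2}\right)^q|\gamma'(s)||\gamma'(t)|\,ds\,dt\in[0,\infty],$$ and the renormalized energy is $R_q(\gamma):=\lim_{\delta\to0+}\delta^{q-2}\,\mathrm{TP}_{q,\delta}(\gamma)$. For $\alpha\in(0,\frac\pi2]$ put $$F(\alpha)=\frac1{(\sin\alpha)^{q-1}}\Big[\int_{-\cot\alpha}^{\tan\frac\alpha2}\Big(\big(\tfrac1{z^2+1}\big)^q+\big(\tfrac{z\sin\alpha+\cos\alpha}{z^2+1}\big)^q\Big)dz+\int_{\cot\alpha}^{\cot\frac\alpha2}\Big(\big(\tfrac1{z^2+1}\big)^q+\big(\tfrac{z\sin\alpha-\cos\alpha}{z^2+1}\big)^q\Big)dz\Big].$$ **Theorem.** Let $\mathcal C=\mathcal C(j_\pm,s,\omega)$ be a (non-empty) compartment, $\eta\in(0,1)$ and $q>2$, and let $X:=\mathcal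 F(\eta,j_\pm,s,\omega)\cap\mathcal C\cap W^{2-\frac1q,q}(\mathbb R/\mathbb Z,\mathbb R^2)$ with the topology of the $C^1$-norm. Then: 1. for every $\gamma\in X$ the limit defining $R_q(\gamma)$ exists; 2. $\delta^{q-2}\,\mathrm{TP}_{q,\delta}$ Gamma-converges to $R_q$ on $X$ as $\delta\to0+$, that is, for every $\xi\in X$: $R_q(\xi)\le\liminf_{\delta\to0+}\delta^{q-2}\mathrm{TP}_{q,\delta}(\xi_\delta)$ for every family $(\xi_\delta)_{\delta>0}\subset X$ with $\xi_\delta\to\xi$ in $C^1$, and there is such a family with $\limsup_{\delta\to0+}\delta^{q-2}\mathrm{TP}_{q,\delta}(\xi_\delta)\le R_q(\xi)$; 3. for every $\gamma\in X$ one has $R_q(\gamma)=\frac{2^{q+2}}{q-2}\sum_{i=1}^nF(\alpha_i(\gamma))$; in particular $R_q$ depends only on the intersection angles; 4. a curve $\gamma\in X$ minimizes $R_q$ on $X$ if and only if all its intersection angles equal $\frac\pi2$. -/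

import Mathlib

open Set Filter Topology MeasureTheory
open scoped ENNReal

/-- A closed planar curve of class `C¹`, i.e. an element of `C¹(ℝ/ℤ, ℝ²)`, written as a
`1`-periodic map on `ℝ`. The Euclidean plane `ℝ²` is identified with `ℂ`. -/
structure C1Loop where
  toFun : ℝ → ℂ
  periodic : Function.Periodic toFun 1
  contDiff : ContDiff ℝ 1 toFun

namespace C1Loop

instance : CoeFun C1Loop (fun _ => ℝ → ℂ) := ⟨C1Loop.toFun⟩

/-- The velocity of the curve. -/
noncomputable def vel (γ : C1Loop) (t : ℝ) : ℂ := deriv γ.toFun t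

/-- The topology of the `C¹` norm: uniform convergence of the curves together with their
velocities. -/
noncomputable instance : TopologicalSpace C1Loop :=
  TopologicalSpace.induced
    (fun γ : C1Loop => (UniformFun.ofFun γ.toFun, UniformFun.ofFun γ.vel)) inferInstance

/-- Regular curves (immersions of the circle). -/
def IsImmersion (γ : C1Loop) : Prop := ∀ t, γ.vel t ≠ 0

/-- The set `S(γ)` of self-intersections: pairs `(u, v)` of parameters of the circle, represented in
`[0, 1)`, with `u < v` and `γ u = γ v`. -/
def selfInt (γ : C1Loop) : Set (ℝ × ℝ) :=
  {p | 0 ≤ p.1 ∧ p.1 < p.2 ∧ p.2 < 1 ∧ γ p.1 = γ p.2}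

/-- The set `T(γ)` of all parameters (in `[0, 1)`) that occur in a self-intersection. -/
def selfIntParams (γ : C1Loop) : Set ℝ := {u | ∃ p ∈ γ.selfInt, u = p.1 ∨ u = p.2}

/-- The two tangent lines at the self-intersection `p` are distinct. -/
def TransverseAt (γ : C1Loop) (p : ℝ × ℝ) : Prop :=
  LinearIndependent ℝ ![γ.vel p.1, γ.vel p.2]

/-- `a < b < c` are three parameters in `[0, 1)` of one and the same curve point. -/
def IsTriplePoint (γ : C1Loop) (a b c : ℝ) : Prop :=
  0 ≤ a ∧ a < b ∧ b < c ∧ c < 1 ∧ γ a = γ b ∧ γ b = γ c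

/-- Generic immersions: all self-intersections are transverse, of multiplicity two, and there are
only finitely many of them. -/
def IsGeneric (γ : C1Loop) : Prop :=
  γ.IsImmersion ∧ γ.selfInt.Finite ∧ (∀ p ∈ γ.selfInt, γ.TransverseAt p) ∧
    ∀ a b c, ¬ γ.IsTriplePoint a b c

/-- `W(γ) = ω`: a continuous angle function of the velocity grows by `2πω` over one period. -/
def HasWindingNumber (γ : C1Loop) (ω : ℤ) : Prop :=
  ∃ θ : ℝ → ℝ, Continuous θ ∧
    (∀ t, γ.vel t = (‖γ.vel t‖ : ℂ) * Complex.exp (θ t * Complex.I)) ∧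
    θ 1 - θ 0 = 2 * Real.pi * ω

/-! ### The Arnold invariants -/

/-- The good part of the discriminant, self-tangencies: the only degeneracy of the immersion is
one non-transverse double point, where `vel v = r • vel u` with `r` of the sign prescribed by
`side`. -/
def HasOneSelfTangency (side : ℝ → Prop) (γ : C1Loop) : Prop :=
  γ.IsImmersion ∧ γ.selfInt.Finite ∧ (∀ a b c, ¬ γ.IsTriplePoint a b c) ∧
    ∃ p ∈ γ.selfInt, (∃ r : ℝ, side r ∧ γ.vel p.2 = r • γ.vel p.1) ∧
      ∀ p' ∈ γ.selfInt, p' ≠ p → γ.TransverseAt p'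

/-- The stratum `Δᵈ`: one direct self-tangency (velocities point in the same direction). -/
def InDirectStratum (γ : C1Loop) : Prop := γ.HasOneSelfTangency (fun r => 0 < r)

/-- The stratum `Δⁱ`: one inverse self-tangency (velocities point in opposite directions). -/
def InInverseStratum (γ : C1Loop) : Prop := γ.HasOneSelfTangency (fun r => r < 0)

/-- The stratum `Δᵗ`: the only degeneracy of the immersion is one transverse triple point,
with parameters `a < b < c`. -/
def InTripleStratum (γ : C1Loop) (a b c : ℝ) : Prop :=
  γ.IsImmersion ∧ γ.selfInt.Finite ∧ (∀ p ∈ γ.selfInt, γ.TransverseAt p) ∧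
    γ.IsTriplePoint a b c ∧
    ∀ a' b' c', γ.IsTriplePoint a' b' c' → a' = a ∧ b' = b ∧ c' = c

/-- Near a triple point with parameters `a < b < c` the three branches of a nearby curve form a
small triangle, whose vertices are the intersection points of the branches `a, b` (parameters
`xa, xb`), `b, c` (parameters `yb, yc`) and `c, a` (parameters `zc, za`). The order `a, b, c` in
which the curve visits the sides orients the triangle: the side on branch `a` runs from `za` to
`xa`, the one on `b` from `xb` to `yb`, the one on `c` from `yc` to `zc`. The product below has the
sign `(-1)^(3 - m)`, where `m` is the number of sides on which this orientation agrees with that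
of the curve. -/
def TriangleOrientation (sgn : ℝ → Prop) (γ : C1Loop) (a b c ε : ℝ) : Prop :=
  ∃ xa za xb yb yc zc : ℝ,
    |xa - a| < ε ∧ |za - a| < ε ∧ |xb - b| < ε ∧ |yb - b| < ε ∧ |yc - c| < ε ∧ |zc - c| < ε ∧
    γ xa = γ xb ∧ γ yb = γ yc ∧ γ zc = γ za ∧
    sgn ((xa - za) * (yb - xb) * (zc - yc))

/-- The sign `(-1)^m` of the small triangle is `+1`. -/
def PositiveTriangle (γ : C1Loop) (a b c ε : ℝ) : Prop :=
  γ.TriangleOrientation (fun x => x < 0) a b c ε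

/-- The sign `(-1)^m` of the small triangle is `-1`. -/
def NegativeTriangle (γ : C1Loop) (a b c ε : ℝ) : Prop :=
  γ.TriangleOrientation (fun x => 0 < x) a b c ε

/-- A regular homotopy from `γ` to `ξ` that meets the discriminant only once, in a curve of the
self-tangency stratum `Δ`, in the positive direction: the number of double points increases
(by two). -/
def CrossesTangency (Δ : C1Loop → Prop) (γ ξ : C1Loop) : Prop :=
  ∃ P : Path γ ξ, ∃ t₀ : unitInterval, 0 < t₀ ∧ t₀ < 1 ∧
    (∀ t, t ≠ t₀ → (P t).IsGeneric) ∧ Δ (P t₀) ∧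
    ξ.selfInt.ncard = γ.selfInt.ncard + 2

/-- A regular homotopy from `γ` to `ξ` that meets the discriminant only once, in a curve with one
transverse triple point, in the positive direction: the vanishing triangle is negative and the
newborn triangle is positive. -/
def CrossesTriple (γ ξ : C1Loop) : Prop :=
  ∃ P : Path γ ξ, ∃ t₀ : unitInterval, 0 < t₀ ∧ t₀ < 1 ∧
    (∀ t, t ≠ t₀ → (P t).IsGeneric) ∧
    ∃ a b c : ℝ, (P t₀).InTripleStratum a b c ∧
      (∀ ε > 0, ∀ᶠ t in 𝓝[<] t₀, (P t).NegativeTriangle a b c ε) ∧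
      (∀ ε > 0, ∀ᶠ t in 𝓝[>] t₀, (P t).PositiveTriangle a b c ε)

/-- Arnold's representative curves. For `ω = 0` this is a figure eight. For `ω ≠ 0` it is a round
circle (`|ω| = 1`) or an epitrochoid with `|ω| - 1` small loops in its interior, traversed
counterclockwise for `ω > 0` and clockwise for `ω < 0`; its winding number is `ω`. -/
noncomputable def standardFun (ω : ℤ) (t : ℝ) : ℂ :=
  if ω = 0 then
    Complex.sin (2 * Real.pi * t) + Complex.sin (4 * Real.pi * t) * Complex.I
  else
    Complex.exp (2 * Real.pi * (ω.sign : ℂ) * t * Complex.I) +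
      (2 / (2 * (|ω| : ℤ) - 1) : ℂ) * Complex.exp (2 * Real.pi * (ω : ℂ) * t * Complex.I)

theorem exp_periodic_aux (m : ℤ) (t : ℝ) :
    Complex.exp (2 * Real.pi * (m : ℂ) * ((t + 1 : ℝ) : ℂ) * Complex.I) =
      Complex.exp (2 * Real.pi * (m : ℂ) * t * Complex.I) := by
  rw [show (2 * Real.pi * (m : ℂ) * ((t + 1 : ℝ) : ℂ) * Complex.I) =
      2 * Real.pi * (m : ℂ) * t * Complex.I + m * (2 * Real.pi * Complex.I) by push_cast; ring]
  exact Complex.exp_periodic.int_mul m _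

/-- Arnold's representative curve of winding number `ω` as a closed curve. -/
noncomputable def standardCurve (ω : ℤ) : C1Loop where
  toFun := standardFun ω
  periodic := by
    intro t
    unfold standardFun
    split_ifs with h
    · have h1 : (2 * Real.pi * ((t + 1 : ℝ) : ℂ)) = 2 * Real.pi * t + (1 : ℤ) * (2 * Real.pi) := by
        push_cast; ring
      have h2 : (4 * Real.pi * ((t + 1 : ℝ) : ℂ)) = 4 * Real.pi * t + (2 : ℤ) * (2 * Real.pi) := by
        push_cast; ring
      rw [h1, h2, Complex.sin_periodic.int_mul 1, Complex.sin_periodic.int_mul 2]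
    · rw [exp_periodic_aux, exp_periodic_aux]
  contDiff := by
    have hc : ContDiff ℝ 1 (fun t : ℝ => (t : ℂ)) := Complex.ofRealCLM.contDiff
    have he : ∀ a b : ℂ, ContDiff ℝ 1 (fun t : ℝ => Complex.exp (a * t * b)) := fun a b =>
      ((contDiff_const.mul hc).mul contDiff_const).cexp
    have hs : ∀ a : ℂ, ContDiff ℝ 1 (fun t : ℝ => Complex.sin (a * t)) := fun a =>
      (Complex.contDiff_sin.restrict_scalars ℝ).comp (contDiff_const.mul hc)
    unfold standardFun
    split_ifs with h
    · exact (hs _).add ((hs _).mul contDiff_const)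
    · exact (he _ _).add (contDiff_const.mul (he _ _))

/-- `γ.HasArnoldInvariants ω jp jm s` says that `J⁺(γ) = jp`, `J⁻(γ) = jm`, `St(γ) = s`, computed
along a generic path that starts at the representative curve of winding number `ω`: the path is a
succession of regular homotopies through generic immersions, which change nothing, and of
positive or negative crossings of the three strata of the discriminant. -/
inductive HasArnoldInvariants (ω : ℤ) : C1Loop → ℤ → ℤ → ℤ → Prop
  | standard : HasArnoldInvariants ω (standardCurve ω)
      (if ω = 0 then 0 else -2 * (|ω| - 1))
      (if ω = 0 then -1 else -3 * (|ω| - 1))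
      (if ω = 0 then 0 else |ω| - 1)
  | homotopy {γ ξ : C1Loop} {jp jm s : ℤ} : HasArnoldInvariants ω γ jp jm s →
      JoinedIn {ζ : C1Loop | ζ.IsGeneric} γ ξ → HasArnoldInvariants ω ξ jp jm s
  | direct_pos {γ ξ : C1Loop} {jp jm s : ℤ} : HasArnoldInvariants ω γ jp jm s →
      CrossesTangency InDirectStratum γ ξ → HasArnoldInvariants ω ξ (jp + 2) jm s
  | direct_neg {γ ξ : C1Loop} {jp jm s : ℤ} : HasArnoldInvariants ω γ jp jm s →
      CrossesTangency InDirectStratum ξ γ → HasArnoldInvariants ω ξ (jp - 2) jm s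
  | inverse_pos {γ ξ : C1Loop} {jp jm s : ℤ} : HasArnoldInvariants ω γ jp jm s →
      CrossesTangency InInverseStratum γ ξ → HasArnoldInvariants ω ξ jp (jm - 2) s
  | inverse_neg {γ ξ : C1Loop} {jp jm s : ℤ} : HasArnoldInvariants ω γ jp jm s →
      CrossesTangency InInverseStratum ξ γ → HasArnoldInvariants ω ξ jp (jm + 2) s
  | triple_pos {γ ξ : C1Loop} {jp jm s : ℤ} : HasArnoldInvariants ω γ jp jm s →
      CrossesTriple γ ξ → HasArnoldInvariants ω ξ jp jm (s + 1)
  | triple_neg {γ ξ : C1Loop} {jp jm s : ℤ} : HasArnoldInvariants ω γ jp jm s →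
      CrossesTriple ξ γ → HasArnoldInvariants ω ξ jp jm (s - 1)

/-- All generic immersions with `J⁺ = jp`, `J⁻ = jm`, `St = s` and winding number `ω`. -/
def genericWith (jp jm s ω : ℤ) : Set C1Loop :=
  {γ | γ.IsGeneric ∧ γ.HasWindingNumber ω ∧ HasArnoldInvariants ω γ jp jm s}

/-- A (non-empty) compartment: a path component, with respect to regular homotopy, of the set of
all generic immersions with given winding number and Arnold invariants. -/
def IsCompartment (C : Set C1Loop) (jp jm s ω : ℤ) : Prop :=
  ∃ γ ∈ genericWith jp jm s ω, C = pathComponentIn (genericWith jp jm s ω) γ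

/-! ### Truncated and renormalized tangent-point energies -/

/-- The intrinsic distance `d_γ(x, y)`: the length of the shortest arc of the curve that joins the
parameters `x` and `y` of the circle. -/
noncomputable def intrinsicDist (γ : C1Loop) (x y : ℝ) : ℝ :=
  ⨅ k : ℤ, |∫ τ in x..(y + k), ‖γ.vel τ‖|

/-- `Λ(γ)`, the least intrinsic distance of two distinct elements of `T(γ)` (`∞` if there are
none). -/
noncomputable def Lam (γ : C1Loop) : ℝ≥0∞ :=
  ⨅ a ∈ γ.selfIntParams, ⨅ b ∈ γ.selfIntParams, ⨅ _ : a ≠ b, ENNReal.ofReal (γ.intrinsicDist a b)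

/-- The set `Y_δ(γ)` of parameter pairs close to a self-intersection. -/
def nearSelfInt (γ : C1Loop) (δ : ℝ) : Set (ℝ × ℝ) :=
  {z | ∃ p ∈ γ.selfInt,
    (γ.intrinsicDist z.1 p.1 < δ ∧ γ.intrinsicDist z.2 p.2 < δ) ∨
    (γ.intrinsicDist z.1 p.2 < δ ∧ γ.intrinsicDist z.2 p.1 < δ)}

/-- The affine tangent line `ℓ(t) = γ(t) + ℝ γ'(t)`. -/
def tangentLine (γ : C1Loop) (t : ℝ) : Set ℂ := range (fun r : ℝ => γ t + r • γ.vel t)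

/-- The truncated tangent-point energy `TP_{q,δ}`, with values in `[0, ∞]`; the inner quotient is
`1 / r_tp[γ](γ(t), γ(s))`, with `z = (s, t)`. -/
noncomputable def TP (q δ : ℝ) (γ : C1Loop) : ℝ≥0∞ :=
  ∫⁻ z in (Ico (0 : ℝ) 1 ×ˢ Ico (0 : ℝ) 1) \ γ.nearSelfInt δ,
    ENNReal.ofReal
      ((2 * Metric.infDist (γ z.1) (γ.tangentLine z.2) / ‖γ z.2 - γ z.1‖ ^ 2) ^ q *
        (‖γ.vel z.1‖ * ‖γ.vel z.2‖))

/-- The rescaled energy `δ^{q-2} TP_{q,δ}`. -/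
noncomputable def rescaledTP (q δ : ℝ) (γ : C1Loop) : ℝ≥0∞ :=
  ENNReal.ofReal (δ ^ (q - 2)) * γ.TP q δ

/-- The renormalized tangent-point energy `R_q = lim_{δ → 0} δ^{q-2} TP_{q,δ}`. -/
noncomputable def renormTP (q : ℝ) (γ : C1Loop) : ℝ≥0∞ :=
  limUnder (𝓝[>] (0 : ℝ)) (fun δ => γ.rescaledTP q δ)

/-- The angle in `[0, π/2]` between the two tangent lines at the self-intersection `p`. -/
noncomputable def intAngle (γ : C1Loop) (p : ℝ × ℝ) : ℝ :=
  min (InnerProductGeometry.angle (γ.vel p.1) (γ.vel p.2))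
    (Real.pi - InnerProductGeometry.angle (γ.vel p.1) (γ.vel p.2))

/-- The curve belongs to the Sobolev-Slobodeckij space `W^{2-1/q,q}(ℝ/ℤ, ℝ²)`. For a curve of class
`C¹` this means that the Gagliardo seminorm of order `1 - 1/q` of its velocity is finite, the
kernel exponent being `1 + (1 - 1/q) q = q`. -/
def InSobolev (q : ℝ) (γ : C1Loop) : Prop :=
  ∫⁻ x in Ico (0 : ℝ) 1, ∫⁻ w in Icc (-(1 / 2) : ℝ) (1 / 2),
    ENNReal.ofReal (‖γ.vel (x + w) - γ.vel x‖ ^ q / |w| ^ q) < ∞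

/-- The admissible class `F(η, j±, s, ω)`. -/
def admissible (η : ℝ) (jp jm s ω : ℤ) : Set C1Loop :=
  {γ | γ ∈ genericWith jp jm s ω ∧ (∀ t, ‖γ.vel t‖ = 1) ∧ ENNReal.ofReal (2 * η) ≤ γ.Lam ∧
    ∀ u ∈ γ.selfIntParams, ∃ p v : ℂ, ∀ t ∈ Ioo (u - η) (u + η), γ t = p + (t - u) • v}

end C1Loop

/-- The angle function `F` (for the exponent `q`), `α ∈ (0, π/2]`. -/
noncomputable def angleF (q α : ℝ) : ℝ :=
  1 / (Real.sin α) ^ (q - 1) *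
    ((∫ z in (-Real.cot α)..(Real.tan (α / 2)),
        ((1 / (z ^ 2 + 1)) ^ q + ((z * Real.sin α + Real.cos α) / (z ^ 2 + 1)) ^ q)) +
     (∫ z in (Real.cot α)..(Real.cot (α / 2)),
        ((1 / (z ^ 2 + 1)) ^ q + ((z * Real.sin α - Real.cos α) / (z ^ 2 + 1)) ^ q)))

/-- Gamma convergence of functionals `E i` to `E₀` along a filter `l`: the liminf inequality for
all convergent families, and the existence of recovery families. -/
def GammaConverges {ι X : Type*} [TopologicalSpace X] (l : Filter ι) (E : ι → X → ℝ≥0∞)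
    (E₀ : X → ℝ≥0∞) : Prop :=
  ∀ x : X,
    (∀ ξ : ι → X, Tendsto ξ l (𝓝 x) → E₀ x ≤ liminf (fun i => E i (ξ i)) l) ∧
    ∃ ξ : ι → X, Tendsto ξ l (𝓝 x) ∧ limsup (fun i => E i (ξ i)) l ≤ E₀ x

/-!
An admissible curve has unit speed and is straight near its double points. Between two truncation
radii `δ ≤ η`, the tangent-point energy therefore changes only by the energy of finitely many
crossings of straight segments. That energy is homogeneous: in the coordinates given by one
arclength parameter and the quotient of the two, it splits into `∫ s ^ (1 - q)` over `δ ≤ s < η` and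
a function of the angle alone (`lintegral_lineDensity`, `C1Loop.TP_eq_add_sum`), which a change of
variables identifies with `angleF` (`angleF_eq_crossEnergy`). The energy truncated at radius `η` is
finite for a curve of the Sobolev class (`C1Loop.TP_lt_top`): near the diagonal the integrand is
bounded by a mean of difference quotients of the velocity, and elsewhere it is bounded, by
compactness. Hence the rescaled energies obey an exact formula for all `δ ≤ η`
(`C1Loop.rescaledTP_eq`), from which the limit and its value follow.

For the Gamma-convergence, the exact formula bounds the rescaled energy from below by the angle sum
times a factor which depends only on `δ` and tends to `1`. The angle sum is continuous in the `C¹`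
topology, since the crossings of a generic immersion persist, and no new ones appear, under small
`C¹` perturbations (`C1Loop.eventually_stable`). Constant families are recovery families.

For the minimizers, the number of crossings is constant on a compartment
(`C1Loop.ncard_dblPts_eq_of_joinedIn`), and the energy of a crossing is strictly increasing in the
absolute value of the cosine of its angle (`strictMonoOn_crossEnergy`). So a curve with right angles
only is a minimizer. For the converse no curve with right angles is needed, and the class may
contain none: a curve with an oblique crossing is improved within the class. Replacing the velocity
partly by a mean where the curve bends, away from its crossings, shortens the curve, and after
rescaling to length one its straight strands are longer than required (`C1Loop.exists_slack`). The
room so gained allows one strand to be turned slightly about an oblique crossing, with all other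
crossings kept (`C1Loop.exists_angleSum_lt`). Both steps perturb the curve by a small loop whose
velocity is controlled by that of the curve, so that after reparametrization by arclength the
competitor is again of the Sobolev class and in the same compartment
(`C1Loop.eventually_exists_competitor`).
-/

/-! ### The angle function -/

/-- The energy density of a transverse crossing of two straight strands, whose directions have
inner product `c`, along the ray on which the quotient of the arclength parameters is `t`. -/
noncomputable def crossKernel (q c t : ℝ) : ℝ :=
  (1 + |t| ^ q) * (√(1 - c ^ 2) / (1 + t ^ 2 - 2 * t * c)) ^ q

/-- The angle function as a function of the cosine `c` of the angle, written as an integral over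
the quotient of the arclength parameters of the two strands. -/
noncomputable def crossEnergy (q c : ℝ) : ℝ := ∫ t in (-1 : ℝ)..1, crossKernel q c t

theorem crossKernel_denom_pos {c : ℝ} (hc : |c| < 1) (t : ℝ) : 0 < 1 + t ^ 2 - 2 * t * c := by
  have := (sq_lt_one_iff_abs_lt_one c).2 hc
  nlinarith [sq_nonneg (t - c)]

theorem continuous_crossKernel {q c : ℝ} (hq : 2 < q) (hc : |c| < 1) :
    Continuous (crossKernel q c) := by
  unfold crossKernel
  refine (continuous_const.add (continuous_abs.rpow_const fun _ => Or.inr (by linarith))).mul ?_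
  refine Continuous.rpow_const ?_ fun _ => Or.inr (by linarith)
  exact continuous_const.div (by fun_prop) fun t => (crossKernel_denom_pos hc t).ne'

theorem crossKernel_pos {q c : ℝ} (hc : |c| < 1) (t : ℝ) : 0 < crossKernel q c t := by
  unfold crossKernel
  have h1 := crossKernel_denom_pos hc t
  have h2 : 0 < 1 - c ^ 2 := by linarith [(sq_lt_one_iff_abs_lt_one c).2 hc]
  positivity

theorem crossEnergy_pos {q c : ℝ} (hq : 2 < q) (hc : |c| < 1) : 0 < crossEnergy q c :=
  intervalIntegral.intervalIntegral_pos_of_pos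
    ((continuous_crossKernel hq hc).intervalIntegrable _ _) (crossKernel_pos hc) (by norm_num)

theorem crossEnergy_neg (q c : ℝ) : crossEnergy q (-c) = crossEnergy q c := by
  have := intervalIntegral.integral_comp_neg (a := -1) (b := 1) (crossKernel q c)
  rw [neg_neg] at this
  rw [crossEnergy, crossEnergy, ← this]
  congr 1
  ext t
  simp [crossKernel]

theorem crossEnergy_abs (q c : ℝ) : crossEnergy q |c| = crossEnergy q c := by
  rcases abs_choice c with h | h <;> rw [h]
  exact crossEnergy_neg q c

theorem continuousAt_crossEnergy {q c : ℝ} (hq : 2 < q) (hc : |c| < 1) :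
    ContinuousAt (crossEnergy q) c := by
  obtain ⟨k, hk, hk1⟩ := exists_between hc
  have hk0 : 0 < k := (abs_nonneg c).trans_lt hk
  -- the parameter is clamped to a compact interval, on which no denominator vanishes
  let P : ℝ → ℝ := fun x => max (-k) (min k x)
  have hP : ∀ x, |P x| < 1 := fun x => by
    have : |P x| ≤ k := abs_le.2 ⟨le_max_left _ _, max_le (by linarith) (min_le_left _ _)⟩
    linarith
  have hPc : Continuous P := by fun_prop
  have hcont : Continuous fun x => ∫ t in (-1 : ℝ)..1, crossKernel q (P x) t := by
    apply intervalIntegral.continuous_parametric_intervalIntegral_of_continuous'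
    unfold Function.uncurry crossKernel
    refine (continuous_const.add
      (continuous_snd.abs.rpow_const fun _ => Or.inr (by linarith))).mul ?_
    refine Continuous.rpow_const ?_ fun _ => Or.inr (by linarith)
    exact (by fun_prop : Continuous _).div (by fun_prop)
      fun z => (crossKernel_denom_pos (hP z.1) z.2).ne'
  refine hcont.continuousAt.congr ?_
  have : ∀ᶠ x in 𝓝 c, |x| < k := continuous_abs.continuousAt.eventually (gt_mem_nhds hk)
  filter_upwards [this] with x hx
  rw [abs_lt] at hx
  have : P x = x := by simp [P, hx.1.le, hx.2.le]
  simp only [this, crossEnergy]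

theorem angleF_eq_crossEnergy {q α : ℝ} (hq : 2 < q) (h0 : 0 < α) (h1 : α ≤ Real.pi / 2) :
    angleF q α = crossEnergy q (Real.cos α) := by
  have hpi := Real.pi_pos
  have hs : 0 < Real.sin α := Real.sin_pos_of_pos_of_lt_pi h0 (by linarith)
  have hc : 0 ≤ Real.cos α := Real.cos_nonneg_of_mem_Icc ⟨by linarith, h1⟩
  have hsc := Real.sin_sq_add_cos_sq α
  have hs2 : 0 < Real.sin (α / 2) := Real.sin_pos_of_pos_of_lt_pi (by linarith) (by linarith)
  have hc2 : 0 < Real.cos (α / 2) := Real.cos_pos_of_mem_Ioo ⟨by linarith, by linarith⟩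
  have e1 : Real.sin α = 2 * Real.sin (α / 2) * Real.cos (α / 2) := by
    rw [← Real.sin_two_mul]; ring_nf
  have e2 : Real.cos α = 2 * Real.cos (α / 2) ^ 2 - 1 := by
    rw [← Real.cos_two_mul]; ring_nf
  have e3 := Real.sin_sq_add_cos_sq (α / 2)
  have htan : Real.tan (α / 2) = (1 - Real.cos α) / Real.sin α := by
    rw [Real.tan_eq_sin_div_cos, div_eq_div_iff hc2.ne' hs.ne', e1, e2]
    nlinarith
  have hcot : Real.cot (α / 2) = (1 + Real.cos α) / Real.sin α := by
    rw [Real.cot_eq_cos_div_sin, div_eq_div_iff hs2.ne' hs.ne', e1, e2]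
    ring
  have hsq : √(1 - Real.cos α ^ 2) = Real.sin α := by
    rw [show 1 - Real.cos α ^ 2 = Real.sin α ^ 2 by linarith, Real.sqrt_sq hs.le]
  unfold angleF
  rw [htan, hcot, Real.cot_eq_cos_div_sin]
  generalize Real.sin α = s at *
  generalize Real.cos α = c at *
  have hc1 : |c| < 1 := by
    rw [← sq_lt_one_iff_abs_lt_one]; nlinarith
  let g : ℝ → ℝ := fun z => (1 / (z ^ 2 + 1)) ^ q + (|z * s + c| / (z ^ 2 + 1)) ^ q
  have hgc : Continuous g := by
    have : ∀ z : ℝ, z ^ 2 + 1 ≠ 0 := fun z => by positivity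
    refine Continuous.add ?_ ?_
    · exact Continuous.rpow_const (continuous_const.div (by fun_prop) this)
        fun _ => Or.inr (by linarith)
    · exact Continuous.rpow_const (Continuous.div (by fun_prop) (by fun_prop) this)
        fun _ => Or.inr (by linarith)
  have hk : ∀ z, s * crossKernel q c (s * z + c) = 1 / s ^ (q - 1) * g z := by
    intro z
    have hz : (0:ℝ) < z ^ 2 + 1 := by positivity
    have e : s / (1 + (s * z + c) ^ 2 - 2 * (s * z + c) * c) = (1 / (z ^ 2 + 1)) / s := by
      rw [show 1 + (s * z + c) ^ 2 - 2 * (s * z + c) * c = s * (s * (z ^ 2 + 1)) by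
        linear_combination -hsc]
      field_simp
    simp only [crossKernel, g, hsq, e]
    rw [show s * z + c = z * s + c by ring, show |z * s + c| / (z ^ 2 + 1) =
      |z * s + c| * (1 / (z ^ 2 + 1)) by ring, Real.mul_rpow (abs_nonneg _) (by positivity),
      Real.div_rpow (by positivity) hs.le, Real.rpow_sub_one hs.ne']
    field_simp
  have hsplit : crossEnergy q c = 1 / s ^ (q - 1) *
      ∫ z in (-((1 + c) / s))..((1 - c) / s), g z := by
    rw [← intervalIntegral.integral_const_mul]
    simp_rw [← hk]
    rw [intervalIntegral.integral_const_mul, intervalIntegral.integral_comp_mul_add _ hs.ne',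
      smul_eq_mul, ← mul_assoc, mul_inv_cancel₀ hs.ne', one_mul, crossEnergy]
    congr 1 <;> field_simp <;> ring
  have hle : c / s ≤ (1 + c) / s := by gcongr; linarith
  have hle' : -(c / s) ≤ (1 - c) / s := by
    rw [← neg_div]; gcongr; linarith [(abs_lt.1 hc1).2]
  have hi : ∀ a b, IntervalIntegrable g volume a b := fun a b => hgc.intervalIntegrable a b
  rw [hsplit, ← intervalIntegral.integral_add_adjacent_intervals (hi _ (-(c / s))) (hi _ _),
    ← intervalIntegral.integral_comp_neg, add_comm]
  congr 2
  · refine intervalIntegral.integral_congr fun z hz => ?_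
    rw [uIcc_of_le hle] at hz
    have : 0 ≤ z * s - c := by linarith [(div_le_iff₀ hs).1 hz.1]
    simp only [g]
    rw [show -z * s + c = -(z * s - c) by ring, abs_neg, abs_of_nonneg this, neg_sq]
  · refine intervalIntegral.integral_congr fun z hz => ?_
    rw [uIcc_of_le hle'] at hz
    have h2 : -(c / s) * s ≤ z * s := by have := hz.1; gcongr
    have : 0 ≤ z * s + c := by
      rw [neg_mul, div_mul_cancel₀ _ hs.ne'] at h2; linarith
    simp only [g]
    rw [abs_of_nonneg this]

/-- The integrand of the angle function in polar coordinates of the plane spanned by the two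
strands: `E` is the sum and `m` the difference of the normalized squared distances to the two
lines. -/
noncomputable def polarKernel (q m E : ℝ) : ℝ :=
  ((E + m) / 2) ^ (q - 1) + ((E - m) / 2) ^ (q / 2) * ((E + m) / 2) ^ (q / 2 - 1)

theorem continuous_polarKernel {q : ℝ} (hq : 2 < q) :
    Continuous fun z : ℝ × ℝ => polarKernel q z.1 z.2 := by
  unfold polarKernel
  refine Continuous.add ?_ (Continuous.mul ?_ ?_) <;>
  exact Continuous.rpow_const (by fun_prop) fun _ => Or.inr (by linarith)

theorem strictMonoOn_polarKernel {q m : ℝ} (hq : 2 < q) (hm : 0 ≤ m) :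
    StrictMonoOn (polarKernel q m) (Ici m) := by
  intro x hx y hy hxy
  simp only [mem_Ici] at hx hy
  unfold polarKernel
  apply add_lt_add_of_lt_of_le
  · exact Real.rpow_lt_rpow (by linarith) (by linarith) (by linarith)
  · apply mul_le_mul (Real.rpow_le_rpow (by linarith) (by linarith) (by linarith))
      (Real.rpow_le_rpow (by linarith) (by linarith) (by linarith))
    · exact Real.rpow_nonneg (by linarith) _
    · exact Real.rpow_nonneg (by linarith) _

theorem convexOn_polarKernel {q m : ℝ} (hq : 2 < q) (hm : 0 ≤ m) :
    ConvexOn ℝ (Ici m) (polarKernel q m) := by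
  refine MonotoneOn.convexOn_of_deriv (convex_Ici m)
    ((continuous_polarKernel hq).comp (Continuous.prodMk_right m)).continuousOn ?_ ?_
  all_goals rw [interior_Ici]
  all_goals
    have hd : ∀ E ∈ Ioi m, HasDerivAt (polarKernel q m)
        ((q - 1) / 2 * ((E + m) / 2) ^ (q - 2) + 1 / 2 * (((E - m) / 2) ^ (q / 2 - 1) *
          ((E + m) / 2) ^ (q / 2 - 1) * (q / 2 + (q / 2 - 1) * (1 - m / ((E + m) / 2))))) E := by
      intro E hE
      have hE : m < E := hE
      have h1 : 0 < (E - m) / 2 := by linarith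
      have h2 : 0 < (E + m) / 2 := by linarith
      have d1 : HasDerivAt (fun E : ℝ => (E + m) / 2) (1 / 2) E :=
        ((hasDerivAt_id E).add_const m).div_const 2
      have d2 : HasDerivAt (fun E : ℝ => (E - m) / 2) (1 / 2) E :=
        ((hasDerivAt_id E).sub_const m).div_const 2
      have := (d1.rpow_const (p := q - 1) (Or.inl h2.ne')).add
        ((d2.rpow_const (p := q / 2) (Or.inl h1.ne')).mul
          (d1.rpow_const (p := q / 2 - 1) (Or.inl h2.ne')))
      refine this.congr_deriv ?_
      rw [show q - 1 - 1 = q - 2 by ring, Real.rpow_sub_one h2.ne' (q / 2 - 1),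
        Real.rpow_sub_one h1.ne' (q / 2), show 1 - m / ((E + m) / 2) =
          (E - m) / 2 / ((E + m) / 2) by
            rw [eq_div_iff h2.ne', sub_mul, div_mul_cancel₀ _ h2.ne']; ring]
      generalize (E - m) / 2 = X at *
      generalize (E + m) / 2 = Y at *
      field_simp
  · exact fun E hE => (hd E hE).differentiableAt.differentiableWithinAt
  · intro x hx y hy hxy
    have hx' : m < x := hx
    rw [(hd x hx).deriv, (hd y hy).deriv]
    have p1 : 0 < (x - m) / 2 := by linarith
    have p2 : 0 < (x + m) / 2 := by linarith
    have p3 : 0 ≤ 1 - m / ((x + m) / 2) := by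
      rw [sub_nonneg, div_le_one p2]; linarith
    have q1 : 0 < q - 1 := by linarith
    have q2 : 0 < q - 2 := by linarith
    have q3 : 0 < q / 2 - 1 := by linarith
    have p4 : 0 ≤ q / 2 + (q / 2 - 1) * (1 - m / ((x + m) / 2)) := by positivity
    have y1 : 0 < (y - m) / 2 := by linarith
    have y2 : 0 < (y + m) / 2 := by linarith
    gcongr

/-- A weak majorization inequality for increasing convex functions. -/
theorem ConvexOn.add_lt_add_of_weak_majorization {h : ℝ → ℝ} {m a b a' b' : ℝ}
    (hc : ConvexOn ℝ (Ici m) h) (hm : StrictMonoOn h (Ici m)) (ha : m ≤ a) (ha' : m ≤ a')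
    (hab' : a' ≤ b') (hb : b' < b) (hs : a' + b' < a + b) : h a' + h b' < h a + h b := by
  rcases le_or_gt a' a with h1 | h1
  · exact add_lt_add_of_le_of_lt (hm.monotoneOn ha' ha h1)
      (hm (mem_Ici.2 (by linarith)) (mem_Ici.2 (by linarith)) hb)
  · -- moving `a` up to `a'` and `b` down by the same amount decreases the sum
    have h2 : h b' < h (a + b - a') := hm (mem_Ici.2 (by linarith)) (mem_Ici.2 (by linarith))
      (by linarith)
    have hD : 0 < b - a := by linarith
    have hw1 : 0 ≤ (b - a') / (b - a) := div_nonneg (by linarith) hD.le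
    have hw2 : 0 ≤ (a' - a) / (b - a) := div_nonneg (by linarith) hD.le
    have hw : (b - a') / (b - a) + (a' - a) / (b - a) = 1 := by field_simp; ring
    have c1 := hc.2 (mem_Ici.2 ha) (mem_Ici.2 (show m ≤ b by linarith)) hw1 hw2 hw
    have c2 := hc.2 (mem_Ici.2 ha) (mem_Ici.2 (show m ≤ b by linarith)) hw2 hw1
      (by rw [add_comm]; exact hw)
    simp only [smul_eq_mul] at c1 c2
    rw [show (b - a') / (b - a) * a + (a' - a) / (b - a) * b = a' by field_simp; ring] at c1
    rw [show (a' - a) / (b - a) * a + (b - a') / (b - a) * b = a + b - a' by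
      field_simp; ring] at c2
    have c3 : (b - a') / (b - a) * h a + (a' - a) / (b - a) * h b +
      ((a' - a) / (b - a) * h a + (b - a') / (b - a) * h b) = h a + h b := by field_simp; ring
    linarith

/-- The sum of the normalized squared distances of a unit vector to the two lines of a crossing of
angle `α`. -/
noncomputable def polarSum (α x : ℝ) : ℝ := (1 + Real.cos (2 * x) * Real.cos α) / Real.sin α

theorem crossEnergy_eq_polar {q α : ℝ} (hq : 2 < q) (h0 : 0 < α) (h1 : α < Real.pi) :
    crossEnergy q (Real.cos α) =
      ∫ x in (-(Real.pi / 2))..0, polarKernel q (-Real.sin (2 * x)) (polarSum α x) := by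
  have hs : 0 < Real.sin α := Real.sin_pos_of_pos_of_lt_pi h0 h1
  have hsc := Real.sin_sq_add_cos_sq α
  have hc1 : |Real.cos α| < 1 := by rw [← sq_lt_one_iff_abs_lt_one]; nlinarith
  have hsq : √(1 - Real.cos α ^ 2) = Real.sin α := by
    rw [show 1 - Real.cos α ^ 2 = Real.sin α ^ 2 by linarith, Real.sqrt_sq hs.le]
  have hcos : ∀ x ∈ uIcc (-(Real.pi / 2)) 0, 0 < Real.cos (x + α / 2) := by
    intro x hx
    rw [uIcc_of_le (by linarith)] at hx
    exact Real.cos_pos_of_mem_Ioo ⟨by linarith [hx.1], by linarith [hx.2]⟩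
  let f : ℝ → ℝ := fun x => Real.cos (x - α / 2) / Real.cos (x + α / 2)
  have hf : ∀ x ∈ uIcc (-(Real.pi / 2)) 0,
      HasDerivAt f (Real.sin α / Real.cos (x + α / 2) ^ 2) x := by
    intro x hx
    have hx0 := (hcos x hx).ne'
    have := ((hasDerivAt_id x).sub_const (α / 2)).cos.div ((hasDerivAt_id x).add_const (α / 2)).cos
      hx0
    refine this.congr_deriv ?_
    congr 1
    have : Real.sin α = Real.sin ((x + α / 2) - (x - α / 2)) := by ring_nf
    rw [this, Real.sin_sub (x + α / 2) (x - α / 2)]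
    simp only [id]
    ring
  have hfa : f (-(Real.pi / 2)) = -1 := by
    have : 0 < Real.sin (α / 2) := Real.sin_pos_of_pos_of_lt_pi (by linarith) (by linarith)
    simp only [f]
    rw [show -(Real.pi / 2) - α / 2 = -(α / 2 + Real.pi / 2) by ring, Real.cos_neg,
      Real.cos_add_pi_div_two, show -(Real.pi / 2) + α / 2 = α / 2 - Real.pi / 2 by ring,
      Real.cos_sub_pi_div_two, neg_div, div_self this.ne']
  have hfb : f 0 = 1 := by
    have : 0 < Real.cos (α / 2) := Real.cos_pos_of_mem_Ioo ⟨by linarith, by linarith⟩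
    simp [f, this.ne']
  have key := intervalIntegral.integral_comp_mul_deriv hf
    (ContinuousOn.div continuousOn_const (by fun_prop) fun x hx => (pow_pos (hcos x hx) 2).ne')
    (continuous_crossKernel hq hc1)
  rw [hfa, hfb] at key
  rw [crossEnergy, ← key]
  refine intervalIntegral.integral_congr fun x hx => ?_
  have hC := hcos x hx
  simp only [Function.comp, crossKernel, hsq, f]
  have e1 : (polarSum α x + -Real.sin (2 * x)) / 2 = Real.cos (x + α / 2) ^ 2 / Real.sin α := by
    rw [Real.cos_sq, polarSum, show 2 * (x + α / 2) = 2 * x + α by ring, Real.cos_add]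
    field_simp
    ring
  have e2 : (polarSum α x - -Real.sin (2 * x)) / 2 = Real.cos (x - α / 2) ^ 2 / Real.sin α := by
    rw [Real.cos_sq, polarSum, show 2 * (x - α / 2) = 2 * x - α by ring, Real.cos_sub]
    field_simp
    ring
  have e3 : Real.cos (x + α / 2) ^ 2 + Real.cos (x - α / 2) ^ 2 -
      2 * Real.cos α * Real.cos (x + α / 2) * Real.cos (x - α / 2) = Real.sin α ^ 2 := by
    have hp := Real.sin_sq_add_cos_sq (x + α / 2)
    have hr := Real.sin_sq_add_cos_sq (x - α / 2)
    have e4 : Real.sin α = Real.sin ((x + α / 2) - (x - α / 2)) := by ring_nf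
    have e5 : Real.cos α = Real.cos ((x + α / 2) - (x - α / 2)) := by ring_nf
    rw [e4, e5, Real.sin_sub (x + α / 2) (x - α / 2), Real.cos_sub (x + α / 2) (x - α / 2)]
    generalize Real.cos (x + α / 2) = A at *
    generalize Real.cos (x - α / 2) = B at *
    generalize Real.sin (x + α / 2) = A' at *
    generalize Real.sin (x - α / 2) = B' at *
    have hp' : A' ^ 2 = 1 - A ^ 2 := by linarith
    have hr' : B' ^ 2 = 1 - B ^ 2 := by linarith
    linear_combination (-B ^ 2) * hp' - A ^ 2 * hr'
  unfold polarKernel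
  rw [e1, e2]
  generalize Real.cos (x + α / 2) = A at *
  generalize Real.cos (x - α / 2) = B at *
  have e4 : Real.sin α / (1 + (B / A) ^ 2 - 2 * (B / A) * Real.cos α) = A ^ 2 / Real.sin α := by
    rw [show 1 + (B / A) ^ 2 - 2 * (B / A) * Real.cos α = Real.sin α ^ 2 / A ^ 2 by
      rw [← e3]; field_simp]
    field_simp
  rw [e4]
  have e5 : |B / A| ^ q = (B ^ 2 / Real.sin α) ^ (q / 2) / (A ^ 2 / Real.sin α) ^ (q / 2) := by
    rw [← Real.div_rpow (by positivity) (by positivity), show B ^ 2 / Real.sin α /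
      (A ^ 2 / Real.sin α) = |B / A| ^ (2 : ℝ) by
        rw [Real.rpow_two, sq_abs]; field_simp, ← Real.rpow_mul (abs_nonneg _)]
    congr 1; ring
  rw [e5]
  have hP : 0 < A ^ 2 / Real.sin α := by positivity
  rw [show Real.sin α / A ^ 2 = (A ^ 2 / Real.sin α)⁻¹ by rw [inv_div]]
  generalize A ^ 2 / Real.sin α = P at *
  rw [Real.rpow_sub_one hP.ne' q, Real.rpow_sub_one hP.ne' (q / 2)]
  have e6 : P ^ q = P ^ (q / 2) * P ^ (q / 2) := by rw [← Real.rpow_add hP]; congr 1; ring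
  rw [e6]
  have := Real.rpow_pos_of_pos hP (q / 2)
  field_simp

theorem polarSum_mem {α x : ℝ} (h0 : 0 < α) (h1 : α < Real.pi) :
    -Real.sin (2 * x) ≤ polarSum α x := by
  have hs : 0 < Real.sin α := Real.sin_pos_of_pos_of_lt_pi h0 h1
  rw [polarSum, le_div_iff₀ hs]
  have := Real.neg_one_le_cos (2 * x - α)
  rw [Real.cos_sub] at this
  linarith

/-- The crossing energy strictly decreases as the angle increases to `π / 2`. In polar
coordinates, the integrand is a convex increasing function of a sum of squared distances of the
form `C ± y S`, where `C = 1 / sin α` and `S = cot α` decrease in `α`, and the points with opposite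
signs are paired: a larger `C` and a larger spread `y S` both increase the sum of the two values. -/
theorem crossEnergy_cos_lt {q α β : ℝ} (hq : 2 < q) (h0 : 0 < α) (hαβ : α < β)
    (h1 : β ≤ Real.pi / 2) : crossEnergy q (Real.cos β) < crossEnergy q (Real.cos α) := by
  have hpi := Real.pi_pos
  have hsym : ∀ γ, 0 < γ → γ < Real.pi → 2 * crossEnergy q (Real.cos γ) =
      ∫ x in (-(Real.pi / 2))..0, (polarKernel q (-Real.sin (2 * x)) (polarSum γ x) +
        polarKernel q (-Real.sin (2 * x)) (polarSum γ (-(Real.pi / 2) - x))) := by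
    intro γ g0 g1
    have hcs : Continuous (polarSum γ) := by unfold polarSum; fun_prop
    have hc : ∀ h : ℝ → ℝ, Continuous h → IntervalIntegrable
        (fun x => polarKernel q (-Real.sin (2 * x)) (h x)) volume (-(Real.pi / 2)) 0 :=
      fun h hh => ((continuous_polarKernel hq).comp
        (by fun_prop : Continuous fun x => (-Real.sin (2 * x), h x))).intervalIntegrable _ _
    rw [intervalIntegral.integral_add (hc _ hcs) (hc _ (by fun_prop)), two_mul,
      crossEnergy_eq_polar hq g0 g1]
    congr 1
    have := intervalIntegral.integral_comp_sub_left (a := -(Real.pi / 2)) (b := 0)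
      (fun x => polarKernel q (-Real.sin (2 * x)) (polarSum γ x)) (-(Real.pi / 2))
    rw [sub_zero, sub_self] at this
    rw [← this]
    congr 1
    ext x
    rw [show 2 * (-(Real.pi / 2) - x) = -(2 * x + Real.pi) by ring, Real.sin_neg, Real.sin_add_pi]
    simp
  suffices h : 2 * crossEnergy q (Real.cos β) < 2 * crossEnergy q (Real.cos α) by linarith
  have hs : 0 < Real.sin α := Real.sin_pos_of_pos_of_lt_pi h0 (by linarith)
  have hsl : Real.sin α < Real.sin β := Real.sin_lt_sin_of_lt_of_le_pi_div_two (by linarith) h1 hαβ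
  have hcl : Real.cos β < Real.cos α := Real.cos_lt_cos_of_nonneg_of_le_pi_div_two h0.le h1 hαβ
  have hcb : 0 ≤ Real.cos β := Real.cos_nonneg_of_mem_Icc ⟨by linarith, h1⟩
  have hlt : ∀ x ∈ Icc (-(Real.pi / 2)) 0,
      polarKernel q (-Real.sin (2 * x)) (polarSum β x) +
        polarKernel q (-Real.sin (2 * x)) (polarSum β (-(Real.pi / 2) - x)) <
      polarKernel q (-Real.sin (2 * x)) (polarSum α x) +
        polarKernel q (-Real.sin (2 * x)) (polarSum α (-(Real.pi / 2) - x)) := by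
    intro x hx
    have hm : 0 ≤ -Real.sin (2 * x) := by
      have := Real.sin_nonneg_of_nonneg_of_le_pi (x := -(2 * x)) (by linarith [hx.2])
        (by linarith [hx.1])
      rwa [Real.sin_neg] at this
    have hsh : ∀ γ, polarSum γ (-(Real.pi / 2) - x) =
        (1 - Real.cos (2 * x) * Real.cos γ) / Real.sin γ := by
      intro γ
      rw [polarSum, show 2 * (-(Real.pi / 2) - x) = -(2 * x + Real.pi) by ring, Real.cos_neg,
        Real.cos_add_pi]
      ring
    have hsin : Real.sin (2 * (-(Real.pi / 2) - x)) = Real.sin (2 * x) := by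
      rw [show 2 * (-(Real.pi / 2) - x) = -(2 * x + Real.pi) by ring, Real.sin_neg, Real.sin_add_pi]
      simp
    have mem1 : ∀ γ, 0 < γ → γ < Real.pi → -Real.sin (2 * x) ≤ polarSum γ x :=
      fun γ g0 g1 => polarSum_mem g0 g1
    have mem2 : ∀ γ, 0 < γ → γ < Real.pi →
        -Real.sin (2 * x) ≤ polarSum γ (-(Real.pi / 2) - x) := fun γ g0 g1 => by
      rw [← hsin]; exact polarSum_mem g0 g1
    have hconv := convexOn_polarKernel hq hm
    have hmono := strictMonoOn_polarKernel hq hm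
    have hinv : 1 / Real.sin β < 1 / Real.sin α := one_div_lt_one_div_of_lt hs hsl
    have hcot : Real.cos β / Real.sin β ≤ Real.cos α / Real.sin α :=
      div_le_div₀ (hcb.trans hcl.le) hcl.le hs hsl.le
    have hcot0 : 0 ≤ Real.cos β / Real.sin β := div_nonneg hcb (hs.trans hsl).le
    have d1 : ∀ γ, polarSum γ x = 1 / Real.sin γ + Real.cos (2 * x) *
      (Real.cos γ / Real.sin γ) := fun γ => by rw [polarSum]; ring
    have d2 : ∀ γ, polarSum γ (-(Real.pi / 2) - x) = 1 / Real.sin γ - Real.cos (2 * x) *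
      (Real.cos γ / Real.sin γ) := fun γ => by rw [hsh]; ring
    have a1 := mem1 α h0 (by linarith)
    have a2 := mem2 α h0 (by linarith)
    have b1 := mem1 β (by linarith) (by linarith)
    have b2 := mem2 β (by linarith) (by linarith)
    rw [d1] at a1 b1
    rw [d2] at a2 b2
    rw [d1, d1, d2, d2]
    rcases le_total 0 (Real.cos (2 * x)) with hy | hy
    · rw [add_comm (polarKernel q _ (1 / Real.sin β + _)),
        add_comm (polarKernel q _ (1 / Real.sin α + _))]
      refine hconv.add_lt_add_of_weak_majorization hmono a2 b2 ?_ ?_ ?_ <;> nlinarith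
    · refine hconv.add_lt_add_of_weak_majorization hmono a1 b1 ?_ ?_ ?_ <;> nlinarith
  rw [hsym β (by linarith) (by linarith), hsym α h0 (by linarith)]
  have hcont : ∀ γ, ContinuousOn (fun x => polarKernel q (-Real.sin (2 * x)) (polarSum γ x) +
      polarKernel q (-Real.sin (2 * x)) (polarSum γ (-(Real.pi / 2) - x)))
      (Icc (-(Real.pi / 2)) 0) := by
    intro γ
    have hcs : Continuous (polarSum γ) := by unfold polarSum; fun_prop
    have hc : ∀ h : ℝ → ℝ, Continuous h → Continuous
        (fun x => polarKernel q (-Real.sin (2 * x)) (h x)) :=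
      fun h hh => (continuous_polarKernel hq).comp
        (by fun_prop : Continuous fun x => (-Real.sin (2 * x), h x))
    exact ((hc _ hcs).add (hc _ (by fun_prop))).continuousOn
  exact intervalIntegral.integral_lt_integral_of_continuousOn_of_le_of_exists_lt (by linarith)
    (hcont β) (hcont α) (fun x hx => (hlt x (Ioc_subset_Icc_self hx)).le)
    ⟨0, by constructor <;> linarith, hlt 0 (by constructor <;> linarith)⟩

/-- The crossing energy is a strictly increasing function of the cosine of the angle. -/
theorem strictMonoOn_crossEnergy {q : ℝ} (hq : 2 < q) : StrictMonoOn (crossEnergy q) (Ico 0 1) := by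
  intro c hc d hd hcd
  rw [← Real.cos_arccos (by linarith [hc.1]) hc.2.le,
    ← Real.cos_arccos (by linarith [hd.1]) hd.2.le]
  exact crossEnergy_cos_lt hq (Real.arccos_pos.2 hd.2)
    (Real.arccos_lt_arccos (by linarith [hc.1]) hcd hd.2.le) (Real.arccos_le_pi_div_two.2 hc.1)

namespace C1Loop

/-! ### The `C¹` topology -/

theorem apply_add_int (γ : C1Loop) (x : ℝ) (k : ℤ) : γ (x + k) = γ x := by
  simpa using γ.periodic.int_mul k x

theorem apply_fract (γ : C1Loop) (x : ℝ) : γ (Int.fract x) = γ x := by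
  rw [← γ.apply_add_int (Int.fract x) ⌊x⌋, Int.fract_add_floor]

theorem hasDerivAt (γ : C1Loop) (t : ℝ) : HasDerivAt γ (γ.vel t) t :=
  (γ.contDiff.differentiable (by norm_num) t).hasDerivAt

theorem continuous (γ : C1Loop) : Continuous γ := γ.contDiff.continuous

theorem continuous_vel (γ : C1Loop) : Continuous γ.vel := γ.contDiff.continuous_deriv le_rfl

theorem vel_periodic (γ : C1Loop) : Function.Periodic γ.vel 1 := by
  intro t
  have h1 := (γ.hasDerivAt (t + 1)).scomp t ((hasDerivAt_id t).add_const 1)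
  have h2 : (γ : ℝ → ℂ) ∘ (fun x => id x + 1) = γ := by ext x; exact γ.periodic x
  rw [h2] at h1
  simpa using h1.unique (γ.hasDerivAt t)

theorem vel_add_int (γ : C1Loop) (x : ℝ) (k : ℤ) : γ.vel (x + k) = γ.vel x := by
  simpa using γ.vel_periodic.int_mul k x

theorem vel_fract (γ : C1Loop) (x : ℝ) : γ.vel (Int.fract x) = γ.vel x := by
  rw [← γ.vel_add_int (Int.fract x) ⌊x⌋, Int.fract_add_floor]

theorem hasBasis_nhds (γ : C1Loop) : (𝓝 γ).HasBasis (fun ε : ℝ => 0 < ε)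
    (fun ε => {ζ : C1Loop | (∀ t, ‖ζ t - γ t‖ < ε) ∧ ∀ t, ‖ζ.vel t - γ.vel t‖ < ε}) := by
  have hb := fun f => UniformFun.hasBasis_nhds_of_basis ℝ ℂ f Metric.uniformity_basis_dist
  rw [nhds_induced, nhds_prod_eq]
  have h := (((hb (UniformFun.ofFun γ.toFun)).prod_same_index
    (hb (UniformFun.ofFun γ.vel)) ?_).comap
    (fun γ : C1Loop => (UniformFun.ofFun γ.toFun, UniformFun.ofFun γ.vel)))
  · refine h.congr (fun _ => Iff.rfl) fun ε _ => ?_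
    ext ζ
    simp only [UniformFun.gen, mem_preimage, mem_prod, mem_ofPred_eq, dist_eq_norm,
      UniformFun.toFun_ofFun]
    simp only [norm_sub_rev]
  · intro ε δ hε hδ
    refine ⟨min ε δ, lt_min hε hδ, ?_, ?_⟩
    · intro f hf x
      have := hf x
      simp only [mem_ofPred_eq] at this ⊢
      exact lt_of_lt_of_le this (min_le_left _ _)
    · intro f hf x
      have := hf x
      simp only [mem_ofPred_eq] at this ⊢
      exact lt_of_lt_of_le this (min_le_right _ _)

theorem eventually_near (γ : C1Loop) {ε : ℝ} (hε : 0 < ε) :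
    ∀ᶠ ζ in 𝓝 γ, (∀ t, ‖ζ t - γ t‖ < ε) ∧ ∀ t, ‖ζ.vel t - γ.vel t‖ < ε :=
  γ.hasBasis_nhds.mem_of_mem hε

theorem continuous_eval : Continuous fun z : C1Loop × ℝ => z.1 z.2 := by
  rw [continuous_iff_continuousAt]
  rintro ⟨γ, t⟩
  rw [ContinuousAt, Metric.tendsto_nhds]
  intro ε hε
  rw [nhds_prod_eq]
  filter_upwards [(γ.eventually_near (half_pos hε)).prod_mk
    (Metric.tendsto_nhds.1 γ.continuous.continuousAt (ε / 2) (half_pos hε))] with z hz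
  calc dist (z.1 z.2) (γ t) ≤ dist (z.1 z.2) (γ z.2) + dist (γ z.2) (γ t) := dist_triangle _ _ _
    _ < ε / 2 + ε / 2 := add_lt_add (by rw [dist_eq_norm]; exact hz.1.1 _) hz.2
    _ = ε := by ring

theorem continuous_eval_vel : Continuous fun z : C1Loop × ℝ => z.1.vel z.2 := by
  rw [continuous_iff_continuousAt]
  rintro ⟨γ, t⟩
  rw [ContinuousAt, Metric.tendsto_nhds]
  intro ε hε
  rw [nhds_prod_eq]
  filter_upwards [(γ.eventually_near (half_pos hε)).prod_mk
    (Metric.tendsto_nhds.1 γ.continuous_vel.continuousAt (ε / 2) (half_pos hε))] with z hz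
  calc dist (z.1.vel z.2) (γ.vel t) ≤ dist (z.1.vel z.2) (γ.vel z.2) + dist (γ.vel z.2) (γ.vel t) :=
        dist_triangle _ _ _
    _ < ε / 2 + ε / 2 := add_lt_add (by rw [dist_eq_norm]; exact hz.1.2 _) hz.2
    _ = ε := by ring

/-- Curves near `γ` in `C¹` are uniformly close to affine near a given parameter. -/
theorem eventually_norm_sub_sub_le (γ : C1Loop) (u : ℝ) {κ : ℝ} (hκ : 0 < κ) :
    ∃ r > 0, ∀ᶠ ζ in 𝓝 γ, ∀ x ∈ Metric.ball u r, ∀ y ∈ Metric.ball u r,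
      ‖ζ x - ζ y - (x - y) • γ.vel u‖ ≤ κ * |x - y| := by
  obtain ⟨r, hr, h⟩ := Metric.continuousAt_iff.1 (γ.continuous_vel.continuousAt (x := u)) (κ / 2)
    (half_pos hκ)
  refine ⟨r, hr, ?_⟩
  filter_upwards [γ.eventually_near (half_pos hκ)] with ζ hζ x hx y hy
  have hd : ∀ t ∈ Metric.ball u r, HasDerivWithinAt (fun t => ζ t - t • γ.vel u)
      (ζ.vel t - γ.vel u) (Metric.ball u r) t := fun t _ => by
    have := ((ζ.hasDerivAt t).sub ((hasDerivAt_id t).smul_const (γ.vel u))).hasDerivWithinAt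
      (s := Metric.ball u r)
    rw [one_smul] at this
    exact this
  have := (convex_ball u r).norm_image_sub_le_of_norm_hasDerivWithin_le (C := κ) hd
    (fun t ht => ?_) hy hx
  · rw [Real.norm_eq_abs] at this
    refine le_trans (le_of_eq ?_) this
    congr 1
    rw [sub_smul]; abel
  · calc ‖ζ.vel t - γ.vel u‖ ≤ ‖ζ.vel t - γ.vel t‖ + ‖γ.vel t - γ.vel u‖ :=
        norm_sub_le_norm_sub_add_norm_sub _ _ _
      _ ≤ κ / 2 + κ / 2 := add_le_add (hζ.2 t).le (by rw [← dist_eq_norm]; exact (h ht).le)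
      _ = κ := by ring

/-- Curves near an immersion are injective near a given parameter. -/
theorem eventually_eq_of_apply_eq (γ : C1Loop) (hγ : γ.IsImmersion) {x y : ℝ} {m : ℤ}
    (hm : x - y = m) : ∀ᶠ w : C1Loop × ℝ × ℝ in 𝓝 (γ, x, y),
      w.1 w.2.1 = w.1 w.2.2 → w.2.1 - w.2.2 = m := by
  have hv : 0 < ‖γ.vel y‖ := norm_pos_iff.2 (hγ y)
  obtain ⟨r, hr, h⟩ := γ.eventually_norm_sub_sub_le y (half_pos hv)
  have h1 : ∀ᶠ s : ℝ in 𝓝 x, s - (m : ℝ) ∈ Metric.ball y r := by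
    have : Tendsto (fun s : ℝ => s - (m : ℝ)) (𝓝 x) (𝓝 (x - m)) :=
      (continuous_id.sub continuous_const).continuousAt
    rw [show x - m = y by linarith] at this
    exact this (Metric.ball_mem_nhds y hr)
  rw [nhds_prod_eq, nhds_prod_eq]
  filter_upwards [h.prod_mk (h1.prod_mk (Metric.ball_mem_nhds y hr))] with w hw he
  have := hw.1 _ hw.2.1 _ hw.2.2
  rw [show w.2.1 - (m : ℝ) = w.2.1 + ((-m : ℤ) : ℝ) by push_cast; ring, w.1.apply_add_int, he,
    sub_self, zero_sub, norm_neg, norm_smul, Real.norm_eq_abs] at this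
  have h3 : |w.2.1 + ((-m : ℤ) : ℝ) - w.2.2| = 0 := by
    have := abs_nonneg (w.2.1 + ((-m : ℤ) : ℝ) - w.2.2)
    nlinarith
  rw [abs_eq_zero] at h3
  push_cast at h3
  linarith

theorem eventually_apply_ne {γ : C1Loop} {x y : ℝ} (h : γ x ≠ γ y) :
    ∀ᶠ w : C1Loop × ℝ × ℝ in 𝓝 (γ, x, y), w.1 w.2.1 ≠ w.1 w.2.2 := by
  have h1 : Continuous fun w : C1Loop × ℝ × ℝ => w.1 w.2.1 :=
    continuous_eval.comp (continuous_fst.prodMk (continuous_fst.comp continuous_snd))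
  have h2 : Continuous fun w : C1Loop × ℝ × ℝ => w.1 w.2.2 :=
    continuous_eval.comp (continuous_fst.prodMk (continuous_snd.comp continuous_snd))
  exact (isOpen_ne_fun h1 h2).mem_nhds h

/-! ### Double points under small perturbations -/

/-- The ordered double points of the curve: both orders of each self-intersection occur. -/
def dblPts (γ : C1Loop) : Set (ℝ × ℝ) :=
  {p | p.1 ∈ Ico (0 : ℝ) 1 ∧ p.2 ∈ Ico (0 : ℝ) 1 ∧ p.1 ≠ p.2 ∧ γ p.1 = γ p.2}

theorem dblPts_eq (γ : C1Loop) : γ.dblPts = γ.selfInt ∪ Prod.swap '' γ.selfInt := by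
  ext ⟨x, y⟩
  simp only [dblPts, selfInt, mem_ofPred_eq, mem_union, image_swap_eq_preimage_swap, mem_preimage,
    Prod.swap_prod_mk, mem_Ico]
  constructor
  · rintro ⟨⟨a, b⟩, ⟨c, d⟩, e, f⟩
    rcases lt_or_gt_of_ne e with h | h
    · exact Or.inl ⟨a, h, d, f⟩
    · exact Or.inr ⟨c, h, b, f.symm⟩
  · rintro (⟨a, b, c, d⟩ | ⟨a, b, c, d⟩)
    · exact ⟨⟨a, b.trans c⟩, ⟨a.trans b.le, c⟩, b.ne, d⟩
    · exact ⟨⟨a.trans b.le, c⟩, ⟨a, b.trans c⟩, b.ne', d.symm⟩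

theorem disjoint_selfInt_swap (γ : C1Loop) : Disjoint γ.selfInt (Prod.swap '' γ.selfInt) := by
  rw [Set.disjoint_left]
  rintro ⟨x, y⟩ h1 ⟨⟨x', y'⟩, h2, h3⟩
  simp only [Prod.swap_prod_mk, Prod.mk.injEq] at h3
  have a := h1.2.1
  have b := h2.2.1
  simp only at a b
  linarith [h3.1, h3.2]

theorem selfInt_subset_dblPts (γ : C1Loop) : γ.selfInt ⊆ γ.dblPts := by
  rw [dblPts_eq]; exact subset_union_left

theorem IsGeneric.finite_dblPts {γ : C1Loop} (h : γ.IsGeneric) : γ.dblPts.Finite := by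
  rw [dblPts_eq]
  exact h.2.1.union (h.2.1.image _)

theorem IsGeneric.linearIndependent {γ : C1Loop} (h : γ.IsGeneric) {p : ℝ × ℝ}
    (hp : p ∈ γ.dblPts) : LinearIndependent ℝ ![γ.vel p.1, γ.vel p.2] := by
  rw [dblPts_eq] at hp
  rcases hp with hp | ⟨p', hp, rfl⟩
  · exact h.2.2.1 p hp
  · have := h.2.2.1 p' hp
    rw [TransverseAt, LinearIndependent.pair_symm_iff] at this
    exact this

theorem fract_mem_dblPts {γ : C1Loop} {x y : ℝ} (h : γ x = γ y) (hxy : ∀ m : ℤ, x - y ≠ m) :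
    (Int.fract x, Int.fract y) ∈ γ.dblPts := by
  refine ⟨⟨Int.fract_nonneg _, Int.fract_lt_one _⟩, ⟨Int.fract_nonneg _, Int.fract_lt_one _⟩,
    ?_, ?_⟩
  · intro he
    apply hxy (⌊x⌋ - ⌊y⌋)
    simp only [Int.fract] at he
    push_cast
    linarith
  · simp only [apply_fract, h]

theorem ne_int_of_mem_dblPts {γ : C1Loop} {p : ℝ × ℝ} (hp : p ∈ γ.dblPts) (m : ℤ) :
    p.1 - p.2 ≠ m := by
  intro h
  obtain ⟨⟨a, b⟩, ⟨c, d⟩, e, -⟩ := hp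
  have h1 : (m : ℝ) < 1 := by linarith
  have h2 : (-1 : ℝ) < m := by linarith
  have h3 : m < 1 := by exact_mod_cast h1
  have h4 : -1 < m := by exact_mod_cast h2
  have : m = 0 := by omega
  subst this
  apply e
  push_cast at h
  linarith

/-- The linearization of `(x, y) ↦ γ x - γ y` at a transverse double point. -/
noncomputable def diffMap (a b : ℂ) : ℝ × ℝ →L[ℝ] ℂ :=
  (ContinuousLinearMap.fst ℝ ℝ ℝ).smulRight a - (ContinuousLinearMap.snd ℝ ℝ ℝ).smulRight b

theorem diffMap_apply (a b : ℂ) (z : ℝ × ℝ) : diffMap a b z = z.1 • a - z.2 • b := rfl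

theorem exists_equiv_diffMap {a b : ℂ} (h : LinearIndependent ℝ ![a, b]) :
    ∃ e : (ℝ × ℝ) ≃L[ℝ] ℂ, (e : ℝ × ℝ →L[ℝ] ℂ) = diffMap a b := by
  have hinj : Function.Injective (diffMap a b).toLinearMap := by
    rw [injective_iff_map_eq_zero]
    rintro ⟨x, y⟩ hz
    have hz' : x • a + (-y) • b = 0 := by
      rw [neg_smul, ← sub_eq_add_neg]; exact hz
    have := LinearIndependent.pair_iff.1 h x (-y) hz'
    ext
    · exact this.1
    · exact neg_eq_zero.1 this.2
  refine ⟨((diffMap a b).toLinearMap.linearEquivOfInjective hinj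
    (by simp)).toContinuousLinearEquiv, ?_⟩
  ext <;> rfl

/-- Near a transverse pair of parameters, the map `(x, y) ↦ ζ x - ζ y` is close to linear,
uniformly for all `ζ` near `γ`. -/
theorem exists_approximatesLinearOn (γ : C1Loop) (p : ℝ × ℝ) {c : NNReal} (hc : 0 < c) :
    ∃ r > 0, ∀ᶠ ζ in 𝓝 γ, ApproximatesLinearOn (fun z : ℝ × ℝ => ζ z.1 - ζ z.2)
      (diffMap (γ.vel p.1) (γ.vel p.2)) (Metric.ball p r) c := by
  have hc' : (0 : ℝ) < c / 2 := by positivity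
  obtain ⟨r₁, hr₁, h₁⟩ := γ.eventually_norm_sub_sub_le p.1 hc'
  obtain ⟨r₂, hr₂, h₂⟩ := γ.eventually_norm_sub_sub_le p.2 hc'
  refine ⟨min r₁ r₂, lt_min hr₁ hr₂, ?_⟩
  filter_upwards [h₁, h₂] with ζ k₁ k₂ z hz w hw
  have m1 : ∀ z ∈ Metric.ball p (min r₁ r₂), z.1 ∈ Metric.ball p.1 r₁ ∧
      z.2 ∈ Metric.ball p.2 r₂ := by
    intro z hz
    rw [Metric.mem_ball, Prod.dist_eq, max_lt_iff] at hz
    exact ⟨lt_of_lt_of_le hz.1 (min_le_left _ _), lt_of_lt_of_le hz.2 (min_le_right _ _)⟩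
  have a1 := k₁ _ (m1 z hz).1 _ (m1 w hw).1
  have a2 := k₂ _ (m1 z hz).2 _ (m1 w hw).2
  have n1 : |z.1 - w.1| ≤ ‖z - w‖ := norm_fst_le (z - w)
  have n2 : |z.2 - w.2| ≤ ‖z - w‖ := norm_snd_le (z - w)
  rw [diffMap_apply]
  calc _ = ‖(ζ z.1 - ζ w.1 - (z.1 - w.1) • γ.vel p.1) -
        (ζ z.2 - ζ w.2 - (z.2 - w.2) • γ.vel p.2)‖ := by
          congr 1; simp only [Prod.fst_sub, Prod.snd_sub]; abel
    _ ≤ c / 2 * |z.1 - w.1| + c / 2 * |z.2 - w.2| := (norm_sub_le _ _).trans (add_le_add a1 a2)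
    _ ≤ c / 2 * ‖z - w‖ + c / 2 * ‖z - w‖ := by gcongr
    _ = c * ‖z - w‖ := by ring

/-- A transverse double point is locally unique, uniformly for nearby curves. -/
theorem exists_injOn (γ : C1Loop) (p : ℝ × ℝ)
    (hp : LinearIndependent ℝ ![γ.vel p.1, γ.vel p.2]) :
    ∃ r > 0, ∀ᶠ ζ in 𝓝 γ, InjOn (fun z : ℝ × ℝ => ζ z.1 - ζ z.2) (Metric.ball p r) := by
  obtain ⟨e, he⟩ := exists_equiv_diffMap hp
  have hN : 0 < ‖(e.symm : ℂ →L[ℝ] ℝ × ℝ)‖₊⁻¹ :=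
    inv_pos.2 (nnnorm_pos.2 fun h => by
      have := e.symm.injective (a₁ := 1) (a₂ := 0)
        ((DFunLike.congr_fun h 1).trans (DFunLike.congr_fun h 0).symm)
      norm_num at this)
  obtain ⟨r, hr, h⟩ := γ.exists_approximatesLinearOn p (half_pos hN)
  refine ⟨r, hr, h.mono fun ζ hζ => ?_⟩
  rw [← he] at hζ
  exact hζ.injOn (Or.inr (half_lt_self hN))

/-- A transverse double point persists under small perturbations. -/
theorem eventually_exists_dblPt (γ : C1Loop) (p : ℝ × ℝ)
    (hp : LinearIndependent ℝ ![γ.vel p.1, γ.vel p.2]) (h0 : γ p.1 = γ p.2) {ρ : ℝ} (hρ : 0 < ρ) :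
    ∀ᶠ ζ in 𝓝 γ, ∃ z ∈ Metric.ball p ρ, ζ z.1 = ζ z.2 := by
  obtain ⟨e, he⟩ := exists_equiv_diffMap hp
  have hN : 0 < ‖(e.symm : ℂ →L[ℝ] ℝ × ℝ)‖₊⁻¹ :=
    inv_pos.2 (nnnorm_pos.2 fun h => by
      have := e.symm.injective (a₁ := 1) (a₂ := 0)
        ((DFunLike.congr_fun h 1).trans (DFunLike.congr_fun h 0).symm)
      norm_num at this)
  obtain ⟨r, hr, h⟩ := γ.exists_approximatesLinearOn p (half_pos hN)
  set ε := min ρ r / 2 with hε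
  have hε0 : 0 < ε := half_pos (lt_min hρ hr)
  have hερ : ε < ρ := by have := min_le_left ρ r; linarith
  have hεr : ε < r := by have := min_le_right ρ r; linarith
  have hpos : 0 < ((‖(e.symm : ℂ →L[ℝ] ℝ × ℝ)‖₊⁻¹ / 2 : NNReal) : ℝ) * ε :=
    mul_pos (by exact_mod_cast half_pos hN) hε0
  have hsmall : ∀ᶠ ζ in 𝓝 γ,
      ‖ζ p.1 - ζ p.2‖ < (‖(e.symm : ℂ →L[ℝ] ℝ × ℝ)‖₊⁻¹ / 2 : NNReal) * ε := by
    have hc : ContinuousAt (fun ζ : C1Loop => ‖ζ p.1 - ζ p.2‖) γ := by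
      refine ContinuousAt.norm (ContinuousAt.sub ?_ ?_)
      · exact (continuous_eval.comp (Continuous.prodMk_left p.1)).continuousAt
      · exact (continuous_eval.comp (Continuous.prodMk_left p.2)).continuousAt
    have := hc.eventually_lt_const (u := (‖(e.symm : ℂ →L[ℝ] ℝ × ℝ)‖₊⁻¹ / 2 : NNReal) * ε)
      (by simpa [h0] using hpos)
    exact this
  filter_upwards [h, hsmall] with ζ hζ hs
  rw [← he] at hζ
  have := hζ.surjOn_closedBall_of_nonlinearRightInverse e.toNonlinearRightInverse hε0.le
    (Metric.closedBall_subset_ball hεr)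
  obtain ⟨z, hz, hz'⟩ := this (show (0 : ℂ) ∈ _ by
    rw [Metric.mem_closedBall, dist_comm, dist_zero_right]
    refine hs.le.trans (le_of_eq ?_)
    congr 1
    change _ = ((‖(e.symm : ℂ →L[ℝ] ℝ × ℝ)‖₊ : ℝ))⁻¹ - _
    push_cast
    ring)
  exact ⟨z, Metric.closedBall_subset_ball hερ hz, sub_eq_zero.1 hz'⟩

/-- The cosine of the angle between the velocities at two parameters. -/
noncomputable def velCos (γ : C1Loop) (p : ℝ × ℝ) : ℝ :=
  Real.cos (InnerProductGeometry.angle (γ.vel p.1) (γ.vel p.2))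

theorem continuousAt_velCos (γ : C1Loop) (hγ : γ.IsImmersion) (p : ℝ × ℝ) :
    ContinuousAt (fun w : C1Loop × ℝ × ℝ => w.1.velCos w.2) (γ, p) := by
  have h1 : Continuous fun w : C1Loop × ℝ × ℝ => w.1.vel w.2.1 :=
    continuous_eval_vel.comp (continuous_fst.prodMk (continuous_fst.comp continuous_snd))
  have h2 : Continuous fun w : C1Loop × ℝ × ℝ => w.1.vel w.2.2 :=
    continuous_eval_vel.comp (continuous_fst.prodMk (continuous_snd.comp continuous_snd))
  exact ContinuousAt.comp (f := fun w : C1Loop × ℝ × ℝ => (w.1.vel w.2.1, w.1.vel w.2.2))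
    (g := fun z : ℂ × ℂ => Real.cos (InnerProductGeometry.angle z.1 z.2))
    (Real.continuous_cos.continuousAt.comp
      (InnerProductGeometry.continuousAt_angle (x := (γ.vel p.1, γ.vel p.2)) (hγ _) (hγ _)))
    (h1.prodMk h2).continuousAt

theorem eventually_isImmersion (γ : C1Loop) (hγ : γ.IsImmersion) :
    ∀ᶠ ζ in 𝓝 γ, ζ.IsImmersion := by
  have := isCompact_Icc.eventually_forall_of_forall_eventually (x₀ := γ) (K := Icc (0 : ℝ) 1)
    (P := fun ζ t => ζ.vel t ≠ 0) fun t _ =>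
      continuous_eval_vel.continuousAt.eventually_ne (hγ t)
  filter_upwards [this] with ζ hζ t
  rw [← ζ.vel_fract]
  exact hζ _ ⟨Int.fract_nonneg _, (Int.fract_lt_one _).le⟩

theorem eventually_no_triplePoint (γ : C1Loop) (hγ : γ.IsGeneric) :
    ∀ᶠ ζ in 𝓝 γ, ∀ a b c, ¬ ζ.IsTriplePoint a b c := by
  have key := (isCompact_Icc (a := (0 : ℝ)) (b := 1)).prod
    ((isCompact_Icc (a := (0 : ℝ)) (b := 1)).prod (isCompact_Icc (a := (0 : ℝ)) (b := 1)))
    |>.eventually_forall_of_forall_eventually (x₀ := γ)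
    (P := fun ζ t => ¬ (t.1 < t.2.1 ∧ t.2.1 < t.2.2 ∧ t.2.2 < t.1 + 1 ∧
      ζ t.1 = ζ t.2.1 ∧ ζ t.2.1 = ζ t.2.2)) ?_
  · filter_upwards [key] with ζ hζ a b c h
    obtain ⟨h1, h2, h3, h4, h5, h6⟩ := h
    exact hζ (a, b, c) ⟨⟨h1, by linarith⟩, ⟨by simp only; linarith, by simp only; linarith⟩,
      ⟨by simp only; linarith, h4.le⟩⟩ ⟨h2, h3, by simp only; linarith, h5, h6⟩
  · rintro ⟨a, b, c⟩ -
    have t1 : Tendsto (fun w : C1Loop × ℝ × ℝ × ℝ => (w.1, w.2.1, w.2.2.1)) (𝓝 (γ, a, b, c))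
        (𝓝 (γ, a, b)) := Continuous.tendsto (by fun_prop) (γ, a, b, c)
    have t2 : Tendsto (fun w : C1Loop × ℝ × ℝ × ℝ => (w.1, w.2.2.1, w.2.2.2)) (𝓝 (γ, a, b, c))
        (𝓝 (γ, b, c)) := Continuous.tendsto (by fun_prop) (γ, a, b, c)
    have t3 : Tendsto (fun w : C1Loop × ℝ × ℝ × ℝ => (w.1, w.2.1, w.2.2.2)) (𝓝 (γ, a, b, c))
        (𝓝 (γ, a, c)) := Continuous.tendsto (by fun_prop) (γ, a, b, c)
    have no_int : ∀ x y : ℝ, x < y → y < x + 1 → ∀ m : ℤ, x - y ≠ m := by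
      intro x y h1 h2 m hm
      have : (-1 : ℝ) < m := by linarith
      have h3 : (m : ℝ) < 0 := by linarith
      have h4 : -1 < m := by exact_mod_cast this
      have h5 : m < 0 := by exact_mod_cast h3
      omega
    by_cases hab : ∃ m : ℤ, a - b = m
    · obtain ⟨m, hm⟩ := hab
      have := t1.eventually (γ.eventually_eq_of_apply_eq hγ.1 hm)
      filter_upwards [this] with w hw h
      exact no_int _ _ h.1 (by linarith [h.2.1, h.2.2.1]) m (hw h.2.2.2.1)
    by_cases hbc : ∃ m : ℤ, b - c = m
    · obtain ⟨m, hm⟩ := hbc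
      have := t2.eventually (γ.eventually_eq_of_apply_eq hγ.1 hm)
      filter_upwards [this] with w hw h
      exact no_int _ _ h.2.1 (by linarith [h.1, h.2.2.1]) m (hw h.2.2.2.2)
    by_cases hac : ∃ m : ℤ, a - c = m
    · obtain ⟨m, hm⟩ := hac
      have := t3.eventually (γ.eventually_eq_of_apply_eq hγ.1 hm)
      filter_upwards [this] with w hw h
      exact no_int _ _ (h.1.trans h.2.1) h.2.2.1 m (hw (h.2.2.2.1.trans h.2.2.2.2))
    -- the three parameters are distinct on the circle, so that they do not have the same image
    push Not at hab hbc hac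
    have hne : ¬ (γ a = γ b ∧ γ b = γ c) := by
      rintro ⟨h1, h2⟩
      have sort : ∀ x y z : ℝ, x ∈ Ico (0 : ℝ) 1 → z ∈ Ico (0 : ℝ) 1 → x < y → y < z →
          γ x = γ y → γ y = γ z → False := fun x y z hx hz hxy hyz e1 e2 =>
        hγ.2.2.2 x y z ⟨hx.1, hxy, hyz, hz.2, e1, e2⟩
      have f1 := fract_mem_dblPts h1 hab
      have f2 := fract_mem_dblPts h2 hbc
      have f3 := fract_mem_dblPts (h1.trans h2) hac
      obtain ⟨ha, hb, n1, e1⟩ := f1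
      obtain ⟨-, hc, n2, e2⟩ := f2
      obtain ⟨-, -, n3, e3⟩ := f3
      simp only at ha hb hc n1 n2 n3 e1 e2 e3
      rcases lt_or_gt_of_ne n1 with l1 | l1 <;> rcases lt_or_gt_of_ne n2 with l2 | l2 <;>
        rcases lt_or_gt_of_ne n3 with l3 | l3
      · exact sort _ _ _ ha hc l1 l2 e1 e2
      · linarith
      · exact sort _ _ _ ha hb l3 l2 e3 e2.symm
      · exact sort _ _ _ hc hb l3 l1 e3.symm e1
      · exact sort _ _ _ hb hc l1 l3 e1.symm e3
      · exact sort _ _ _ hb ha l2 l3 e2 e3.symm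
      · linarith
      · exact sort _ _ _ hc ha l2 l1 e2.symm e1.symm
    by_cases h1 : γ a = γ b
    · have h2 : γ b ≠ γ c := fun h => hne ⟨h1, h⟩
      have := t2.eventually (eventually_apply_ne h2)
      filter_upwards [this] with w hw h
      exact hw h.2.2.2.2
    · have := t1.eventually (eventually_apply_ne h1)
      filter_upwards [this] with w hw h
      exact hw h.2.2.2.1

end C1Loop

namespace C1Loop

/-- Double points of curves near `γ` are transverse and lie, modulo integers, near double points
of `γ`; the corresponding angles are close. -/
theorem eventually_dblPt_near (γ : C1Loop) (hγ : γ.IsGeneric) {ρ ε : ℝ} (hρ : 0 < ρ) (hε : 0 < ε) :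
    ∀ᶠ ζ in 𝓝 γ, ∀ w ∈ ζ.dblPts, LinearIndependent ℝ ![ζ.vel w.1, ζ.vel w.2] ∧
      ∃ p ∈ γ.dblPts, ∃ i j : ℤ, ((w.1 + i : ℝ), (w.2 + j : ℝ)) ∈ Metric.ball p ρ ∧
        |ζ.velCos w - γ.velCos p| < ε := by
  have key := (isCompact_Icc (a := (0 : ℝ)) (b := 1)).prod (isCompact_Icc (a := (0 : ℝ)) (b := 1))
    |>.eventually_forall_of_forall_eventually (x₀ := γ)
    (P := fun ζ w => ζ w.1 = ζ w.2 → (∃ m : ℤ, w.1 - w.2 = m) ∨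
      (LinearIndependent ℝ ![ζ.vel w.1, ζ.vel w.2] ∧
      ∃ p ∈ γ.dblPts, ∃ i j : ℤ, ((w.1 + i : ℝ), (w.2 + j : ℝ)) ∈ Metric.ball p ρ ∧
        |ζ.velCos w - γ.velCos p| < ε)) ?_
  · filter_upwards [key] with ζ hζ w hw
    rcases hζ w ⟨Ico_subset_Icc_self hw.1, Ico_subset_Icc_self hw.2.1⟩ hw.2.2.2 with ⟨m, hm⟩ | h
    · exact absurd hm (ne_int_of_mem_dblPts hw m)
    · exact h
  · rintro ⟨x, y⟩ -
    by_cases hxy : ∃ m : ℤ, x - y = m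
    · obtain ⟨m, hm⟩ := hxy
      filter_upwards [γ.eventually_eq_of_apply_eq hγ.1 hm] with w hw h
      exact Or.inl ⟨m, hw h⟩
    push Not at hxy
    by_cases he : γ x = γ y
    · have hp := fract_mem_dblPts he hxy
      have hli := hγ.linearIndependent hp
      simp only [vel_fract] at hli
      have h1 : Continuous fun w : C1Loop × ℝ × ℝ => ![w.1.vel w.2.1, w.1.vel w.2.2] := by
        refine continuous_pi fun i => ?_
        fin_cases i
        · exact continuous_eval_vel.comp
            (continuous_fst.prodMk (continuous_fst.comp continuous_snd))
        · exact continuous_eval_vel.comp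
            (continuous_fst.prodMk (continuous_snd.comp continuous_snd))
      have e1 := (isOpen_setOfPred_linearIndependent.preimage h1).mem_nhds
        (x := (γ, x, y)) hli
      have e2 := Metric.tendsto_nhds.1 (γ.continuousAt_velCos hγ.1 (x, y)) ε hε
      have h3 : Tendsto (fun w : C1Loop × ℝ × ℝ => (w.2.1 + ((-⌊x⌋ : ℤ) : ℝ),
          w.2.2 + ((-⌊y⌋ : ℤ) : ℝ)))
          (𝓝 (γ, x, y)) (𝓝 (Int.fract x, Int.fract y)) :=
        Continuous.tendsto' (by fun_prop) _ _ (by simp [Int.fract, sub_eq_add_neg])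
      have e3 := h3 (Metric.ball_mem_nhds _ hρ)
      filter_upwards [e1, e2, e3] with w k1 k2 k3 _
      refine Or.inr ⟨k1, _, hp, _, _, k3, ?_⟩
      rw [Real.dist_eq] at k2
      simpa only [velCos, vel_fract] using k2
    · filter_upwards [eventually_apply_ne he] with w hw h
      exact absurd h hw

/-- A finite set of points of the unit square is separated modulo integers. -/
theorem exists_separation (s : Set (ℝ × ℝ)) (hs : s.Finite)
    (h01 : ∀ p ∈ s, p.1 ∈ Ico (0 : ℝ) 1 ∧ p.2 ∈ Ico (0 : ℝ) 1) :
    ∃ ρ > 0, ∀ p ∈ s, ∀ p' ∈ s, ∀ i j : ℤ, |p.1 - p'.1 - i| < ρ → |p.2 - p'.2 - j| < ρ →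
      p = p' := by
  have scal : ∀ x ∈ Ico (0 : ℝ) 1, ∀ y ∈ Ico (0 : ℝ) 1,
      ∀ᶠ ρ in 𝓝[>] (0 : ℝ), ∀ i : ℤ, |x - y - i| < ρ → x = y := by
    intro x hx y hy
    by_cases hxy : x = y
    · simp [hxy]
    have h1 : 0 < |x - y| := abs_pos.2 (sub_ne_zero.2 hxy)
    have h2 : |x - y| < 1 := abs_lt.2 ⟨by linarith [hx.1, hy.2], by linarith [hx.2, hy.1]⟩
    filter_upwards [Ioo_mem_nhdsGT (lt_min h1 (sub_pos.2 h2))] with ρ hρ i hi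
    exfalso
    obtain ⟨h3, h4⟩ := lt_min_iff.1 hρ.2
    have h5 : |(i : ℝ)| < 1 := by
      calc |(i : ℝ)| = |(x - y) - (x - y - i)| := by ring_nf
        _ ≤ |x - y| + |x - y - i| := abs_sub _ _
        _ < 1 := by linarith
    have h6 : |i| < 1 := by exact_mod_cast h5
    rw [Int.abs_lt_one_iff] at h6
    subst h6
    simp only [Int.cast_zero, sub_zero] at hi
    linarith
  have : ∀ᶠ ρ in 𝓝[>] (0 : ℝ), ∀ p ∈ s, ∀ p' ∈ s, ∀ i j : ℤ, |p.1 - p'.1 - i| < ρ →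
      |p.2 - p'.2 - j| < ρ → p = p' := by
    rw [Filter.eventually_all_finite hs]
    intro p hp
    rw [Filter.eventually_all_finite hs]
    intro p' hp'
    filter_upwards [scal _ (h01 p hp).1 _ (h01 p' hp').1, scal _ (h01 p hp).2 _ (h01 p' hp').2]
      with ρ k1 k2 i j l1 l2
    exact Prod.ext (k1 i l1) (k2 j l2)
  obtain ⟨ρ, h1, h2⟩ := (this.and self_mem_nhdsWithin).exists
  exact ⟨ρ, h2, h1⟩

/-- Stability of generic immersions: every curve that is close to `γ` in `C¹` is generic as well,
its double points correspond to those of `γ`, and their angles are close to those of `γ`. -/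
theorem eventually_stable (γ : C1Loop) (hγ : γ.IsGeneric) {ε : ℝ} (hε : 0 < ε) :
    ∀ᶠ ζ in 𝓝 γ, ζ.IsGeneric ∧ ∃ f : ℝ × ℝ → ℝ × ℝ, BijOn f γ.dblPts ζ.dblPts ∧
      ∀ p ∈ γ.dblPts, |ζ.velCos (f p) - γ.velCos p| < ε := by
  have hfin := hγ.finite_dblPts
  obtain ⟨ρ₀, hρ₀, hsep⟩ := exists_separation γ.dblPts hfin fun p hp => ⟨hp.1, hp.2.1⟩
  -- a common radius on which all double points are locally unique
  have hloc : ∀ᶠ r in 𝓝[>] (0 : ℝ), ∀ p ∈ γ.dblPts, ∀ᶠ ζ in 𝓝 γ,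
      InjOn (fun z : ℝ × ℝ => ζ z.1 - ζ z.2) (Metric.ball p r) := by
    rw [Filter.eventually_all_finite hfin]
    intro p hp
    obtain ⟨r, hr, h⟩ := γ.exists_injOn p (hγ.linearIndependent hp)
    filter_upwards [Ioo_mem_nhdsGT hr] with r' hr'
    exact h.mono fun ζ hζ => hζ.mono (Metric.ball_subset_ball hr'.2.le)
  obtain ⟨r, ⟨hinj, hr0⟩, hrρ⟩ :=
    ((hloc.and self_mem_nhdsWithin).and (Ioo_mem_nhdsGT (half_pos hρ₀))).exists
  have hr0 : 0 < r := hr0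
  have hinj' : ∀ᶠ ζ in 𝓝 γ, ∀ p ∈ γ.dblPts,
      InjOn (fun z : ℝ × ℝ => ζ z.1 - ζ z.2) (Metric.ball p r) :=
    (Filter.eventually_all_finite hfin).2 hinj
  have hex : ∀ᶠ ζ in 𝓝 γ, ∀ p ∈ γ.dblPts, ∃ z ∈ Metric.ball p r, ζ z.1 = ζ z.2 :=
    (Filter.eventually_all_finite hfin).2 fun p hp =>
      γ.eventually_exists_dblPt p (hγ.linearIndependent hp) hp.2.2.2 hr0
  have hreg : ∀ᶠ ζ : C1Loop in 𝓝 γ, ∀ p ∈ γ.dblPts, ∀ z ∈ Metric.ball p r,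
      ζ z.1 = ζ z.2 → ∀ m : ℤ, z.1 - z.2 ≠ m := by
    refine Eventually.of_forall fun ζ p hp z hz _ m hm => ?_
    rw [Metric.mem_ball, Prod.dist_eq, max_lt_iff, Real.dist_eq, Real.dist_eq] at hz
    have h1 : |p.1 - p.2 - m| < ρ₀ := by
      calc |p.1 - p.2 - m| = |(z.2 - p.2) - (z.1 - p.1)| := by rw [← hm]; ring_nf
        _ ≤ |z.2 - p.2| + |z.1 - p.1| := abs_sub _ _
        _ < ρ₀ := by linarith [hrρ.2, hz.1, hz.2]
    -- the double point `p` and its swap would coincide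
    have h2 : |p.2 - p.1 - (-m : ℤ)| < ρ₀ := by
      rw [abs_sub_comm] at h1; push_cast
      rwa [show p.2 - p.1 - -(m : ℝ) = m - (p.1 - p.2) by ring]
    have hsw : Prod.swap p ∈ γ.dblPts := ⟨hp.2.1, hp.1, hp.2.2.1.symm, hp.2.2.2.symm⟩
    have := hsep p hp _ hsw m (-m) h1 h2
    exact hp.2.2.1 (congrArg Prod.fst this)
  filter_upwards [γ.eventually_isImmersion hγ.1, γ.eventually_no_triplePoint hγ,
    γ.eventually_dblPt_near hγ hr0 hε, hinj', hex, hreg] with ζ k1 k2 k3 k4 k5 k6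
  choose! z hz hz0 using k5
  set f : ℝ × ℝ → ℝ × ℝ := fun p => (Int.fract (z p).1, Int.fract (z p).2) with hf
  have hmem : ∀ p ∈ γ.dblPts, f p ∈ ζ.dblPts := fun p hp =>
    fract_mem_dblPts (hz0 p hp) (k6 p hp _ (hz p hp) (hz0 p hp))
  have hzd : ∀ p ∈ γ.dblPts, |(z p).1 - p.1| < ρ₀ / 2 ∧ |(z p).2 - p.2| < ρ₀ / 2 := by
    intro p hp
    have := hz p hp
    rw [Metric.mem_ball, Prod.dist_eq, max_lt_iff, Real.dist_eq, Real.dist_eq] at this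
    exact ⟨this.1.trans hrρ.2, this.2.trans hrρ.2⟩
  -- a double point of `ζ` near `p` is the one that was selected
  have hsel : ∀ w ∈ ζ.dblPts, ∀ p ∈ γ.dblPts, ∀ i j : ℤ,
      ((w.1 + i : ℝ), (w.2 + j : ℝ)) ∈ Metric.ball p r → f p = w := by
    intro w hw p hp i j h
    have h0 : ζ (w.1 + i) - ζ (w.2 + j) = 0 := by
      rw [apply_add_int, apply_add_int, hw.2.2.2, sub_self]
    have := k4 p hp (hz p hp) h (by simp only [h0, hz0 p hp, sub_self])
    simp only [hf, this]
    rw [Int.fract_add_intCast, Int.fract_add_intCast, Int.fract_eq_self.2 hw.1,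
      Int.fract_eq_self.2 hw.2.1]
  have hbij : BijOn f γ.dblPts ζ.dblPts := by
    refine ⟨hmem, ?_, ?_⟩
    · intro p hp p' hp' he
      simp only [hf, Prod.mk.injEq, Int.fract_eq_fract] at he
      obtain ⟨⟨i, hi⟩, j, hj⟩ := he
      have d1 := hzd p hp
      have d2 := hzd p' hp'
      refine hsep p hp p' hp' i j ?_ ?_
      · calc |p.1 - p'.1 - i| = |((z p').1 - p'.1) - ((z p).1 - p.1)| := by rw [← hi]; ring_nf
          _ ≤ |(z p').1 - p'.1| + |(z p).1 - p.1| := abs_sub _ _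
          _ < ρ₀ := by linarith
      · calc |p.2 - p'.2 - j| = |((z p').2 - p'.2) - ((z p).2 - p.2)| := by rw [← hj]; ring_nf
          _ ≤ |(z p').2 - p'.2| + |(z p).2 - p.2| := abs_sub _ _
          _ < ρ₀ := by linarith
    · intro w hw
      obtain ⟨-, p, hp, i, j, h, -⟩ := k3 w hw
      exact ⟨p, hp, hsel w hw p hp i j h⟩
  refine ⟨⟨k1, ?_, fun p hp => (k3 p (ζ.selfInt_subset_dblPts hp)).1, k2⟩, f, hbij, ?_⟩
  · exact (hbij.image_eq ▸ hfin.image f).subset ζ.selfInt_subset_dblPts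
  · intro p hp
    obtain ⟨-, p', hp', i, j, h, ha⟩ := k3 _ (hmem p hp)
    have := hbij.injOn hp' hp (hsel _ (hmem p hp) p' hp' i j h)
    rwa [this] at ha

/-! ### Compartments -/

theorem eventually_hasWindingNumber (γ : C1Loop) (hγ : γ.IsImmersion) {ω : ℤ}
    (hω : γ.HasWindingNumber ω) : ∀ᶠ ζ in 𝓝 γ, ζ.HasWindingNumber ω := by
  obtain ⟨θ, hθ, hv, hd⟩ := hω
  obtain ⟨t₀, -, ht₀⟩ := isCompact_Icc.exists_isMinOn (nonempty_Icc.2 (zero_le_one (α := ℝ)))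
    γ.continuous_vel.norm.continuousOn
  have hm : ∀ t, ‖γ.vel t₀‖ ≤ ‖γ.vel t‖ := fun t => by
    rw [← γ.vel_fract t]
    exact ht₀ ⟨Int.fract_nonneg _, (Int.fract_lt_one _).le⟩
  filter_upwards [γ.eventually_near (norm_pos_iff.2 (hγ t₀))] with ζ hζ
  have hr : ∀ t, ζ.vel t / γ.vel t ∈ Complex.slitPlane := fun t => by
    have h := Complex.mem_slitPlane_of_norm_lt_one (z := ζ.vel t / γ.vel t - 1) ?_
    · simpa using h
    rw [div_sub_one (hγ t), norm_div, div_lt_one (norm_pos_iff.2 (hγ t))]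
    exact (hζ.2 t).trans_le (hm t)
  refine ⟨fun t => θ t + Complex.arg (ζ.vel t / γ.vel t), ?_, fun t => ?_, ?_⟩
  · refine hθ.add ?_
    rw [continuous_iff_continuousAt]
    intro t
    exact (Complex.continuousAt_arg (hr t)).comp (f := fun t => ζ.vel t / γ.vel t)
      (ζ.continuous_vel.continuousAt.div γ.continuous_vel.continuousAt (hγ t))
  · have h1 := Complex.norm_mul_exp_arg_mul_I (ζ.vel t / γ.vel t)
    rw [norm_div, Complex.ofReal_div] at h1
    have h2 := hv t
    have h3 : (‖γ.vel t‖ : ℂ) ≠ 0 := by simpa using hγ t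
    have h4 := hγ t
    have h5 : ζ.vel t = γ.vel t * (‖ζ.vel t‖ / ‖γ.vel t‖ *
        Complex.exp (Complex.arg (ζ.vel t / γ.vel t) * Complex.I)) := by rw [h1]; field_simp
    beta_reduce
    generalize Complex.arg (ζ.vel t / γ.vel t) = A at h5 ⊢
    generalize (‖γ.vel t‖ : ℂ) = N at *
    rw [h2] at h5
    push_cast
    rw [add_mul, Complex.exp_add]
    refine h5.trans ?_
    field_simp
  · have e1 : ζ.vel 1 = ζ.vel 0 := by simpa using ζ.vel_periodic 0
    have e2 : γ.vel 1 = γ.vel 0 := by simpa using γ.vel_periodic 0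
    simp only [e1, e2]
    linarith

/-- The curve `γ + s (ζ - γ)`. -/
noncomputable def lineTo (γ ζ : C1Loop) (s : ℝ) : C1Loop where
  toFun t := γ t + s • (ζ t - γ t)
  periodic t := by simp only [γ.periodic t, ζ.periodic t]
  contDiff := γ.contDiff.add ((ζ.contDiff.sub γ.contDiff).const_smul s)

theorem lineTo_apply (γ ζ : C1Loop) (s t : ℝ) : γ.lineTo ζ s t = γ t + s • (ζ t - γ t) := rfl

theorem vel_lineTo (γ ζ : C1Loop) (s t : ℝ) :
    (γ.lineTo ζ s).vel t = γ.vel t + s • (ζ.vel t - γ.vel t) :=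
  ((γ.lineTo ζ s).hasDerivAt t).unique
    ((γ.hasDerivAt t).add (((ζ.hasDerivAt t).sub (γ.hasDerivAt t)).const_smul s))

theorem ext {γ ζ : C1Loop} (h : ∀ t, γ t = ζ t) : γ = ζ := by
  cases γ; cases ζ
  congr
  exact funext h

/-- The space of curves is locally path connected. -/
theorem eventually_joinedIn {γ : C1Loop} {U : Set C1Loop} (hU : U ∈ 𝓝 γ) :
    ∀ᶠ ζ in 𝓝 γ, JoinedIn U γ ζ := by
  obtain ⟨ε, hε, hεU⟩ := γ.hasBasis_nhds.mem_iff.1 hU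
  filter_upwards [γ.eventually_near hε] with ζ hζ
  have hc : Continuous (γ.lineTo ζ) := by
    rw [continuous_iff_continuousAt]
    intro s
    rw [ContinuousAt, (γ.lineTo ζ s).hasBasis_nhds.tendsto_right_iff]
    intro δ hδ
    filter_upwards [Metric.ball_mem_nhds s (div_pos hδ hε)] with s' hs'
    rw [Metric.mem_ball, Real.dist_eq, lt_div_iff₀ hε] at hs'
    constructor
    · intro t
      rw [lineTo_apply, lineTo_apply, add_sub_add_left_eq_sub, ← sub_smul, norm_smul,
        Real.norm_eq_abs]
      exact (mul_le_mul_of_nonneg_left (hζ.1 t).le (abs_nonneg _)).trans_lt hs'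
    · intro t
      rw [vel_lineTo, vel_lineTo, add_sub_add_left_eq_sub, ← sub_smul, norm_smul,
        Real.norm_eq_abs]
      exact (mul_le_mul_of_nonneg_left (hζ.2 t).le (abs_nonneg _)).trans_lt hs'
  refine ⟨⟨⟨fun s => γ.lineTo ζ s, hc.comp continuous_subtype_val⟩, ?_, ?_⟩, fun s => hεU ?_⟩
  · exact ext fun t => by simp [lineTo_apply]
  · exact ext fun t => by simp [lineTo_apply]
  · have key : ∀ a b : ℂ, ‖b - a‖ < ε → ‖a + (s : ℝ) • (b - a) - a‖ < ε := by
      intro a b hab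
      rw [add_sub_cancel_left, norm_smul, Real.norm_eq_abs, abs_of_nonneg s.2.1]
      exact (mul_le_of_le_one_left (norm_nonneg _) s.2.2).trans_lt hab
    refine ⟨fun t => ?_, fun t => ?_⟩
    · have := key _ _ (hζ.1 t)
      rw [← lineTo_apply] at this
      exact this
    have := key _ _ (hζ.2 t)
    rw [← vel_lineTo] at this
    exact this

/-- Curves that are close to `γ` in `C¹` lie in the compartment of `γ`. -/
theorem eventually_joinedIn_genericWith {γ : C1Loop} {jp jm s ω : ℤ}
    (hγ : γ ∈ genericWith jp jm s ω) : ∀ᶠ ζ in 𝓝 γ, JoinedIn (genericWith jp jm s ω) γ ζ := by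
  have hg : {ζ : C1Loop | ζ.IsGeneric} ∈ 𝓝 γ :=
    (γ.eventually_stable hγ.1 one_pos).mono fun ζ h => h.1
  apply eventually_joinedIn
  filter_upwards [hg, γ.eventually_hasWindingNumber hγ.1.1 hγ.2.1, eventually_joinedIn hg]
    with ζ h1 h2 h3
  exact ⟨h1, h2, hγ.2.2.homotopy h3⟩

/-- The number of double points is constant on a compartment. -/
theorem ncard_dblPts_eq_of_joinedIn {γ ζ : C1Loop} {jp jm s ω : ℤ}
    (h : JoinedIn (genericWith jp jm s ω) γ ζ) : ζ.dblPts.ncard = γ.dblPts.ncard := by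
  obtain ⟨P, hP⟩ := h
  have hlc : IsLocallyConstant fun t => (P t).dblPts.ncard := by
    rw [IsLocallyConstant.iff_eventually_eq]
    intro t
    have := P.continuous.continuousAt.eventually ((P t).eventually_stable (hP t).1 one_pos)
    filter_upwards [this] with t' ht'
    obtain ⟨-, f, hf, -⟩ := ht'
    rw [← hf.image_eq, hf.injOn.ncard_image]
  have := hlc.apply_eq_of_preconnectedSpace 1 0
  simpa using this

end C1Loop

/-! ### The energy of a straight crossing -/

theorem lintegral_comp_mul_left_real {g : ℝ → ℝ≥0∞} (hg : Measurable g) {s : ℝ} (hs : s ≠ 0) :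
    ∫⁻ t, g t = ENNReal.ofReal |s| * ∫⁻ τ, g (s * τ) := by
  conv_lhs => rw [← Real.smul_map_volume_mul_left hs]
  rw [lintegral_smul_measure, lintegral_map hg (measurable_const_mul s), smul_eq_mul]

theorem lintegral_abs_rpow {q δ η : ℝ} (hq : 2 < q) (hδ : 0 < δ) (hη : δ ≤ η) :
    ∫⁻ s in {s : ℝ | δ ≤ |s| ∧ |s| < η}, ENNReal.ofReal (|s| ^ (1 - q)) =
      ENNReal.ofReal (2 * (δ ^ (2 - q) - η ^ (2 - q)) / (q - 2)) := by
  have hm : Measurable fun s : ℝ => ENNReal.ofReal (|s| ^ (1 - q)) :=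
    (measurable_id.abs.pow_const _).ennreal_ofReal
  have hset : {s : ℝ | δ ≤ |s| ∧ |s| < η} = Ico δ η ∪ Ioc (-η) (-δ) := by
    ext s
    simp only [mem_ofPred_eq, mem_union, mem_Ico, mem_Ioc]
    rcases le_total 0 s with h | h
    · rw [abs_of_nonneg h]
      constructor
      · exact Or.inl
      · rintro (h | h)
        · exact h
        · linarith
    · rw [abs_of_nonpos h]
      constructor
      · exact fun h => Or.inr ⟨by linarith, by linarith⟩
      · rintro (h | h)
        · linarith
        · exact ⟨by linarith, by linarith⟩
  have hd : Disjoint (Ico δ η) (Ioc (-η) (-δ)) := by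
    rw [Set.disjoint_left]
    rintro s ⟨h1, h2⟩ ⟨h3, h4⟩
    linarith
  have h1 : ∫⁻ s in Ico δ η, ENNReal.ofReal (|s| ^ (1 - q)) =
      ENNReal.ofReal ((δ ^ (2 - q) - η ^ (2 - q)) / (q - 2)) := by
    have hi : ∫ s in Ico δ η, |s| ^ (1 - q) = (δ ^ (2 - q) - η ^ (2 - q)) / (q - 2) := by
      rw [integral_Ico_eq_integral_Ioc, ← intervalIntegral.integral_of_le hη]
      have h0 : (0 : ℝ) ∉ uIcc δ η := by
        rw [uIcc_of_le hη]
        exact fun h => by linarith [h.1]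
      rw [intervalIntegral.integral_congr (g := fun s => s ^ (1 - q)),
        integral_rpow (Or.inr ⟨by linarith, h0⟩)]
      · rw [show 1 - q + 1 = 2 - q by ring, ← neg_div_neg_eq]
        congr 1 <;> ring
      · intro s hs
        rw [uIcc_of_le hη] at hs
        simp only [abs_of_nonneg (hδ.le.trans hs.1)]
    rw [← hi, ofReal_integral_eq_lintegral_ofReal]
    · have : ContinuousOn (fun s : ℝ => |s| ^ (1 - q)) (Icc δ η) := by
        refine continuous_abs.continuousOn.rpow_const fun s hs => Or.inl ?_
        exact (abs_pos.2 (hδ.trans_le hs.1).ne').ne'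
      exact (this.integrableOn_Icc).mono_set Ico_subset_Icc_self
    · exact Eventually.of_forall fun s => by positivity
  have h2 : ∫⁻ s in Ioc (-η) (-δ), ENNReal.ofReal (|s| ^ (1 - q)) =
      ∫⁻ s in Ico δ η, ENNReal.ofReal (|s| ^ (1 - q)) := by
    rw [← lintegral_indicator measurableSet_Ioc, ← lintegral_indicator measurableSet_Ico,
      lintegral_comp_mul_left_real (hm.indicator measurableSet_Ioc) (s := -1) (by norm_num)]
    simp only [abs_neg, abs_one, ENNReal.ofReal_one, one_mul]
    refine lintegral_congr fun s => ?_
    by_cases hs : s ∈ Ico δ η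
    · rw [indicator_of_mem hs, indicator_of_mem (by
        constructor <;> linarith [hs.1, hs.2]), neg_mul, one_mul, abs_neg]
    · rw [indicator_of_notMem hs, indicator_of_notMem (by
        intro h; apply hs; constructor <;> linarith [h.1, h.2])]
  rw [hset, lintegral_union measurableSet_Ioc hd, h2, h1, ← ENNReal.ofReal_add]
  · congr 1; ring
  all_goals
    refine div_nonneg (sub_nonneg.2 ?_) (by linarith)
    exact Real.rpow_le_rpow_of_nonpos hδ hη (by linarith)

/-- The integral of a function that is homogeneous of degree `-q` over the part of a cone that lies
between two squares. -/
theorem lintegral_homogeneous {q δ η : ℝ} (hq : 2 < q) (hδ : 0 < δ) (hη : δ ≤ η)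
    {k : ℝ × ℝ → ℝ≥0∞} (hk : Measurable k) {φ : ℝ → ℝ≥0∞} {T : Set ℝ} (hT : MeasurableSet T)
    (h : ∀ s ≠ 0, ∀ τ ∈ T, k (s, s * τ) = ENNReal.ofReal (|s| ^ (-q)) * φ τ) :
    ∫⁻ z in {z : ℝ × ℝ | (δ ≤ |z.1| ∧ |z.1| < η) ∧ z.2 / z.1 ∈ T}, k z =
      ENNReal.ofReal (2 * (δ ^ (2 - q) - η ^ (2 - q)) / (q - 2)) * ∫⁻ τ in T, φ τ := by
  have hA : MeasurableSet {s : ℝ | δ ≤ |s| ∧ |s| < η} :=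
    (measurableSet_le measurable_const measurable_id.abs).inter
      (measurableSet_lt measurable_id.abs measurable_const)
  have hS : MeasurableSet {z : ℝ × ℝ | (δ ≤ |z.1| ∧ |z.1| < η) ∧ z.2 / z.1 ∈ T} :=
    (hA.preimage measurable_fst).inter ((measurable_snd.div measurable_fst) hT)
  rw [← lintegral_indicator hS, Measure.volume_eq_prod,
    lintegral_prod _ (hk.indicator hS).aemeasurable, ← lintegral_abs_rpow hq hδ hη,
    ← lintegral_mul_const _ (f := fun s : ℝ => ENNReal.ofReal (|s| ^ (1 - q)))
      (measurable_id.abs.pow_const _).ennreal_ofReal,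
    ← lintegral_indicator hA]
  refine lintegral_congr fun s => ?_
  by_cases hs : s ∈ {s : ℝ | δ ≤ |s| ∧ |s| < η}
  · have hs' : δ ≤ |s| ∧ |s| < η := hs
    have hs0 : s ≠ 0 := abs_pos.1 (hδ.trans_le hs'.1)
    rw [indicator_of_mem hs, lintegral_comp_mul_left_real
      (g := fun t => indicator _ k (s, t)) ((hk.indicator hS).comp measurable_prodMk_left) hs0,
      ← lintegral_indicator hT,
      show 1 - q = 1 + (-q) by ring, Real.rpow_add (abs_pos.2 hs0), Real.rpow_one,
      ENNReal.ofReal_mul (abs_nonneg s), mul_assoc,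
      ← lintegral_const_mul' (ENNReal.ofReal (|s| ^ (-q))) _ ENNReal.ofReal_ne_top]
    congr 1
    refine lintegral_congr fun τ => ?_
    by_cases hτ : τ ∈ T
    · rw [indicator_of_mem hτ, indicator_of_mem (show (s, s * τ) ∈
        {z : ℝ × ℝ | (δ ≤ |z.1| ∧ |z.1| < η) ∧ z.2 / z.1 ∈ T} from
          ⟨hs', by simpa only [mul_div_cancel_left₀ τ hs0] using hτ⟩), h s hs0 τ hτ]
    · rw [indicator_of_notMem hτ, mul_zero, indicator_of_notMem fun h => hτ (by
        have := h.2
        simpa only [mul_div_cancel_left₀ τ hs0] using this)]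
  · rw [indicator_of_notMem hs]
    refine (lintegral_congr fun t => ?_).trans lintegral_zero
    exact indicator_of_notMem (fun h => hs h.1) _

/-- The tangent-point density of two straight strands through the origin, whose directions have
inner product `c`. -/
noncomputable def lineDensity (q c : ℝ) (z : ℝ × ℝ) : ℝ≥0∞ :=
  ENNReal.ofReal ((2 * (|z.1| * √(1 - c ^ 2)) / (z.1 ^ 2 + z.2 ^ 2 - 2 * z.1 * z.2 * c)) ^ q)

theorem measurable_lineDensity (q c : ℝ) : Measurable (lineDensity q c) := by
  unfold lineDensity
  refine (Measurable.pow_const ?_ _).ennreal_ofReal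
  exact ((measurable_fst.abs.mul_const _).const_mul _).div (by fun_prop)

/-- The energy of the part of a straight crossing that lies between two squares. -/
theorem lintegral_lineDensity {q δ η c : ℝ} (hq : 2 < q) (hδ : 0 < δ) (hη : δ ≤ η) (hc : |c| < 1) :
    ∫⁻ z in {z : ℝ × ℝ | |z.1| < η ∧ |z.2| < η} \ {z : ℝ × ℝ | |z.1| < δ ∧ |z.2| < δ},
      lineDensity q c z =
    ENNReal.ofReal
      ((δ ^ (2 - q) - η ^ (2 - q)) * ((2 : ℝ) ^ (q + 1) / (q - 2) * crossEnergy q c)) := by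
  set A : Set (ℝ × ℝ) := {z | (δ ≤ |z.1| ∧ |z.1| < η) ∧ z.2 / z.1 ∈ Icc (-1 : ℝ) 1} with hA
  set B : Set (ℝ × ℝ) := {z | (δ ≤ |z.1| ∧ |z.1| < η) ∧ z.2 / z.1 ∈ Ioo (-1 : ℝ) 1} with hB
  have hI : ∀ z : ℝ × ℝ, δ ≤ |z.1| → (z.2 / z.1 ∈ Icc (-1 : ℝ) 1 ↔ |z.2| ≤ |z.1|) := by
    intro z hz
    rw [mem_Icc, ← abs_le, abs_div, div_le_one (hδ.trans_le hz)]
  have hO : ∀ z : ℝ × ℝ, δ ≤ |z.1| → (z.2 / z.1 ∈ Ioo (-1 : ℝ) 1 ↔ |z.2| < |z.1|) := by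
    intro z hz
    rw [mem_Ioo, ← abs_lt, abs_div, div_lt_one (hδ.trans_le hz)]
  have hBm : MeasurableSet B := by
    refine MeasurableSet.inter (MeasurableSet.inter ?_ ?_) ?_
    · exact measurableSet_le measurable_const measurable_fst.abs
    · exact measurableSet_lt measurable_fst.abs measurable_const
    · exact (measurable_snd.div measurable_fst) measurableSet_Ioo
  have hset : {z : ℝ × ℝ | |z.1| < η ∧ |z.2| < η} \ {z : ℝ × ℝ | |z.1| < δ ∧ |z.2| < δ} =
      A ∪ Prod.swap ⁻¹' B := by
    ext z
    have i1 := hI z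
    have o1 := hO z.swap
    simp only [Prod.fst_swap, Prod.snd_swap] at o1
    simp only [hA, hB, Set.mem_sdiff, mem_ofPred_eq, mem_union, mem_preimage, not_and, not_lt,
      Prod.fst_swap, Prod.snd_swap]
    constructor
    · rintro ⟨⟨h1, h2⟩, h3⟩
      rcases le_or_gt |z.2| |z.1| with h | h
      · have : δ ≤ |z.1| := by
          by_contra h4; push Not at h4; linarith [h3 h4]
        exact Or.inl ⟨⟨this, h1⟩, (i1 this).2 h⟩
      · have : δ ≤ |z.2| := by
          by_contra h4; push Not at h4; linarith [h3 (h.trans h4)]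
        exact Or.inr ⟨⟨this, h2⟩, (o1 this).2 h⟩
    · rintro (⟨⟨h1, h2⟩, h3⟩ | ⟨⟨h1, h2⟩, h3⟩)
      · rw [i1 h1] at h3
        exact ⟨⟨h2, h3.trans_lt h2⟩, fun h => by linarith⟩
      · rw [o1 h1] at h3
        exact ⟨⟨h3.trans h2, h2⟩, fun _ => h1⟩
  have hd : Disjoint A (Prod.swap ⁻¹' B) := by
    rw [Set.disjoint_left]
    rintro z h1 h2
    have a := (hI z h1.1.1).1 h1.2
    have b := (hO z.swap h2.1.1).1 h2.2
    simp only [Prod.fst_swap, Prod.snd_swap] at b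
    linarith
  have key : ∀ s τ : ℝ, s ≠ 0 → ∀ a : ℝ, 0 ≤ a →
      (2 * (|s| * a * √(1 - c ^ 2)) / (s ^ 2 * (1 + τ ^ 2 - 2 * τ * c))) ^ q =
      |s| ^ (-q) * ((2 * a * √(1 - c ^ 2)) / (1 + τ ^ 2 - 2 * τ * c)) ^ q := by
    intro s τ hs a ha
    have hp := crossKernel_denom_pos hc τ
    have hs' := abs_pos.2 hs
    rw [show 2 * (|s| * a * √(1 - c ^ 2)) / (s ^ 2 * (1 + τ ^ 2 - 2 * τ * c)) =
      |s|⁻¹ * (2 * a * √(1 - c ^ 2) / (1 + τ ^ 2 - 2 * τ * c)) by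
        rw [← sq_abs s]; field_simp, Real.mul_rpow (by positivity) (by positivity),
        Real.inv_rpow hs'.le, ← Real.rpow_neg hs'.le]
  have hIA := lintegral_homogeneous hq hδ hη (measurable_lineDensity q c)
    (φ := fun τ => ENNReal.ofReal ((2 * 1 * √(1 - c ^ 2) / (1 + τ ^ 2 - 2 * τ * c)) ^ q))
    (measurableSet_Icc (a := (-1 : ℝ)) (b := 1)) (by
      intro s hs τ _
      rw [← ENNReal.ofReal_mul (by positivity), ← key s τ hs 1 zero_le_one, lineDensity]
      congr 3 <;> ring)
  have hIB := lintegral_homogeneous hq hδ hη ((measurable_lineDensity q c).comp measurable_swap)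
    (φ := fun τ => ENNReal.ofReal ((2 * |τ| * √(1 - c ^ 2) / (1 + τ ^ 2 - 2 * τ * c)) ^ q))
    (measurableSet_Ioo (a := (-1 : ℝ)) (b := 1)) (by
      intro s hs τ _
      rw [← ENNReal.ofReal_mul (by positivity), ← key s τ hs |τ| (abs_nonneg _), Function.comp,
        lineDensity]
      simp only [Prod.fst_swap, Prod.snd_swap, abs_mul]
      congr 3
      ring)
  have hswap : ∫⁻ z in Prod.swap ⁻¹' B, lineDensity q c z =
      ∫⁻ z in B, (lineDensity q c ∘ Prod.swap) z := by
    have := (Measure.measurePreserving_swap (μ := (volume : Measure ℝ))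
      (ν := (volume : Measure ℝ))).setLIntegral_comp_preimage hBm
        ((measurable_lineDensity q c).comp measurable_swap)
    simpa [Measure.volume_eq_prod] using this
  have hq2 : 0 < q - 2 := by linarith
  have hle : η ^ (2 - q) ≤ δ ^ (2 - q) := Real.rpow_le_rpow_of_nonpos hδ hη (by linarith)
  have hφ : (∫⁻ τ in Icc (-1 : ℝ) 1,
      ENNReal.ofReal ((2 * 1 * √(1 - c ^ 2) / (1 + τ ^ 2 - 2 * τ * c)) ^ q)) +
      ∫⁻ τ in Ioo (-1 : ℝ) 1,
        ENNReal.ofReal ((2 * |τ| * √(1 - c ^ 2) / (1 + τ ^ 2 - 2 * τ * c)) ^ q) =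
      ENNReal.ofReal (2 ^ q * crossEnergy q c) := by
    rw [setLIntegral_congr Ioc_ae_eq_Icc.symm, setLIntegral_congr Ioo_ae_eq_Ioc,
      ← lintegral_add_left, crossEnergy, intervalIntegral.integral_of_le (by norm_num),
      ← integral_const_mul, ofReal_integral_eq_lintegral_ofReal]
    · refine lintegral_congr fun τ => ?_
      have hp := crossKernel_denom_pos hc τ
      rw [← ENNReal.ofReal_add (by positivity) (by positivity), crossKernel]
      congr 1
      rw [show 2 * 1 * √(1 - c ^ 2) / (1 + τ ^ 2 - 2 * τ * c) =
        2 * (√(1 - c ^ 2) / (1 + τ ^ 2 - 2 * τ * c)) by ring,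
        show 2 * |τ| * √(1 - c ^ 2) / (1 + τ ^ 2 - 2 * τ * c) =
        2 * |τ| * (√(1 - c ^ 2) / (1 + τ ^ 2 - 2 * τ * c)) by ring,
        Real.mul_rpow (by positivity) (by positivity),
        Real.mul_rpow (by positivity) (by positivity),
        Real.mul_rpow (by positivity) (by positivity)]
      ring
    · exact ((continuous_const.mul (continuous_crossKernel hq hc)).integrableOn_Icc).mono_set
        Ioc_subset_Icc_self
    · exact Eventually.of_forall fun τ => mul_nonneg (by positivity) (crossKernel_pos hc τ).le
    · exact (Measurable.pow_const (by fun_prop) _).ennreal_ofReal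
  rw [hset, lintegral_union (measurable_swap hBm) hd, hIA, hswap, hIB, ← mul_add, hφ,
    ← ENNReal.ofReal_mul (div_nonneg (mul_nonneg (by norm_num) (sub_nonneg.2 hle)) hq2.le),
    Real.rpow_add_one (by norm_num)]
  congr 1
  ring

/-! ### Periodic integrands -/

theorem Function.Periodic.setLIntegral_Ico_eq {g : ℝ → ℝ≥0∞} (hg : Function.Periodic g 1)
    (a b : ℝ) : ∫⁻ x in Ico a (a + 1), g x = ∫⁻ x in Ico b (b + 1), g x := by
  rw [← setLIntegral_congr Ico_ae_eq_Ioc.symm, ← setLIntegral_congr Ico_ae_eq_Ioc.symm]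
  exact (isAddFundamentalDomain_Ioc one_pos a).setLIntegral_eq
    (isAddFundamentalDomain_Ioc one_pos b) g hg.map_vadd_zmultiples

theorem setLIntegral_square_eq {g : ℝ × ℝ → ℝ≥0∞} (hm : Measurable g)
    (h1 : ∀ x y, g (x + 1, y) = g (x, y)) (h2 : ∀ x y, g (x, y + 1) = g (x, y)) (a b : ℝ) :
    ∫⁻ z in Ico (0 : ℝ) 1 ×ˢ Ico (0 : ℝ) 1, g z =
      ∫⁻ z in Ico a (a + 1) ×ˢ Ico b (b + 1), g z := by
  rw [Measure.volume_eq_prod, setLIntegral_prod _ hm.aemeasurable,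
    setLIntegral_prod _ hm.aemeasurable]
  have e : ∀ x, ∫⁻ y in Ico (0 : ℝ) 1, g (x, y) = ∫⁻ y in Ico b (b + 1), g (x, y) := fun x => by
    have := Function.Periodic.setLIntegral_Ico_eq (g := fun y => g (x, y)) (h2 x) 0 b
    rwa [zero_add] at this
  simp_rw [e]
  have := Function.Periodic.setLIntegral_Ico_eq (g := fun x => ∫⁻ y in Ico b (b + 1), g (x, y))
    (fun x => by simp only [h1]) 0 a
  rwa [zero_add] at this

namespace C1Loop

/-! ### The tangent-point density of unit speed curves -/

/-- The parameter pairs that are `r`-close to `p` modulo integers. -/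
def cell (p : ℝ × ℝ) (r : ℝ) : Set (ℝ × ℝ) :=
  {z | ∃ i j : ℤ, |z.1 - p.1 - i| < r ∧ |z.2 - p.2 - j| < r}

theorem isOpen_cell (p : ℝ × ℝ) (r : ℝ) : IsOpen (cell p r) := by
  have : cell p r = ⋃ i : ℤ, ⋃ j : ℤ, {z | |z.1 - p.1 - i| < r ∧ |z.2 - p.2 - j| < r} := by
    ext z; simp [cell]
  rw [this]
  refine isOpen_iUnion fun i => isOpen_iUnion fun j => IsOpen.inter ?_ ?_
  · exact isOpen_lt (f := fun z : ℝ × ℝ => |z.1 - p.1 - i|) (by fun_prop) continuous_const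
  · exact isOpen_lt (f := fun z : ℝ × ℝ => |z.2 - p.2 - j|) (by fun_prop) continuous_const

theorem cell_mono (p : ℝ × ℝ) {r r' : ℝ} (h : r ≤ r') : cell p r ⊆ cell p r' :=
  fun _ ⟨i, j, h1, h2⟩ => ⟨i, j, h1.trans_le h, h2.trans_le h⟩

theorem mem_cell_add_fst {p : ℝ × ℝ} {r x y : ℝ} : (x + 1, y) ∈ cell p r ↔ (x, y) ∈ cell p r := by
  constructor
  · rintro ⟨i, j, h1, h2⟩
    refine ⟨i - 1, j, ?_, h2⟩
    push_cast
    simpa only [show x - p.1 - ((i : ℝ) - 1) = x + 1 - p.1 - i by ring] using h1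
  · rintro ⟨i, j, h1, h2⟩
    refine ⟨i + 1, j, ?_, h2⟩
    push_cast
    simpa only [show x + 1 - p.1 - ((i : ℝ) + 1) = x - p.1 - i by ring] using h1

theorem mem_cell_swap {p : ℝ × ℝ} {r x y : ℝ} : (x, y) ∈ cell p r ↔ (y, x) ∈ cell p.swap r :=
  ⟨fun ⟨i, j, h1, h2⟩ => ⟨j, i, h2, h1⟩, fun ⟨i, j, h1, h2⟩ => ⟨j, i, h2, h1⟩⟩

theorem mem_cell_add_snd {p : ℝ × ℝ} {r x y : ℝ} : (x, y + 1) ∈ cell p r ↔ (x, y) ∈ cell p r := by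
  rw [mem_cell_swap, mem_cell_add_fst, ← mem_cell_swap]

theorem intrinsicDist_lt_iff {γ : C1Loop} (hU : ∀ t, ‖γ.vel t‖ = 1) {x y δ : ℝ} :
    γ.intrinsicDist x y < δ ↔ ∃ i : ℤ, |x - y - i| < δ := by
  have h : ∀ k : ℤ, |∫ τ in x..(y + k), ‖γ.vel τ‖| = |x - y - k| := fun k => by
    simp only [hU, intervalIntegral.integral_const, smul_eq_mul, mul_one]
    rw [abs_sub_comm]
    ring_nf
  unfold intrinsicDist
  simp_rw [h]
  exact ciInf_lt_iff ⟨0, by rintro _ ⟨k, rfl⟩; positivity⟩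

theorem nearSelfInt_eq {γ : C1Loop} (hU : ∀ t, ‖γ.vel t‖ = 1) (δ : ℝ) :
    γ.nearSelfInt δ = ⋃ p ∈ γ.dblPts, cell p δ := by
  ext z
  simp only [nearSelfInt, intrinsicDist_lt_iff hU, mem_ofPred_eq, mem_iUnion, exists_prop,
    dblPts_eq, cell]
  constructor
  · rintro ⟨p, hp, ⟨⟨i, hi⟩, j, hj⟩ | ⟨⟨i, hi⟩, j, hj⟩⟩
    · exact ⟨p, Or.inl hp, i, j, hi, hj⟩
    · exact ⟨p.swap, Or.inr ⟨p, hp, rfl⟩, i, j, hi, hj⟩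
  · rintro ⟨p, hp | ⟨p, hp, rfl⟩, i, j, hi, hj⟩
    · exact ⟨p, hp, Or.inl ⟨⟨i, hi⟩, j, hj⟩⟩
    · exact ⟨p, hp, Or.inr ⟨⟨i, hi⟩, j, hj⟩⟩

/-- The integrand of the tangent-point energy. -/
noncomputable def tpDensity (q : ℝ) (γ : C1Loop) (z : ℝ × ℝ) : ℝ≥0∞ :=
  ENNReal.ofReal
    ((2 * Metric.infDist (γ z.1) (γ.tangentLine z.2) / ‖γ z.2 - γ z.1‖ ^ 2) ^ q *
      (‖γ.vel z.1‖ * ‖γ.vel z.2‖))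

/-- The distance of `w` to the line through `p` in the unit direction `v` is the modulus of an
imaginary part. -/
theorem infDist_line {v : ℂ} (hv : ‖v‖ = 1) (w p : ℂ) :
    Metric.infDist w (range fun r : ℝ => p + r • v) = |(starRingEnd ℂ v * (w - p)).im| := by
  have hvv : starRingEnd ℂ v * v = 1 := by
    rw [mul_comm, Complex.mul_conj, Complex.normSq_eq_norm_sq, hv]; norm_num
  have hv' : ‖starRingEnd ℂ v‖ = 1 := by rw [Complex.norm_conj, hv]
  have him : ∀ r : ℝ, starRingEnd ℂ v * (w - (p + r • v)) = starRingEnd ℂ v * (w - p) - r := by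
    intro r
    rw [Complex.real_smul]
    linear_combination (-(r : ℂ)) * hvv
  have hd : ∀ r : ℝ, dist w (p + r • v) = ‖starRingEnd ℂ v * (w - p) - r‖ := by
    intro r
    rw [← him, norm_mul, hv', one_mul, dist_eq_norm]
  apply le_antisymm
  · refine (Metric.infDist_le_dist_of_mem (mem_range_self (starRingEnd ℂ v * (w - p)).re)).trans ?_
    rw [hd]
    generalize starRingEnd ℂ v * (w - p) = a
    rw [show a - (a.re : ℂ) = (a.im : ℂ) * Complex.I by
      apply Complex.ext <;> simp]
    simp
  · refine (Metric.le_infDist (range_nonempty _)).2 ?_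
    rintro _ ⟨r, rfl⟩
    rw [hd]
    refine le_trans (le_of_eq ?_) (Complex.abs_im_le_norm _)
    simp

theorem tpDensity_eq {γ : C1Loop} (hU : ∀ t, ‖γ.vel t‖ = 1) (q : ℝ) (z : ℝ × ℝ) :
    γ.tpDensity q z = ENNReal.ofReal
      ((2 * |(starRingEnd ℂ (γ.vel z.2) * (γ z.1 - γ z.2)).im| / ‖γ z.2 - γ z.1‖ ^ 2) ^ q) := by
  rw [tpDensity, tangentLine, infDist_line (hU _), hU, hU, mul_one, mul_one]

theorem measurable_tpDensity {γ : C1Loop} (hU : ∀ t, ‖γ.vel t‖ = 1) (q : ℝ) :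
    Measurable (γ.tpDensity q) := by
  have : γ.tpDensity q = _ := funext (tpDensity_eq hU q)
  rw [this]
  have h1 : Continuous γ := γ.continuous
  have h2 := γ.continuous_vel
  refine (Measurable.pow_const (Measurable.div ?_ ?_) _).ennreal_ofReal
  · refine Continuous.measurable ?_
    refine continuous_const.mul (continuous_abs.comp (Complex.continuous_im.comp ?_))
    exact (Complex.continuous_conj.comp (h2.comp continuous_snd)).mul
      ((h1.comp continuous_fst).sub (h1.comp continuous_snd))
  · exact Continuous.measurable
      (((h1.comp continuous_snd).sub (h1.comp continuous_fst)).norm.pow 2)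

theorem tpDensity_add_fst {γ : C1Loop} (hU : ∀ t, ‖γ.vel t‖ = 1) (q x y : ℝ) :
    γ.tpDensity q (x + 1, y) = γ.tpDensity q (x, y) := by
  rw [tpDensity_eq hU, tpDensity_eq hU]
  simp only [γ.periodic x]

theorem tpDensity_add_snd {γ : C1Loop} (hU : ∀ t, ‖γ.vel t‖ = 1) (q x y : ℝ) :
    γ.tpDensity q (x, y + 1) = γ.tpDensity q (x, y) := by
  rw [tpDensity_eq hU, tpDensity_eq hU]
  simp only [γ.periodic y, γ.vel_periodic y]

theorem velCos_eq {γ : C1Loop} (hU : ∀ t, ‖γ.vel t‖ = 1) (p : ℝ × ℝ) :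
    γ.velCos p = (starRingEnd ℂ (γ.vel p.2) * γ.vel p.1).re := by
  rw [velCos, InnerProductGeometry.cos_angle, hU, hU, real_inner_comm, Complex.inner]
  simp [mul_comm]

theorem abs_im_eq {γ : C1Loop} (hU : ∀ t, ‖γ.vel t‖ = 1) (p : ℝ × ℝ) :
    |(starRingEnd ℂ (γ.vel p.2) * γ.vel p.1).im| = √(1 - γ.velCos p ^ 2) := by
  have h : ‖starRingEnd ℂ (γ.vel p.2) * γ.vel p.1‖ = 1 := by
    rw [norm_mul, Complex.norm_conj, hU, hU, one_mul]
  have h2 := Complex.sq_norm_sub_sq_re (starRingEnd ℂ (γ.vel p.2) * γ.vel p.1)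
  rw [h, one_pow] at h2
  rw [velCos_eq hU, h2, Real.sqrt_sq_eq_abs]

theorem abs_velCos_lt_one {γ : C1Loop} {p : ℝ × ℝ}
    (hp : LinearIndependent ℝ ![γ.vel p.1, γ.vel p.2]) : |γ.velCos p| < 1 := by
  refine lt_of_le_of_ne (abs_le.2 ⟨Real.neg_one_le_cos _, Real.cos_le_one _⟩) fun h => ?_
  rw [velCos, InnerProductGeometry.cos_angle, abs_div, abs_mul, abs_norm, abs_norm] at h
  have h0 : γ.vel p.1 ≠ 0 := hp.ne_zero 0
  have h1 : |inner ℝ (γ.vel p.1) (γ.vel p.2) / (‖γ.vel p.1‖ * ‖γ.vel p.2‖)| = 1 := by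
    rw [abs_div, abs_mul, abs_norm, abs_norm, h]
  obtain ⟨-, r, -, hr⟩ := abs_real_inner_div_norm_mul_norm_eq_one_iff _ _ |>.1 h1
  have := LinearIndependent.pair_iff.1 hp r (-1) (by rw [hr]; simp)
  norm_num at this

/-- The density near a double point at which both strands are straight. -/
theorem tpDensity_eq_lineDensity {γ : C1Loop} (hU : ∀ t, ‖γ.vel t‖ = 1) (q : ℝ) {p z : ℝ × ℝ}
    (h0 : γ p.1 = γ p.2) (h1 : γ z.1 = γ p.1 + (z.1 - p.1) • γ.vel p.1)
    (h2 : γ z.2 = γ p.2 + (z.2 - p.2) • γ.vel p.2) (h3 : γ.vel z.2 = γ.vel p.2) :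
    γ.tpDensity q z = lineDensity q (γ.velCos p) (z.1 - p.1, z.2 - p.2) := by
  rw [tpDensity_eq hU, lineDensity, h1, h2, h3, h0]
  have e1 : |(starRingEnd ℂ (γ.vel p.2) * (γ p.2 + (z.1 - p.1) • γ.vel p.1 -
      (γ p.2 + (z.2 - p.2) • γ.vel p.2))).im| = |z.1 - p.1| * √(1 - γ.velCos p ^ 2) := by
    rw [← abs_im_eq hU, ← abs_mul]
    congr 1
    have hvv : starRingEnd ℂ (γ.vel p.2) * γ.vel p.2 = 1 := by
      rw [mul_comm, Complex.mul_conj, Complex.normSq_eq_norm_sq, hU]; norm_num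
    rw [show starRingEnd ℂ (γ.vel p.2) * (γ p.2 + (z.1 - p.1) • γ.vel p.1 -
      (γ p.2 + (z.2 - p.2) • γ.vel p.2)) = ((z.1 - p.1 : ℝ) : ℂ) *
        (starRingEnd ℂ (γ.vel p.2) * γ.vel p.1) - ((z.2 - p.2 : ℝ) : ℂ) by
          rw [Complex.real_smul, Complex.real_smul]
          linear_combination (-((z.2 - p.2 : ℝ) : ℂ)) * hvv]
    rw [Complex.sub_im, Complex.im_ofReal_mul, Complex.ofReal_im, sub_zero]
  have e2 : ‖γ p.2 + (z.2 - p.2) • γ.vel p.2 - (γ p.2 + (z.1 - p.1) • γ.vel p.1)‖ ^ 2 =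
      (z.1 - p.1) ^ 2 + (z.2 - p.2) ^ 2 - 2 * (z.1 - p.1) * (z.2 - p.2) * γ.velCos p := by
    rw [add_sub_add_left_eq_sub, norm_sub_sq_real, norm_smul, norm_smul, hU, hU, inner_smul_left,
      inner_smul_right, velCos_eq hU, Complex.inner, Real.norm_eq_abs, Real.norm_eq_abs, mul_one,
      mul_one, sq_abs, sq_abs, mul_comm (γ.vel p.1)]
    simp only [conj_trivial]
    ring
  rw [e1, e2]

/-- Near a straight crossing, the energy between two squares is given by the crossing energy. -/
theorem lintegral_tpDensity_cell {γ : C1Loop} (hU : ∀ t, ‖γ.vel t‖ = 1) {q δ η : ℝ} (hq : 2 < q)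
    (hδ : 0 < δ) (hδη : δ ≤ η) (hη : η ≤ 1 / 2) {p : ℝ × ℝ} (h0 : γ p.1 = γ p.2)
    (hli : LinearIndependent ℝ ![γ.vel p.1, γ.vel p.2])
    (h1 : ∀ t, |t - p.1| < η → γ t = γ p.1 + (t - p.1) • γ.vel p.1)
    (h2 : ∀ t, |t - p.2| < η → γ t = γ p.2 + (t - p.2) • γ.vel p.2 ∧ γ.vel t = γ.vel p.2) :
    ∫⁻ z in Ico (0 : ℝ) 1 ×ˢ Ico (0 : ℝ) 1, (cell p η \ cell p δ).indicator (γ.tpDensity q) z =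
      ENNReal.ofReal ((δ ^ (2 - q) - η ^ (2 - q)) *
        ((2 : ℝ) ^ (q + 1) / (q - 2) * crossEnergy q (γ.velCos p))) := by
  have hm : MeasurableSet (cell p η \ cell p δ) :=
    (isOpen_cell p η).measurableSet.diff (isOpen_cell p δ).measurableSet
  set S : Set (ℝ × ℝ) := {z | |z.1| < η ∧ |z.2| < η} \ {z | |z.1| < δ ∧ |z.2| < δ} with hS
  have hSm : MeasurableSet S := by
    refine MeasurableSet.diff ?_ ?_ <;>
    exact (measurableSet_lt measurable_fst.abs measurable_const).inter
      (measurableSet_lt measurable_snd.abs measurable_const)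
  rw [setLIntegral_square_eq ((measurable_tpDensity hU q).indicator hm) _ _ (p.1 - 1 / 2)
    (p.2 - 1 / 2)]
  · have hloc : ∀ r ≤ η, ∀ z ∈ Ico (p.1 - 1 / 2) (p.1 - 1 / 2 + 1) ×ˢ
        Ico (p.2 - 1 / 2) (p.2 - 1 / 2 + 1),
        (z ∈ cell p r ↔ |z.1 - p.1| < r ∧ |z.2 - p.2| < r) := by
      have scal : ∀ r ≤ η, ∀ x a : ℝ, x ∈ Ico (a - 1 / 2) (a - 1 / 2 + 1) → ∀ i : ℤ,
          |x - a - i| < r → i = 0 := by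
        intro r hr x a hx i hi
        rw [abs_lt] at hi
        have b1 : (-1 : ℝ) < i := by linarith [hx.1, hi.2]
        have b2 : (i : ℝ) < 1 := by linarith [hx.2, hi.1]
        have b3 : -1 < i := by exact_mod_cast b1
        have b4 : i < 1 := by exact_mod_cast b2
        omega
      intro r hr z hz
      constructor
      · rintro ⟨i, j, hi, hj⟩
        have := scal r hr _ _ hz.1 i hi
        have := scal r hr _ _ hz.2 j hj
        subst i; subst j
        simpa using And.intro hi hj
      · rintro ⟨hi, hj⟩
        exact ⟨0, 0, by simpa using hi, by simpa using hj⟩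
    have hbox : MeasurableSet (Ico (p.1 - 1 / 2) (p.1 - 1 / 2 + 1) ×ˢ
        Ico (p.2 - 1 / 2) (p.2 - 1 / 2 + 1)) := measurableSet_Ico.prod measurableSet_Ico
    rw [← lintegral_lineDensity hq hδ hδη (abs_velCos_lt_one hli), ← lintegral_indicator hSm,
      ← lintegral_indicator hbox,
      ← lintegral_sub_right_eq_self (indicator S (lineDensity q (γ.velCos p))) p]
    refine lintegral_congr fun z => ?_
    by_cases hz : z - p ∈ S
    · have hz1 : |z.1 - p.1| < η ∧ |z.2 - p.2| < η := hz.1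
      have hzb : z ∈ Ico (p.1 - 1 / 2) (p.1 - 1 / 2 + 1) ×ˢ
          Ico (p.2 - 1 / 2) (p.2 - 1 / 2 + 1) := by
        have b1 := abs_lt.1 hz1.1
        have b2 := abs_lt.1 hz1.2
        exact ⟨⟨by linarith, by linarith⟩, ⟨by linarith, by linarith⟩⟩
      rw [indicator_of_mem hz, indicator_of_mem hzb, indicator_of_mem
        (show z ∈ cell p η \ cell p δ from
          ⟨(hloc η le_rfl z hzb).2 hz1, fun h => hz.2 ((hloc δ hδη z hzb).1 h)⟩)]
      exact tpDensity_eq_lineDensity hU q h0 (h1 _ hz1.1) (h2 _ hz1.2).1 (h2 _ hz1.2).2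
    · rw [indicator_of_notMem hz]
      by_cases hzb : z ∈ Ico (p.1 - 1 / 2) (p.1 - 1 / 2 + 1) ×ˢ
          Ico (p.2 - 1 / 2) (p.2 - 1 / 2 + 1)
      · rw [indicator_of_mem hzb, indicator_of_notMem]
        rintro ⟨k1, k2⟩
        exact hz ⟨(hloc η le_rfl z hzb).1 k1, fun h => k2 ((hloc δ hδη z hzb).2 h)⟩
      · rw [indicator_of_notMem hzb]
  · intro x y
    have : (x + 1, y) ∈ cell p η \ cell p δ ↔ (x, y) ∈ cell p η \ cell p δ := by
      rw [Set.mem_sdiff, Set.mem_sdiff, mem_cell_add_fst, mem_cell_add_fst]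
    by_cases h : (x, y) ∈ cell p η \ cell p δ
    · rw [indicator_of_mem h, indicator_of_mem (this.2 h), tpDensity_add_fst hU]
    · rw [indicator_of_notMem h, indicator_of_notMem (mt this.1 h)]
  · intro x y
    have : (x, y + 1) ∈ cell p η \ cell p δ ↔ (x, y) ∈ cell p η \ cell p δ := by
      rw [Set.mem_sdiff, Set.mem_sdiff, mem_cell_add_snd, mem_cell_add_snd]
    by_cases h : (x, y) ∈ cell p η \ cell p δ
    · rw [indicator_of_mem h, indicator_of_mem (this.2 h), tpDensity_add_snd hU]
    · rw [indicator_of_notMem h, indicator_of_notMem (mt this.1 h)]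

/-! ### Admissible curves -/

theorem fst_mem_selfIntParams {γ : C1Loop} {p : ℝ × ℝ} (hp : p ∈ γ.dblPts) :
    p.1 ∈ γ.selfIntParams := by
  rw [dblPts_eq] at hp
  rcases hp with hp | ⟨p, hp, rfl⟩
  · exact ⟨p, hp, Or.inl rfl⟩
  · exact ⟨p, hp, Or.inr rfl⟩

theorem snd_mem_selfIntParams {γ : C1Loop} {p : ℝ × ℝ} (hp : p ∈ γ.dblPts) :
    p.2 ∈ γ.selfIntParams := by
  rw [dblPts_eq] at hp
  rcases hp with hp | ⟨p, hp, rfl⟩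
  · exact ⟨p, hp, Or.inr rfl⟩
  · exact ⟨p, hp, Or.inl rfl⟩

theorem admissible_affine {γ : C1Loop} {η : ℝ} {jp jm s ω : ℤ} (hη : 0 < η)
    (h : γ ∈ admissible η jp jm s ω) {u : ℝ} (hu : u ∈ γ.selfIntParams) {t : ℝ}
    (ht : |t - u| < η) : γ t = γ u + (t - u) • γ.vel u ∧ γ.vel t = γ.vel u := by
  obtain ⟨P, v, hPv⟩ := h.2.2.2 u hu
  have hmem : ∀ {t}, |t - u| < η → t ∈ Ioo (u - η) (u + η) := fun {t} ht => by
    rw [abs_lt] at ht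
    exact ⟨by linarith, by linarith⟩
  have hvel : ∀ {t}, |t - u| < η → γ.vel t = v := fun {t} ht => by
    have h1 : γ =ᶠ[𝓝 t] fun t => P + (t - u) • v := by
      filter_upwards [isOpen_Ioo.mem_nhds (hmem ht)] with x hx
      exact hPv x hx
    have h2 : HasDerivAt (fun t : ℝ => P + (t - u) • v) ((1 : ℝ) • v) t :=
      (((hasDerivAt_id t).sub_const u).smul_const v).const_add P
    rw [one_smul] at h2
    exact (γ.hasDerivAt t).unique (h2.congr_of_eventuallyEq h1)
  have h0 : |u - u| < η := by simpa using hη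
  refine ⟨?_, (hvel ht).trans (hvel h0).symm⟩
  have e := hPv u (hmem h0)
  rw [sub_self, zero_smul, add_zero] at e
  rw [hPv t (hmem ht), e, hvel h0]

theorem admissible_sep {γ : C1Loop} {η : ℝ} {jp jm s ω : ℤ} (hη : 0 < η)
    (h : γ ∈ admissible η jp jm s ω) {a b : ℝ} (ha : a ∈ γ.selfIntParams)
    (hb : b ∈ γ.selfIntParams) (hab : a ≠ b) (k : ℤ) : 2 * η ≤ |a - b - k| := by
  by_contra hlt
  push Not at hlt
  have h1 : γ.intrinsicDist a b < 2 * η := (intrinsicDist_lt_iff h.2.1).2 ⟨k, hlt⟩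
  have h2 : γ.Lam ≤ ENNReal.ofReal (γ.intrinsicDist a b) :=
    (iInf₂_le a ha).trans ((iInf₂_le b hb).trans (iInf_le _ hab))
  have h3 := (ENNReal.ofReal_le_ofReal_iff' (p := 2 * η)).1 (h.2.2.1.trans h2)
  rcases h3 with h3 | h3 <;> linarith

theorem admissible_le_quarter {γ : C1Loop} {η : ℝ} {jp jm s ω : ℤ} (hη : 0 < η)
    (h : γ ∈ admissible η jp jm s ω) {p : ℝ × ℝ} (hp : p ∈ γ.dblPts) : η ≤ 1 / 4 := by
  have hs := admissible_sep hη h (fst_mem_selfIntParams hp) (snd_mem_selfIntParams hp) hp.2.2.1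
  obtain ⟨⟨a, b⟩, ⟨c, d⟩, e, -⟩ := hp
  rcases lt_or_gt_of_ne e with l | l
  · have h1 := hs 0
    have h2 := hs (-1)
    push_cast at h1 h2
    rw [abs_of_nonpos (by linarith)] at h1
    rw [abs_of_nonneg (by linarith)] at h2
    linarith
  · have h1 := hs 0
    have h2 := hs 1
    push_cast at h1 h2
    rw [abs_of_nonneg (by linarith)] at h1
    rw [abs_of_nonpos (by linarith)] at h2
    linarith

/-- The exact dependence of the truncated energy of an admissible curve on the truncation. -/
theorem TP_eq_add_sum {γ : C1Loop} {η : ℝ} {jp jm s ω : ℤ} (hη : 0 < η)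
    (h : γ ∈ admissible η jp jm s ω) {q δ : ℝ} (hq : 2 < q) (hδ : 0 < δ) (hδη : δ ≤ η) :
    γ.TP q δ = γ.TP q η + ∑ p ∈ h.1.1.finite_dblPts.toFinset,
      ENNReal.ofReal ((δ ^ (2 - q) - η ^ (2 - q)) *
        ((2 : ℝ) ^ (q + 1) / (q - 2) * crossEnergy q (γ.velCos p))) := by
  have hU := h.2.1
  set D := h.1.1.finite_dblPts.toFinset with hD
  have hmD : ∀ p, p ∈ D ↔ p ∈ γ.dblPts := fun p => Set.Finite.mem_toFinset _
  set Ω : Set (ℝ × ℝ) := Ico (0 : ℝ) 1 ×ˢ Ico (0 : ℝ) 1 with hΩ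
  have hΩm : MeasurableSet Ω := measurableSet_Ico.prod measurableSet_Ico
  have hdisj : ∀ p ∈ γ.dblPts, ∀ p' ∈ γ.dblPts, ∀ z, z ∈ cell p η → z ∈ cell p' η → p = p' := by
    rintro p hp p' hp' z ⟨i, j, hi, hj⟩ ⟨i', j', hi', hj'⟩
    have e : ∀ {x a b : ℝ} {i i' : ℤ}, |x - a - i| < η → |x - b - i'| < η →
        |a - b - (i' - i : ℤ)| < 2 * η := by
      intro x a b i i' h1 h2
      calc |a - b - (i' - i : ℤ)| = |(x - b - i') - (x - a - i)| := by push_cast; ring_nf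
        _ ≤ |x - b - i'| + |x - a - i| := abs_sub _ _
        _ < 2 * η := by linarith
    ext
    · by_contra hne
      have := admissible_sep hη h (fst_mem_selfIntParams hp) (fst_mem_selfIntParams hp') hne
        (i' - i)
      linarith [e hi hi']
    · by_contra hne
      have := admissible_sep hη h (snd_mem_selfIntParams hp) (snd_mem_selfIntParams hp') hne
        (j' - j)
      linarith [e hj hj']
  have hcm : ∀ p r, MeasurableSet (cell p r) := fun p r => (isOpen_cell p r).measurableSet
  have hset : Ω \ γ.nearSelfInt δ = (Ω \ γ.nearSelfInt η) ∪
      ⋃ p ∈ D, Ω ∩ (cell p η \ cell p δ) := by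
    rw [nearSelfInt_eq hU, nearSelfInt_eq hU]
    ext z
    simp only [Set.mem_sdiff, mem_iUnion, mem_union, exists_prop, mem_inter_iff, not_exists,
      not_and, hmD]
    constructor
    · rintro ⟨h1, h2⟩
      by_cases h3 : ∀ p ∈ γ.dblPts, z ∉ cell p η
      · exact Or.inl ⟨h1, h3⟩
      · push Not at h3
        obtain ⟨p, hp, hz⟩ := h3
        exact Or.inr ⟨p, hp, h1, hz, h2 p hp⟩
    · rintro (⟨h1, h2⟩ | ⟨p, hp, h1, h2, h3⟩)
      · exact ⟨h1, fun p hp hz => h2 p hp (cell_mono p hδη hz)⟩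
      · refine ⟨h1, fun p' hp' hz => h3 ?_⟩
        rw [hdisj p hp p' hp' z h2 (cell_mono p' hδη hz)]
        exact hz
  have hd1 : Disjoint (Ω \ γ.nearSelfInt η) (⋃ p ∈ D, Ω ∩ (cell p η \ cell p δ)) := by
    rw [nearSelfInt_eq hU, Set.disjoint_left]
    intro z h1 h2
    simp only [mem_iUnion, exists_prop, hmD] at h2
    obtain ⟨p, hp, -, hz, -⟩ := h2
    exact h1.2 (mem_biUnion hp hz)
  change ∫⁻ z in Ω \ γ.nearSelfInt δ, γ.tpDensity q z = _
  rw [hset, lintegral_union (Finset.measurableSet_biUnion _ fun p _ =>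
    hΩm.inter ((hcm p η).diff (hcm p δ))) hd1, lintegral_biUnion_finset]
  · congr 1
    refine Finset.sum_congr rfl fun p hp => ?_
    rw [hmD] at hp
    rw [← lintegral_tpDensity_cell hU hq hδ hδη
      ((admissible_le_quarter hη h hp).trans (by norm_num)) hp.2.2.2 (h.1.1.linearIndependent hp)
      (fun t ht => (admissible_affine hη h (fst_mem_selfIntParams hp) ht).1)
      (fun t ht => admissible_affine hη h (snd_mem_selfIntParams hp) ht),
      setLIntegral_indicator ((hcm p η).diff (hcm p δ)), inter_comm]
  · intro p hp p' hp' hne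
    rw [Function.onFun, Set.disjoint_left]
    intro z h1 h2
    exact hne (hdisj p ((hmD p).1 hp) p' ((hmD p').1 hp') z h1.2.1 h2.2.1)
  · exact fun p _ => hΩm.inter ((hcm p η).diff (hcm p δ))

end C1Loop

namespace C1Loop

/-! ### Finiteness of the energy away from the double points -/

theorem exists_uniform_vel (γ : C1Loop) {ε : ℝ} (hε : 0 < ε) : ∃ r > 0, r ≤ 1 / 2 ∧
    ∀ t w : ℝ, |w| < r → ‖γ.vel (t + w) - γ.vel t‖ ≤ ε := by
  have h := (isCompact_Icc (a := (0 : ℝ)) (b := 1)).eventually_forall_of_forall_eventually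
    (x₀ := (0 : ℝ)) (P := fun w t => ‖γ.vel (t + w) - γ.vel t‖ < ε) fun t _ => by
      have hc : Continuous fun z : ℝ × ℝ => ‖γ.vel (z.2 + z.1) - γ.vel z.2‖ :=
        ((γ.continuous_vel.comp (continuous_snd.add continuous_fst)).sub
          (γ.continuous_vel.comp continuous_snd)).norm
      refine (hc.continuousAt (x := ((0 : ℝ), t))).eventually_lt_const ?_
      simpa using hε
  obtain ⟨r, hr, hr'⟩ := Metric.eventually_nhds_iff.1 h
  refine ⟨min r (1 / 2), lt_min hr (by norm_num), min_le_right _ _, fun t w hw => ?_⟩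
  have := hr' (y := w) (by rw [Real.dist_eq, sub_zero]; exact hw.trans_le (min_le_left _ _))
    (Int.fract t) ⟨Int.fract_nonneg t, (Int.fract_lt_one t).le⟩
  rw [γ.vel_fract, show Int.fract t + w = t + w + ((-⌊t⌋ : ℤ) : ℝ) by
    rw [Int.fract]; push_cast; ring, γ.vel_add_int] at this
  exact this.le

theorem norm_sub_sub_le_integral (γ : C1Loop) (t w : ℝ) :
    ‖γ (t + w) - γ t - w • γ.vel t‖ ≤
      |w| * ∫ θ in (0 : ℝ)..1, ‖γ.vel (t + w * θ) - γ.vel t‖ := by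
  have hd : ∀ θ : ℝ, HasDerivAt (fun θ : ℝ => γ (t + w * θ) - (w * θ) • γ.vel t)
      (w • (γ.vel (t + w * θ) - γ.vel t)) θ := by
    intro θ
    have h1 : HasDerivAt (fun θ : ℝ => w * θ) w θ := by
      simpa using (hasDerivAt_id θ).const_mul w
    have := ((γ.hasDerivAt (t + w * θ)).scomp θ (h1.const_add t)).sub (h1.smul_const (γ.vel t))
    rw [← smul_sub] at this
    exact this
  have hc : Continuous fun θ : ℝ => γ.vel (t + w * θ) - γ.vel t :=
    (γ.continuous_vel.comp (by fun_prop)).sub continuous_const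
  have := intervalIntegral.integral_eq_sub_of_hasDerivAt (a := 0) (b := 1) (fun θ _ => hd θ)
    ((hc.const_smul w).intervalIntegrable _ _)
  simp only [mul_one, mul_zero, add_zero, zero_smul, sub_zero] at this
  rw [show γ (t + w) - γ t - w • γ.vel t = γ (t + w) - w • γ.vel t - γ t by abel, ← this,
    intervalIntegral.integral_smul, norm_smul, Real.norm_eq_abs]
  exact mul_le_mul_of_nonneg_left
    (intervalIntegral.norm_integral_le_integral_norm zero_le_one) (abs_nonneg _)

/-- Jensen's inequality for a power on the unit interval. -/
theorem _root_.ofReal_integral_rpow_le {h : ℝ → ℝ} (hc : Continuous h) (h0 : ∀ θ, 0 ≤ h θ) {q : ℝ}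
    (hq : 1 ≤ q) : ENNReal.ofReal ((∫ θ in (0 : ℝ)..1, h θ) ^ q) ≤
      ∫⁻ θ in Ioc (0 : ℝ) 1, ENNReal.ofReal (h θ ^ q) := by
  have hcq : Continuous fun θ => h θ ^ q := hc.rpow_const fun _ => Or.inr (by linarith)
  have hi : ∀ {k : ℝ → ℝ}, Continuous k → IntegrableOn k (Ioc 0 1) := fun hk =>
    hk.integrableOn_Icc.mono_set Ioc_subset_Icc_self
  rw [← ofReal_integral_eq_lintegral_ofReal (hi hcq) (Eventually.of_forall fun θ =>
    Real.rpow_nonneg (h0 θ) q), intervalIntegral.integral_of_le zero_le_one]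
  have : IsProbabilityMeasure ((volume : Measure ℝ).restrict (Ioc 0 1)) := ⟨by simp⟩
  exact ENNReal.ofReal_le_ofReal ((convexOn_rpow hq).map_integral_le
    (continuousOn_id.rpow_const fun _ _ => Or.inr (by linarith)) isClosed_Ici
    (Eventually.of_forall h0) (hi hc) (hi hcq))

/-- Close to the diagonal, the density is bounded by a mean of the Gagliardo quotients. -/
theorem tpDensity_le_mean {γ : C1Loop} (hU : ∀ t, ‖γ.vel t‖ = 1) {q : ℝ} (hq : 2 < q) {t w : ℝ}
    (hw : ∀ θ ∈ Icc (0 : ℝ) 1, ‖γ.vel (t + w * θ) - γ.vel t‖ ≤ 1 / 2) :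
    γ.tpDensity q (t + w, t) ≤ ENNReal.ofReal (8 ^ q) *
      ∫⁻ θ in Ioc (0 : ℝ) 1, ENNReal.ofReal (‖γ.vel (t + w * θ) - γ.vel t‖ ^ q / |w| ^ q) := by
  have hc : Continuous fun θ : ℝ => ‖γ.vel (t + w * θ) - γ.vel t‖ :=
    ((γ.continuous_vel.comp (by fun_prop)).sub continuous_const).norm
  rw [tpDensity_eq hU]
  rcases eq_or_ne w 0 with rfl | hw0
  · have : (0 : ℝ) ^ q = 0 := Real.zero_rpow (by linarith)
    simp [this]
  have hwp : 0 < |w| := abs_pos.2 hw0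
  set I := ∫ θ in (0 : ℝ)..1, ‖γ.vel (t + w * θ) - γ.vel t‖ with hI
  have hI0 : 0 ≤ I := intervalIntegral.integral_nonneg zero_le_one fun θ _ => norm_nonneg _
  have hI1 : I ≤ 1 / 2 := by
    calc I ≤ ∫ θ in (0 : ℝ)..1, (1 / 2 : ℝ) :=
          intervalIntegral.integral_mono_on zero_le_one (hc.intervalIntegrable _ _)
            (continuous_const.intervalIntegrable _ _) hw
      _ = 1 / 2 := by simp
  have hmain := γ.norm_sub_sub_le_integral t w
  rw [← hI] at hmain
  have hlow : |w| / 2 ≤ ‖γ t - γ (t + w)‖ := by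
    have h1 : ‖w • γ.vel t‖ = |w| := by rw [norm_smul, hU, mul_one, Real.norm_eq_abs]
    have h2 := norm_sub_norm_le (w • γ.vel t) (w • γ.vel t - (γ (t + w) - γ t))
    rw [sub_sub_cancel, norm_sub_rev (w • γ.vel t), h1] at h2
    rw [norm_sub_rev]
    nlinarith
  have hup : |(starRingEnd ℂ (γ.vel t) * (γ (t + w) - γ t)).im| ≤ |w| * I := by
    have hvv : starRingEnd ℂ (γ.vel t) * γ.vel t = 1 := by
      rw [mul_comm, Complex.mul_conj, Complex.normSq_eq_norm_sq, hU]; norm_num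
    have e : starRingEnd ℂ (γ.vel t) * (γ (t + w) - γ t) =
        starRingEnd ℂ (γ.vel t) * (γ (t + w) - γ t - w • γ.vel t) + (w : ℂ) := by
      rw [Complex.real_smul]
      linear_combination (w : ℂ) * hvv
    rw [e, Complex.add_im, Complex.ofReal_im, add_zero]
    refine (Complex.abs_im_le_norm _).trans ?_
    rw [norm_mul, Complex.norm_conj, hU, one_mul]
    exact hmain
  have hquot : 2 * |(starRingEnd ℂ (γ.vel t) * (γ (t + w) - γ t)).im| / ‖γ t - γ (t + w)‖ ^ 2 ≤
      8 * (I / |w|) := by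
    have hpos : 0 < ‖γ t - γ (t + w)‖ := (by positivity : 0 < |w| / 2).trans_le hlow
    rw [div_le_iff₀ (pow_pos hpos 2)]
    calc 2 * |(starRingEnd ℂ (γ.vel t) * (γ (t + w) - γ t)).im| ≤ 2 * (|w| * I) := by gcongr
      _ = 8 * (I / |w|) * (|w| / 2) ^ 2 := by field_simp; ring
      _ ≤ _ := by gcongr
  calc _ ≤ ENNReal.ofReal ((8 * (I / |w|)) ^ q) :=
        ENNReal.ofReal_le_ofReal (Real.rpow_le_rpow (by positivity) hquot (by linarith))
    _ = ENNReal.ofReal (8 ^ q) * (ENNReal.ofReal (I ^ q) * ENNReal.ofReal ((|w| ^ q)⁻¹)) := by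
        rw [Real.mul_rpow (by norm_num) (by positivity), Real.div_rpow hI0 hwp.le,
          ENNReal.ofReal_mul (by positivity), div_eq_mul_inv, ENNReal.ofReal_mul (by positivity)]
    _ ≤ ENNReal.ofReal (8 ^ q) * ((∫⁻ θ in Ioc (0 : ℝ) 1,
          ENNReal.ofReal (‖γ.vel (t + w * θ) - γ.vel t‖ ^ q)) * ENNReal.ofReal ((|w| ^ q)⁻¹)) := by
        gcongr
        exact ofReal_integral_rpow_le hc (fun θ => norm_nonneg _) (by linarith)
    _ = _ := by
        rw [← lintegral_mul_const' _ _ ENNReal.ofReal_ne_top]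
        congr 1
        refine lintegral_congr fun θ => ?_
        rw [← ENNReal.ofReal_mul (by positivity), div_eq_mul_inv]

/-- The substitution `w ↦ w θ` bounds the integrated means by the Gagliardo seminorm. -/
theorem lintegral_mean_le (γ : C1Loop) {q : ℝ} (hq : 2 < q) (t : ℝ) :
    ∫⁻ w in Icc (-(1 / 2) : ℝ) (1 / 2), ∫⁻ θ in Ioc (0 : ℝ) 1,
        ENNReal.ofReal (‖γ.vel (t + w * θ) - γ.vel t‖ ^ q / |w| ^ q) ≤
      ∫⁻ w in Icc (-(1 / 2) : ℝ) (1 / 2),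
        ENNReal.ofReal (‖γ.vel (t + w) - γ.vel t‖ ^ q / |w| ^ q) := by
  have hv := γ.continuous_vel.measurable
  have hm : Measurable fun z : ℝ × ℝ =>
      ENNReal.ofReal (‖γ.vel (t + z.1 * z.2) - γ.vel t‖ ^ q / |z.1| ^ q) := by
    refine (Measurable.div ?_ (measurable_fst.abs.pow_const _)).ennreal_ofReal
    exact Measurable.pow_const (((hv.comp (by fun_prop)).sub_const _).norm) _
  have hm1 : Measurable fun w : ℝ => ENNReal.ofReal (‖γ.vel (t + w) - γ.vel t‖ ^ q / |w| ^ q) := by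
    refine (Measurable.div ?_ (measurable_id.abs.pow_const _)).ennreal_ofReal
    exact Measurable.pow_const (((hv.comp (by fun_prop)).sub_const _).norm) _
  set J := ∫⁻ w in Icc (-(1 / 2) : ℝ) (1 / 2),
    ENNReal.ofReal (‖γ.vel (t + w) - γ.vel t‖ ^ q / |w| ^ q) with hJ
  rw [lintegral_lintegral_swap hm.aemeasurable]
  calc _ ≤ ∫⁻ θ in Ioc (0 : ℝ) 1, J := by
        refine setLIntegral_mono measurable_const fun θ hθ => ?_
        rw [hJ, ← lintegral_indicator measurableSet_Icc, ← lintegral_indicator measurableSet_Icc]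
        set g := indicator (Icc (-(1 / 2) : ℝ) (1 / 2))
          fun w : ℝ => ENNReal.ofReal (‖γ.vel (t + w) - γ.vel t‖ ^ q / |w| ^ q) with hg
        have hgm : Measurable g := hm1.indicator measurableSet_Icc
        rw [lintegral_comp_mul_left_real hgm hθ.1.ne', ← lintegral_const_mul _
          (f := fun w => g (θ * w)) (hgm.comp (measurable_const_mul θ))]
        refine lintegral_mono fun w => ?_
        by_cases hw : w ∈ Icc (-(1 / 2) : ℝ) (1 / 2)
        · have hwθ : θ * w ∈ Icc (-(1 / 2) : ℝ) (1 / 2) := by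
            rw [mem_Icc, ← abs_le] at hw ⊢
            rw [abs_mul, abs_of_pos hθ.1]
            exact (mul_le_of_le_one_left (abs_nonneg _) hθ.2).trans hw
          rw [indicator_of_mem hw, hg, indicator_of_mem hwθ, ← ENNReal.ofReal_mul (abs_nonneg θ),
            mul_comm w θ, abs_of_pos hθ.1]
          refine ENNReal.ofReal_le_ofReal ?_
          rcases eq_or_ne w 0 with rfl | hw0
          · simp [Real.zero_rpow (by linarith : q ≠ 0)]
          have hwp := abs_pos.2 hw0
          rw [abs_mul, abs_of_pos hθ.1, Real.mul_rpow hθ.1.le (abs_nonneg _),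
            show θ * (‖γ.vel (t + θ * w) - γ.vel t‖ ^ q / (θ ^ q * |w| ^ q)) =
              (θ / θ ^ q) * (‖γ.vel (t + θ * w) - γ.vel t‖ ^ q / |w| ^ q) by field_simp]
          refine le_mul_of_one_le_left (by positivity) ?_
          rw [one_le_div (Real.rpow_pos_of_pos hθ.1 q)]
          calc θ ^ q ≤ θ ^ (1 : ℝ) :=
                Real.rpow_le_rpow_of_exponent_ge hθ.1 hθ.2 (by linarith)
            _ = θ := Real.rpow_one θ
        · rw [indicator_of_notMem hw]
          exact zero_le
    _ = J := by simp

/-- The truncated energy of an arclength parametrized Sobolev curve is finite. -/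
theorem TP_lt_top {γ : C1Loop} (hU : ∀ t, ‖γ.vel t‖ = 1) {q η : ℝ} (hq : 2 < q) (hη : 0 < η)
    (hS : γ.InSobolev q) : γ.TP q η < ∞ := by
  obtain ⟨r, hr, hr2, hvel⟩ := γ.exists_uniform_vel (half_pos one_pos)
  set Ω : Set (ℝ × ℝ) := Ico (0 : ℝ) 1 ×ˢ Ico (0 : ℝ) 1 with hΩ
  have hΩm : MeasurableSet Ω := measurableSet_Ico.prod measurableSet_Ico
  set N : Set (ℝ × ℝ) := {z | ∃ k : ℤ, |z.1 - z.2 - k| < r} with hN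
  have hNo : IsOpen N := by
    have : N = ⋃ k : ℤ, {z : ℝ × ℝ | |z.1 - z.2 - k| < r} := by ext z; simp [hN]
    rw [this]
    exact isOpen_iUnion fun k =>
      isOpen_lt (f := fun z : ℝ × ℝ => |z.1 - z.2 - k|) (by fun_prop) continuous_const
  have hYo : IsOpen (γ.nearSelfInt η) := by
    rw [nearSelfInt_eq hU]
    exact isOpen_biUnion fun p _ => isOpen_cell p η
  have hf := measurable_tpDensity hU q
  change ∫⁻ z in Ω \ γ.nearSelfInt η, γ.tpDensity q z < ∞
  have hsub : Ω \ γ.nearSelfInt η ⊆ (Ω \ (γ.nearSelfInt η ∪ N)) ∪ (Ω ∩ N) := by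
    intro z hz
    by_cases h : z ∈ N
    · exact Or.inr ⟨hz.1, h⟩
    · exact Or.inl ⟨hz.1, fun h' => h'.elim hz.2 h⟩
  refine (lintegral_mono_set hsub).trans_lt ((lintegral_union_le _ _ _).trans_lt
    (ENNReal.add_lt_top.2 ⟨?_, ?_⟩))
  · -- away from the diagonal and the double points, the chord length is bounded below
    set K : Set (ℝ × ℝ) := (Icc (0 : ℝ) 1 ×ˢ Icc (0 : ℝ) 1) \ (γ.nearSelfInt η ∪ N) with hK
    have hKc : IsCompact K := (isCompact_Icc.prod isCompact_Icc).diff (hYo.union hNo)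
    have hpos : ∀ z ∈ K, 0 < ‖γ z.2 - γ z.1‖ := by
      intro z hz
      refine norm_pos_iff.2 fun h0 => hz.2 ?_
      by_cases hd : ∃ m : ℤ, z.1 - z.2 = m
      · obtain ⟨m, hm⟩ := hd
        exact Or.inr ⟨m, by simpa [hm] using hr⟩
      · push Not at hd
        refine Or.inl ?_
        rw [nearSelfInt_eq hU]
        refine mem_biUnion (fract_mem_dblPts (sub_eq_zero.1 h0).symm hd) ⟨⌊z.1⌋, ⌊z.2⌋, ?_, ?_⟩ <;>
        · simp only [Int.fract, sub_sub_cancel, sub_self, abs_zero]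
          exact hη
    have hcont : Continuous fun z : ℝ × ℝ => ‖γ z.2 - γ z.1‖ :=
      ((γ.continuous.comp continuous_snd).sub (γ.continuous.comp continuous_fst)).norm
    obtain ⟨c, hc, hcK⟩ : ∃ c > 0, ∀ z ∈ K, c ≤ ‖γ z.2 - γ z.1‖ := by
      rcases K.eq_empty_or_nonempty with hE | hne
      · exact ⟨1, one_pos, by simp [hE]⟩
      · obtain ⟨z, hz, hmin⟩ := hKc.exists_isMinOn hne hcont.continuousOn
        exact ⟨_, hpos z hz, fun z' hz' => hmin hz'⟩
    calc ∫⁻ z in Ω \ (γ.nearSelfInt η ∪ N), γ.tpDensity q z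
        ≤ ∫⁻ z in Ω \ (γ.nearSelfInt η ∪ N), ENNReal.ofReal ((2 / c) ^ q) := by
          refine setLIntegral_mono measurable_const fun z hz => ?_
          have hz' : c ≤ ‖γ z.2 - γ z.1‖ := hcK z ⟨⟨Ico_subset_Icc_self hz.1.1,
            Ico_subset_Icc_self hz.1.2⟩, hz.2⟩
          have hz0 : 0 < ‖γ z.2 - γ z.1‖ := hc.trans_le hz'
          rw [tpDensity_eq hU]
          refine ENNReal.ofReal_le_ofReal (Real.rpow_le_rpow (by positivity) ?_ (by linarith))
          have h1 : |(starRingEnd ℂ (γ.vel z.2) * (γ z.1 - γ z.2)).im| ≤ ‖γ z.2 - γ z.1‖ := by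
            refine (Complex.abs_im_le_norm _).trans ?_
            rw [norm_mul, Complex.norm_conj, hU, one_mul, norm_sub_rev]
          rw [div_le_div_iff₀ (by positivity) hc]
          nlinarith
      _ ≤ ∫⁻ z in Ω, ENNReal.ofReal ((2 / c) ^ q) := lintegral_mono_set sdiff_subset
      _ = ENNReal.ofReal ((2 / c) ^ q) := by
          rw [setLIntegral_const, hΩ, Measure.volume_eq_prod, Measure.prod_prod]
          simp
      _ < ∞ := ENNReal.ofReal_lt_top
  · -- near the diagonal, the density is controlled by the Sobolev seminorm
    have hgm : Measurable (N.indicator (γ.tpDensity q)) := hf.indicator hNo.measurableSet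
    have hper : ∀ x y, N.indicator (γ.tpDensity q) (x + 1, y) =
        N.indicator (γ.tpDensity q) (x, y) := by
      intro x y
      have : (x + 1, y) ∈ N ↔ (x, y) ∈ N := by
        constructor
        · rintro ⟨k, hk⟩
          refine ⟨k - 1, ?_⟩
          push_cast
          simpa only [show x - y - ((k : ℝ) - 1) = x + 1 - y - k by ring] using hk
        · rintro ⟨k, hk⟩
          refine ⟨k + 1, ?_⟩
          push_cast
          simpa only [show x + 1 - y - ((k : ℝ) + 1) = x - y - k by ring] using hk
      by_cases h : (x, y) ∈ N
      · rw [indicator_of_mem h, indicator_of_mem (this.2 h), tpDensity_add_fst hU]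
      · rw [indicator_of_notMem h, indicator_of_notMem (mt this.1 h)]
    have hin : ∀ t, ∫⁻ s in Ico (0 : ℝ) 1, N.indicator (γ.tpDensity q) (s, t) ≤
        ENNReal.ofReal (8 ^ q) * ∫⁻ w in Icc (-(1 / 2) : ℝ) (1 / 2),
          ENNReal.ofReal (‖γ.vel (t + w) - γ.vel t‖ ^ q / |w| ^ q) := by
      intro t
      have hsh := Function.Periodic.setLIntegral_Ico_eq
        (g := fun s => N.indicator (γ.tpDensity q) (s, t)) (fun x => hper x t) 0 (t - 1 / 2)
      rw [zero_add] at hsh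
      refine le_trans ?_ (mul_le_mul_right (γ.lintegral_mean_le hq t) _)
      rw [hsh, ← lintegral_indicator measurableSet_Ico,
        ← lintegral_add_left_eq_self _ t, ← lintegral_const_mul' _ _ ENNReal.ofReal_ne_top,
        ← lintegral_indicator measurableSet_Icc]
      refine lintegral_mono fun w => ?_
      by_cases hw : t + w ∈ Ico (t - 1 / 2) (t - 1 / 2 + 1)
      · have hw' : w ∈ Icc (-(1 / 2) : ℝ) (1 / 2) := ⟨by linarith [hw.1], by linarith [hw.2]⟩
        rw [indicator_of_mem hw, indicator_of_mem hw']
        by_cases hwN : (t + w, t) ∈ N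
        · rw [indicator_of_mem hwN]
          refine tpDensity_le_mean hU hq fun θ hθ => hvel _ _ ?_
          obtain ⟨k, hk⟩ := hwN
          simp only [add_sub_cancel_left] at hk
          rw [abs_lt] at hk
          have hk0 : k = 0 := by
            have b1 : (-1 : ℝ) < k := by linarith [hw.1, hk.2]
            have b2 : (k : ℝ) < 1 := by linarith [hw.2, hk.1]
            have b3 : -1 < k := by exact_mod_cast b1
            have b4 : k < 1 := by exact_mod_cast b2
            omega
          subst hk0
          rw [abs_mul, abs_of_nonneg hθ.1]
          have : |w| < r := abs_lt.2 (by simpa using hk)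
          exact (mul_le_of_le_one_right (abs_nonneg _) hθ.2).trans_lt this
        · rw [indicator_of_notMem hwN]
          exact zero_le
      · rw [indicator_of_notMem hw]
        exact zero_le
    calc ∫⁻ z in Ω ∩ N, γ.tpDensity q z = ∫⁻ z in Ω, N.indicator (γ.tpDensity q) z := by
          rw [setLIntegral_indicator hNo.measurableSet, inter_comm]
      _ = ∫⁻ t in Ico (0 : ℝ) 1, ∫⁻ s in Ico (0 : ℝ) 1, N.indicator (γ.tpDensity q) (s, t) := by
          rw [hΩ, Measure.volume_eq_prod, setLIntegral_prod_symm _ hgm.aemeasurable]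
      _ ≤ ∫⁻ t in Ico (0 : ℝ) 1, ENNReal.ofReal (8 ^ q) * ∫⁻ w in Icc (-(1 / 2) : ℝ) (1 / 2),
          ENNReal.ofReal (‖γ.vel (t + w) - γ.vel t‖ ^ q / |w| ^ q) := lintegral_mono hin
      _ = ENNReal.ofReal (8 ^ q) * ∫⁻ t in Ico (0 : ℝ) 1, ∫⁻ w in Icc (-(1 / 2) : ℝ) (1 / 2),
          ENNReal.ofReal (‖γ.vel (t + w) - γ.vel t‖ ^ q / |w| ^ q) :=
        lintegral_const_mul' _ _ ENNReal.ofReal_ne_top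
      _ < ∞ := ENNReal.mul_lt_top ENNReal.ofReal_lt_top hS

end C1Loop

namespace C1Loop

/-! ### The renormalized energy and its Gamma convergence -/

/-- The sum of the crossing energies over all ordered double points; each self-intersection
contributes twice. -/
noncomputable def angleSum (q : ℝ) (γ : C1Loop) : ℝ :=
  ∑ᶠ p ∈ γ.dblPts, crossEnergy q (γ.velCos p)

theorem cos_intAngle (γ : C1Loop) (p : ℝ × ℝ) : Real.cos (γ.intAngle p) = |γ.velCos p| := by
  unfold intAngle velCos
  set a := InnerProductGeometry.angle (γ.vel p.1) (γ.vel p.2) with ha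
  have h0 : 0 ≤ a := InnerProductGeometry.angle_nonneg _ _
  have h1 : a ≤ Real.pi := InnerProductGeometry.angle_le_pi _ _
  rcases le_total a (Real.pi / 2) with h | h
  · rw [min_eq_left (by linarith), abs_of_nonneg
      (Real.cos_nonneg_of_mem_Icc ⟨by linarith, h⟩)]
  · rw [min_eq_right (by linarith), Real.cos_pi_sub, abs_of_nonpos
      (Real.cos_nonpos_of_pi_div_two_le_of_le h (by linarith))]

theorem intAngle_le_pi_div_two (γ : C1Loop) (p : ℝ × ℝ) : γ.intAngle p ≤ Real.pi / 2 := by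
  unfold intAngle
  rcases le_total (InnerProductGeometry.angle (γ.vel p.1) (γ.vel p.2)) (Real.pi / 2) with h | h
  · exact (min_le_left _ _).trans h
  · exact (min_le_right _ _).trans (by linarith)

theorem intAngle_nonneg (γ : C1Loop) (p : ℝ × ℝ) : 0 ≤ γ.intAngle p :=
  le_min (InnerProductGeometry.angle_nonneg _ _)
    (sub_nonneg.2 (InnerProductGeometry.angle_le_pi _ _))

theorem intAngle_pos {γ : C1Loop} {p : ℝ × ℝ}
    (hp : LinearIndependent ℝ ![γ.vel p.1, γ.vel p.2]) : 0 < γ.intAngle p := by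
  refine (γ.intAngle_nonneg p).lt_of_ne fun h => ?_
  have h1 := abs_velCos_lt_one hp
  rw [← γ.cos_intAngle, ← h, Real.cos_zero] at h1
  exact lt_irrefl _ h1

theorem intAngle_eq_pi_div_two_iff (γ : C1Loop) (p : ℝ × ℝ) :
    γ.intAngle p = Real.pi / 2 ↔ γ.velCos p = 0 := by
  rw [← abs_eq_zero, ← γ.cos_intAngle]
  constructor
  · intro h
    rw [h, Real.cos_pi_div_two]
  · intro h
    have h0 := γ.intAngle_nonneg p
    have h1 := γ.intAngle_le_pi_div_two p
    refine Real.injOn_cos ⟨h0, by linarith [Real.pi_pos]⟩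
      ⟨by linarith [Real.pi_pos], by linarith [Real.pi_pos]⟩ ?_
    rw [h, Real.cos_pi_div_two]

theorem velCos_swap (γ : C1Loop) (p : ℝ × ℝ) : γ.velCos p.swap = γ.velCos p := by
  rw [velCos, velCos, InnerProductGeometry.angle_comm]
  rfl

theorem IsGeneric.angleSum_eq {γ : C1Loop} (hγ : γ.IsGeneric) {q : ℝ} (hq : 2 < q) :
    γ.angleSum q = 2 * ∑ᶠ p ∈ γ.selfInt, angleF q (γ.intAngle p) := by
  have h1 : ∑ᶠ p ∈ γ.selfInt, angleF q (γ.intAngle p) =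
      ∑ᶠ p ∈ γ.selfInt, crossEnergy q (γ.velCos p) := by
    refine finsum_mem_congr rfl fun p hp => ?_
    rw [angleF_eq_crossEnergy hq (intAngle_pos (hγ.linearIndependent (γ.selfInt_subset_dblPts hp)))
      (γ.intAngle_le_pi_div_two p), γ.cos_intAngle, crossEnergy_abs]
  rw [h1, angleSum, dblPts_eq, finsum_mem_union γ.disjoint_selfInt_swap hγ.2.1 (hγ.2.1.image _),
    finsum_mem_image Prod.swap_injective.injOn, two_mul]
  simp only [velCos_swap]

theorem IsGeneric.angleSum_eq_sum {γ : C1Loop} (hγ : γ.IsGeneric) (q : ℝ) :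
    γ.angleSum q = ∑ p ∈ hγ.finite_dblPts.toFinset, crossEnergy q (γ.velCos p) :=
  finsum_mem_eq_finite_toFinset_sum _ _

theorem IsGeneric.angleSum_nonneg {γ : C1Loop} (hγ : γ.IsGeneric) {q : ℝ} (hq : 2 < q) :
    0 ≤ γ.angleSum q := by
  rw [hγ.angleSum_eq_sum]
  refine Finset.sum_nonneg fun p hp => (crossEnergy_pos hq ?_).le
  exact abs_velCos_lt_one (hγ.linearIndependent (hγ.finite_dblPts.mem_toFinset.1 hp))

/-- The rescaled energy in closed form for all `δ ≤ η`, not just in the limit: the only term that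
depends on more than the angles is `δ ^ (q - 2)` times the energy truncated at `η`. -/
theorem rescaledTP_eq {γ : C1Loop} {η : ℝ} {jp jm s ω : ℤ} (hη : 0 < η)
    (h : γ ∈ admissible η jp jm s ω) {q δ : ℝ} (hq : 2 < q) (hδ : 0 < δ) (hδη : δ ≤ η) :
    γ.rescaledTP q δ = ENNReal.ofReal (δ ^ (q - 2)) * γ.TP q η +
      ENNReal.ofReal ((1 - (δ / η) ^ (q - 2)) * ((2 : ℝ) ^ (q + 1) / (q - 2) * γ.angleSum q)) := by
  have hc : 0 ≤ (2 : ℝ) ^ (q + 1) / (q - 2) := div_nonneg (by positivity) (by linarith)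
  have hle : η ^ (2 - q) ≤ δ ^ (2 - q) :=
    Real.rpow_le_rpow_of_nonpos hδ hδη (by linarith)
  rw [rescaledTP, TP_eq_add_sum hη h hq hδ hδη, mul_add, ← ENNReal.ofReal_sum_of_nonneg,
    ← ENNReal.ofReal_mul (by positivity), ← Finset.mul_sum, ← Finset.mul_sum,
    ← h.1.1.angleSum_eq_sum, ← mul_assoc]
  · congr 4
    rw [mul_sub, ← Real.rpow_add hδ, Real.div_rpow hδ.le hη.le, ← neg_sub q 2, Real.rpow_neg hη.le]
    simp [div_eq_mul_inv]
  · intro p hp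
    refine mul_nonneg (sub_nonneg.2 hle) (mul_nonneg hc (crossEnergy_pos hq ?_).le)
    exact abs_velCos_lt_one (h.1.1.linearIndependent (h.1.1.finite_dblPts.mem_toFinset.1 hp))

theorem tendsto_one_sub_rpow {η q : ℝ} (hq : 2 < q) :
    Tendsto (fun δ : ℝ => 1 - (δ / η) ^ (q - 2)) (𝓝[>] 0) (𝓝 1) := by
  have h : ContinuousAt (fun δ : ℝ => 1 - (δ / η) ^ (q - 2)) 0 :=
    continuousAt_const.sub ((continuousAt_id.div_const η).rpow_const (Or.inr (by linarith)))
  have := h.tendsto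
  simp only [zero_div, Real.zero_rpow (by linarith : q - 2 ≠ 0), sub_zero] at this
  exact this.mono_left nhdsWithin_le_nhds

theorem tendsto_rescaledTP {γ : C1Loop} {η : ℝ} {jp jm s ω : ℤ} (hη : 0 < η)
    (h : γ ∈ admissible η jp jm s ω) {q : ℝ} (hq : 2 < q) (hS : γ.InSobolev q) :
    Tendsto (fun δ => γ.rescaledTP q δ) (𝓝[>] 0)
      (𝓝 (ENNReal.ofReal ((2 : ℝ) ^ (q + 1) / (q - 2) * γ.angleSum q))) := by
  have h1 : Tendsto (fun δ : ℝ => ENNReal.ofReal (δ ^ (q - 2)) * γ.TP q η) (𝓝[>] 0) (𝓝 0) := by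
    have hc : ContinuousAt (fun δ : ℝ => δ ^ (q - 2)) 0 :=
      continuousAt_id.rpow_const (Or.inr (by linarith))
    have h0 := hc.tendsto.mono_left (nhdsWithin_le_nhds (s := Ioi 0))
    simp only [Real.zero_rpow (by linarith : q - 2 ≠ 0)] at h0
    have := ENNReal.Tendsto.mul_const (ENNReal.tendsto_ofReal h0)
      (b := γ.TP q η) (Or.inr (TP_lt_top h.2.1 hq hη hS).ne)
    simpa using this
  have h2 := ENNReal.tendsto_ofReal ((tendsto_one_sub_rpow (η := η) hq).mul_const
    ((2 : ℝ) ^ (q + 1) / (q - 2) * γ.angleSum q))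
  have h3 := h1.add h2
  rw [zero_add, one_mul] at h3
  refine h3.congr' ?_
  filter_upwards [Ioc_mem_nhdsGT hη] with δ hδ
  exact (rescaledTP_eq hη h hq hδ.1 hδ.2).symm

theorem renormTP_eq {γ : C1Loop} {η : ℝ} {jp jm s ω : ℤ} (hη : 0 < η)
    (h : γ ∈ admissible η jp jm s ω) {q : ℝ} (hq : 2 < q) (hS : γ.InSobolev q) :
    γ.renormTP q = ENNReal.ofReal ((2 : ℝ) ^ (q + 1) / (q - 2) * γ.angleSum q) :=
  (tendsto_rescaledTP hη h hq hS).limUnder_eq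

/-- The crossings and their angles persist under small `C¹` perturbations, so `angleSum` is
continuous at generic curves. -/
theorem IsGeneric.continuousAt_angleSum {γ : C1Loop} (hγ : γ.IsGeneric) {q : ℝ} (hq : 2 < q) :
    ContinuousAt (angleSum q) γ := by
  rw [ContinuousAt, Metric.tendsto_nhds]
  intro ε hε
  set D := hγ.finite_dblPts.toFinset with hD
  have hmem : ∀ {p}, p ∈ D ↔ p ∈ γ.dblPts := hγ.finite_dblPts.mem_toFinset
  obtain ⟨κ, hκ, hκ'⟩ : ∃ κ > 0, ∀ p ∈ D, ∀ c : ℝ, |c - γ.velCos p| < κ →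
      |crossEnergy q c - crossEnergy q (γ.velCos p)| < ε / (D.card + 1) := by
    have : ∀ p ∈ D, ∀ᶠ κ in 𝓝[>] (0 : ℝ), ∀ c : ℝ, |c - γ.velCos p| < κ →
        |crossEnergy q c - crossEnergy q (γ.velCos p)| < ε / (D.card + 1) := by
      intro p hp
      have hc := continuousAt_crossEnergy hq (abs_velCos_lt_one (hγ.linearIndependent (hmem.1 hp)))
      obtain ⟨κ, hκ, hκ'⟩ := Metric.continuousAt_iff.1 hc (ε / (D.card + 1)) (by positivity)
      filter_upwards [Ioc_mem_nhdsGT hκ] with κ' h' c hc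
      exact hκ' (hc.trans_le h'.2)
    have h2 := (Filter.eventually_all_finset D).2 this
    obtain ⟨κ, hκ, hκ0⟩ := (h2.and self_mem_nhdsWithin).exists
    exact ⟨κ, hκ0, hκ⟩
  filter_upwards [eventually_stable γ hγ hκ] with ζ hζ
  obtain ⟨hζg, f, hf, hfc⟩ := hζ
  have e : ζ.angleSum q = ∑ p ∈ D, crossEnergy q (ζ.velCos (f p)) := by
    rw [angleSum, ← hf.image_eq, finsum_mem_image hf.injOn]
    exact finsum_mem_eq_finite_toFinset_sum _ _
  rw [e, hγ.angleSum_eq_sum, Real.dist_eq, ← Finset.sum_sub_distrib]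
  calc _ ≤ ∑ p ∈ D, |crossEnergy q (ζ.velCos (f p)) - crossEnergy q (γ.velCos p)| :=
        Finset.abs_sum_le_sum_abs _ _
    _ ≤ ∑ p ∈ D, ε / (D.card + 1) :=
        Finset.sum_le_sum fun p hp => (hκ' p hp _ (hfc p (hmem.1 hp))).le
    _ = D.card * (ε / (D.card + 1)) := by rw [Finset.sum_const, nsmul_eq_mul]
    _ < ε := by
        rw [mul_div_assoc', div_lt_iff₀ (by positivity)]
        nlinarith

/-- The `liminf` inequality follows from the closed form of the rescaled energy by dropping the
term which is not determined by the angles, uniformly along the family. -/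
theorem gammaConverges_rescaledTP {X : Set C1Loop} {η : ℝ} {jp jm s ω : ℤ} (hη : 0 < η) {q : ℝ}
    (hq : 2 < q) (hX : ∀ γ ∈ X, γ ∈ admissible η jp jm s ω ∧ γ.InSobolev q) :
    GammaConverges (X := X) (𝓝[>] (0 : ℝ)) (fun δ γ => (γ : C1Loop).rescaledTP q δ)
      (fun γ => (γ : C1Loop).renormTP q) := by
  rintro ⟨γ, hγ⟩
  obtain ⟨ha, hS⟩ := hX γ hγ
  refine ⟨fun ξ hξ => ?_, fun _ => ⟨γ, hγ⟩, tendsto_const_nhds, ?_⟩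
  · have hξ' : Tendsto (fun δ => (ξ δ : C1Loop)) (𝓝[>] (0 : ℝ)) (𝓝 γ) :=
      (continuous_subtype_val.tendsto _).comp hξ
    have hs := (ha.1.1.continuousAt_angleSum hq).tendsto.comp hξ'
    have hlim := ENNReal.tendsto_ofReal ((tendsto_one_sub_rpow (η := η) hq).mul
      (hs.const_mul ((2 : ℝ) ^ (q + 1) / (q - 2))))
    rw [one_mul] at hlim
    simp only [renormTP_eq hη ha hq hS]
    rw [← hlim.liminf_eq]
    refine liminf_le_liminf ?_
    filter_upwards [Ioc_mem_nhdsGT hη] with δ hδ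
    rw [rescaledTP_eq hη (hX _ (ξ δ).2).1 hq hδ.1 hδ.2]
    exact le_add_left le_rfl
  · rw [(tendsto_rescaledTP hη ha hq hS).limsup_eq]
    exact (renormTP_eq hη ha hq hS).ge

end C1Loop

namespace C1Loop

/-! ### Parametrization proportional to arclength -/

/-- The length of the curve. -/
noncomputable def length (γ : C1Loop) : ℝ := ∫ t in (0 : ℝ)..1, ‖γ.vel t‖

/-- The arclength parameter, normalized to total length `1`. -/
noncomputable def arc (γ : C1Loop) (t : ℝ) : ℝ := (∫ x in (0 : ℝ)..t, ‖γ.vel x‖) / γ.length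

theorem length_pos {γ : C1Loop} (h : γ.IsImmersion) : 0 < γ.length :=
  intervalIntegral.intervalIntegral_pos_of_pos (γ.continuous_vel.norm.intervalIntegrable _ _)
    (fun t => norm_pos_iff.2 (h t)) one_pos

theorem hasDerivAt_arc (γ : C1Loop) (t : ℝ) : HasDerivAt γ.arc (‖γ.vel t‖ / γ.length) t :=
  (intervalIntegral.integral_hasDerivAt_right (γ.continuous_vel.norm.intervalIntegrable _ _)
    γ.continuous_vel.norm.stronglyMeasurable.stronglyMeasurableAtFilter
    γ.continuous_vel.norm.continuousAt).div_const _

theorem continuous_arc (γ : C1Loop) : Continuous γ.arc :=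
  continuous_iff_continuousAt.2 fun t => (γ.hasDerivAt_arc t).continuousAt

theorem strictMono_arc {γ : C1Loop} (h : γ.IsImmersion) : StrictMono γ.arc :=
  strictMono_of_hasDerivAt_pos γ.hasDerivAt_arc fun t =>
    div_pos (norm_pos_iff.2 (h t)) (length_pos h)

theorem arc_zero (γ : C1Loop) : γ.arc 0 = 0 := by simp [arc]

theorem arc_sub_arc (γ : C1Loop) (a b : ℝ) :
    γ.arc b - γ.arc a = (∫ x in a..b, ‖γ.vel x‖) / γ.length := by
  rw [arc, arc, ← sub_div, intervalIntegral.integral_interval_sub_left] <;>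
  exact γ.continuous_vel.norm.intervalIntegrable _ _

theorem arc_add_one {γ : C1Loop} (h : γ.IsImmersion) (t : ℝ) : γ.arc (t + 1) = γ.arc t + 1 := by
  rw [← sub_eq_iff_eq_add', arc_sub_arc, div_eq_one_iff_eq (length_pos h).ne', length]
  have hp : Function.Periodic (fun x => ‖γ.vel x‖) 1 := fun x => by simp only [γ.vel_periodic x]
  simpa using hp.intervalIntegral_add_eq t 0

theorem arc_add_int {γ : C1Loop} (h : γ.IsImmersion) (t : ℝ) (k : ℤ) :
    γ.arc (t + k) = γ.arc t + k := by
  have hp : Function.Periodic (fun x => γ.arc x - x) 1 := fun x => by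
    simp only [arc_add_one h]; ring
  have := hp.int_mul k t
  simp only [mul_one] at this
  linarith

theorem arc_int {γ : C1Loop} (h : γ.IsImmersion) (k : ℤ) : γ.arc k = k := by
  simpa [arc_zero] using arc_add_int h 0 k

theorem surjective_arc {γ : C1Loop} (h : γ.IsImmersion) : Function.Surjective γ.arc := by
  intro x
  have hx : x ∈ Icc (γ.arc ⌊x⌋) (γ.arc (⌊x⌋ + 1)) := by
    rw [arc_add_one h, arc_int h]
    exact ⟨Int.floor_le x, (Int.lt_floor_add_one x).le⟩
  obtain ⟨t, -, ht⟩ := intermediate_value_Icc (by linarith) γ.continuous_arc.continuousOn hx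
  exact ⟨t, ht⟩

theorem arc_mem_Ico_iff {γ : C1Loop} (h : γ.IsImmersion) {t : ℝ} :
    γ.arc t ∈ Ico (0 : ℝ) 1 ↔ t ∈ Ico (0 : ℝ) 1 := by
  have h0 := γ.arc_zero
  have h1 : γ.arc 1 = 1 := by simpa using arc_int h 1
  have hm := strictMono_arc h
  rw [mem_Ico, mem_Ico, ← hm.le_iff_le (a := 0) (b := t), ← hm.lt_iff_lt (a := t) (b := 1), h0, h1]

/-- `ξ` is the curve `ζ`, scaled to length `1` and parametrized by arclength. -/
def IsNormalization (ζ ξ : C1Loop) : Prop :=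
  ∀ t, ξ (ζ.arc t) = ζ.length⁻¹ • ζ t ∧ ξ.vel (ζ.arc t) = ‖ζ.vel t‖⁻¹ • ζ.vel t

theorem exists_isNormalization {ζ : C1Loop} (h : ζ.IsImmersion) : ∃ ξ, ζ.IsNormalization ξ := by
  set e := (strictMono_arc h).orderIsoOfSurjective _ (surjective_arc h) with he
  have hL := length_pos h
  set τ : ℝ → ℝ := fun x => e.symm x with hτ
  have hτc : Continuous τ := e.symm.continuous
  have h1 : ∀ x, ζ.arc (τ x) = x := fun x => e.apply_symm_apply x
  have h2 : ∀ t, τ (ζ.arc t) = t := fun t => e.symm_apply_apply t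
  have hd : ∀ x, HasDerivAt τ (‖ζ.vel (τ x)‖ / ζ.length)⁻¹ x := fun x =>
    HasDerivAt.of_local_left_inverse hτc.continuousAt (ζ.hasDerivAt_arc _)
      (div_pos (norm_pos_iff.2 (h _)) hL).ne' (Eventually.of_forall h1)
  have hξ : ∀ x, HasDerivAt (fun x => ζ.length⁻¹ • ζ (τ x)) (‖ζ.vel (τ x)‖⁻¹ • ζ.vel (τ x)) x := by
    intro x
    have := ((ζ.hasDerivAt (τ x)).scomp x (hd x)).const_smul ζ.length⁻¹
    rw [smul_smul, show ζ.length⁻¹ * (‖ζ.vel (τ x)‖ / ζ.length)⁻¹ = ‖ζ.vel (τ x)‖⁻¹ by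
      field_simp] at this
    exact this
  refine ⟨⟨fun x => ζ.length⁻¹ • ζ (τ x), fun x => ?_, ?_⟩, fun t => ⟨?_, ?_⟩⟩
  · have : τ (x + 1) = τ x + 1 := by
      rw [← h2 (τ x + 1), arc_add_one h, h1]
    simp only [this, ζ.periodic (τ x)]
  · refine contDiff_one_iff_deriv.2 ⟨fun x => (hξ x).differentiableAt, ?_⟩
    rw [funext fun x => (hξ x).deriv]
    exact ((ζ.continuous_vel.comp hτc).norm.inv₀ fun x => norm_ne_zero_iff.2 (h _)).smul
      (ζ.continuous_vel.comp hτc)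
  · change ζ.length⁻¹ • ζ (τ (ζ.arc t)) = _
    rw [h2]
  · have := (hξ (ζ.arc t)).deriv
    rw [h2] at this
    exact this

variable {ζ ξ : C1Loop}

theorem IsNormalization.norm_vel (hζ : ζ.IsImmersion) (hξ : ζ.IsNormalization ξ) (x : ℝ) :
    ‖ξ.vel x‖ = 1 := by
  obtain ⟨t, rfl⟩ := surjective_arc hζ x
  rw [(hξ t).2, norm_smul, norm_inv, norm_norm, inv_mul_cancel₀ (norm_ne_zero_iff.2 (hζ t))]

theorem IsNormalization.dblPts_eq (hζ : ζ.IsImmersion) (hξ : ζ.IsNormalization ξ) :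
    ξ.dblPts = Prod.map ζ.arc ζ.arc '' ζ.dblPts := by
  have hL := length_pos hζ
  ext ⟨x, y⟩
  obtain ⟨s, rfl⟩ := surjective_arc hζ x
  obtain ⟨t, rfl⟩ := surjective_arc hζ y
  have hinj : Function.Injective (Prod.map ζ.arc ζ.arc) :=
    (strictMono_arc hζ).injective.prodMap (strictMono_arc hζ).injective
  rw [show (ζ.arc s, ζ.arc t) = Prod.map ζ.arc ζ.arc (s, t) from rfl, hinj.mem_set_image]
  simp only [dblPts, mem_ofPred_eq, Prod.map_apply, arc_mem_Ico_iff hζ,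
    (strictMono_arc hζ).injective.ne_iff, (hξ s).1, (hξ t).1,
    (smul_right_injective ℂ (inv_ne_zero hL.ne')).eq_iff]

theorem IsNormalization.velCos_eq (hζ : ζ.IsImmersion) (hξ : ζ.IsNormalization ξ) (p : ℝ × ℝ) :
    ξ.velCos (Prod.map ζ.arc ζ.arc p) = ζ.velCos p := by
  simp only [velCos, Prod.map_fst, Prod.map_snd, (hξ _).2]
  rw [InnerProductGeometry.angle_smul_left_of_pos _ _ (inv_pos.2 (norm_pos_iff.2 (hζ _))),
    InnerProductGeometry.angle_smul_right_of_pos _ _ (inv_pos.2 (norm_pos_iff.2 (hζ _)))]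

theorem IsNormalization.angleSum_eq (hζ : ζ.IsImmersion) (hξ : ζ.IsNormalization ξ) (q : ℝ) :
    ξ.angleSum q = ζ.angleSum q := by
  have hinj : Function.Injective (Prod.map ζ.arc ζ.arc) :=
    (strictMono_arc hζ).injective.prodMap (strictMono_arc hζ).injective
  rw [angleSum, hξ.dblPts_eq hζ, finsum_mem_image hinj.injOn]
  simp only [hξ.velCos_eq hζ, angleSum]

theorem norm_sub_le_of_unit {γ : C1Loop} (hU : ∀ t, ‖γ.vel t‖ = 1) (x y : ℝ) :
    ‖γ x - γ y‖ ≤ |x - y| := by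
  simpa using (convex_univ (𝕜 := ℝ) (E := ℝ)).norm_image_sub_le_of_norm_hasDerivWithin_le (C := 1)
    (fun t _ => (γ.hasDerivAt t).hasDerivWithinAt) (fun t _ => (hU t).le) (mem_univ y) (mem_univ x)

theorem exists_norm_le (γ : C1Loop) : ∃ M > 0, (∀ t, ‖γ t‖ ≤ M) ∧ ∀ t, ‖γ.vel t‖ ≤ M := by
  obtain ⟨M₁, h₁⟩ := (γ.periodic.isBounded_of_continuous one_ne_zero γ.continuous).exists_norm_le
  obtain ⟨M₂, h₂⟩ :=
    (γ.vel_periodic.isBounded_of_continuous one_ne_zero γ.continuous_vel).exists_norm_le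
  refine ⟨max 1 (max M₁ M₂), lt_max_of_lt_left one_pos, fun t => ?_, fun t => ?_⟩
  · exact (h₁ _ (mem_range_self t)).trans ((le_max_left _ _).trans (le_max_right _ _))
  · exact (h₂ _ (mem_range_self t)).trans ((le_max_right _ _).trans (le_max_right _ _))

/-- If the speed is nearly `1`, then the normalized arclength is nearly the original parameter. -/
theorem abs_arc_sub_le {ζ : C1Loop} (hζ : ζ.IsImmersion) {κ : ℝ} (hκ1 : κ ≤ 1 / 2)
    (h : ∀ t, |‖ζ.vel t‖ - 1| ≤ κ) : |ζ.length - 1| ≤ κ ∧ ∀ t, |ζ.arc t - t| ≤ 4 * κ := by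
  have hc := ζ.continuous_vel.norm
  have hL : |ζ.length - 1| ≤ κ := by
    have : ζ.length - 1 = ∫ t in (0 : ℝ)..1, (‖ζ.vel t‖ - 1) := by
      rw [intervalIntegral.integral_sub (hc.intervalIntegrable _ _) (by simp)]
      simp [length]
    rw [this]
    simpa using intervalIntegral.norm_integral_le_of_norm_le_const (a := 0) (b := 1) (C := κ)
      (f := fun t => ‖ζ.vel t‖ - 1) fun t _ => h t
  refine ⟨hL, fun t => ?_⟩
  have hL0 : 1 / 2 ≤ ζ.length := by linarith [(abs_le.1 hL).1]
  have key : ∀ t ∈ Icc (0 : ℝ) 1, |ζ.arc t - t| ≤ 4 * κ := by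
    intro t ht
    have e : ζ.arc t - t = ∫ x in (0 : ℝ)..t, (‖ζ.vel x‖ / ζ.length - 1) := by
      rw [intervalIntegral.integral_sub ((hc.div_const _).intervalIntegrable _ _) (by simp)]
      simp [arc]
    have hb : ∀ x, ‖‖ζ.vel x‖ / ζ.length - 1‖ ≤ 4 * κ := by
      intro x
      rw [Real.norm_eq_abs, div_sub_one (by linarith), abs_div,
        abs_of_pos (by linarith : 0 < ζ.length), div_le_iff₀ (by linarith)]
      have h1 := abs_le.1 (h x)
      have h2 := abs_le.1 hL
      have h0 : 0 ≤ κ := (abs_nonneg _).trans hL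
      rw [abs_le]
      constructor <;> nlinarith
    rw [e]
    refine (intervalIntegral.norm_integral_le_of_norm_le_const fun x _ => hb x).trans ?_
    have h0 : 0 ≤ κ := (abs_nonneg _).trans hL
    rw [sub_zero, abs_of_nonneg ht.1]
    exact mul_le_of_le_one_right (by positivity) ht.2
  have hf := key (Int.fract t) ⟨Int.fract_nonneg t, (Int.fract_lt_one t).le⟩
  have ha := arc_add_int hζ (Int.fract t) ⌊t⌋
  rw [Int.fract_add_floor] at ha
  rw [ha]
  convert hf using 2
  rw [Int.fract]; ring

/-- Normalization is continuous at arclength parametrized curves. -/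
theorem eventually_normalization_mem {γ : C1Loop} (hU : ∀ t, ‖γ.vel t‖ = 1) {U : Set C1Loop}
    (hUγ : U ∈ 𝓝 γ) : ∀ᶠ ζ in 𝓝 γ, ∀ ξ, ζ.IsNormalization ξ → ξ ∈ U := by
  have hI : γ.IsImmersion := fun t ht => by
    have := hU t
    simp [ht] at this
  obtain ⟨ε, hε, hεU⟩ := γ.hasBasis_nhds.mem_iff.1 hUγ
  obtain ⟨r, hr, -, hvel⟩ := γ.exists_uniform_vel (ε := ε / 4) (by positivity)
  obtain ⟨M, hM, hγM, -⟩ := γ.exists_norm_le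
  obtain ⟨κ, hκ0, hκ⟩ : ∃ κ > 0, κ ≤ 1 / 2 ∧ 4 * κ < r ∧ κ * (2 * M + 6) < ε ∧ κ ≤ ε / 4 := by
    have hc : Tendsto (fun κ : ℝ => κ) (𝓝[>] 0) (𝓝 0) := nhdsWithin_le_nhds
    have h1 := hc.eventually (eventually_le_nhds (show (0 : ℝ) < 1 / 2 by norm_num))
    have h2 := hc.eventually (eventually_lt_nhds (show (0 : ℝ) < r / 4 by positivity))
    have h3 := hc.eventually (eventually_lt_nhds (show (0 : ℝ) < ε / (2 * M + 6) by positivity))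
    have h4 := hc.eventually (eventually_le_nhds (show (0 : ℝ) < ε / 4 by positivity))
    obtain ⟨κ, ⟨⟨⟨⟨h1, h2⟩, h3⟩, h4⟩, h5⟩⟩ :=
      ((((h1.and h2).and h3).and h4).and self_mem_nhdsWithin).exists
    exact ⟨κ, h5, h1, by linarith, (lt_div_iff₀ (by positivity)).1 h3, h4⟩
  obtain ⟨hκ1, hκ2, hκ3, hκ4⟩ := hκ
  filter_upwards [γ.eventually_near hκ0, γ.eventually_isImmersion hI] with ζ hζ hζI ξ hξ
  have hsp : ∀ t, |‖ζ.vel t‖ - 1| ≤ κ := fun t => by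
    rw [← hU t]
    exact (abs_norm_sub_norm_le _ _).trans (hζ.2 t).le
  obtain ⟨hL, harc⟩ := abs_arc_sub_le hζI hκ1 hsp
  have hL1 := abs_le.1 hL
  have hL0 : 0 < ζ.length := length_pos hζI
  refine hεU ⟨fun x => ?_, fun x => ?_⟩
  · obtain ⟨t, rfl⟩ := surjective_arc hζI x
    rw [(hξ t).1]
    have e : ζ.length⁻¹ • ζ t - γ (ζ.arc t) =
        (ζ.length⁻¹ - 1) • (ζ t - γ t) + (ζ.length⁻¹ - 1) • γ t + (ζ t - γ t) +
          (γ t - γ (ζ.arc t)) := by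
      simp only [sub_smul, smul_sub, one_smul]; abel
    have h1 : |ζ.length⁻¹ - 1| ≤ 2 * κ := by
      rw [inv_eq_one_div, div_sub_one hL0.ne', abs_div, abs_sub_comm,
        abs_of_pos hL0, div_le_iff₀ hL0]
      nlinarith
    have h2 := (hζ.1 t).le
    have h3 := hγM t
    have h4 : ‖γ t - γ (ζ.arc t)‖ ≤ 4 * κ := by
      refine (norm_sub_le_of_unit hU _ _).trans ?_
      rw [abs_sub_comm]
      exact harc t
    rw [e]
    refine ((norm_add_le _ _).trans (add_le_add ((norm_add_le _ _).trans (add_le_add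
      ((norm_add_le _ _).trans (add_le_add ?_ ?_)) h2)) h4)).trans_lt
        (b := 2 * κ * (1 / 2) + 2 * κ * M + κ + 4 * κ) (by linarith)
    · rw [norm_smul, Real.norm_eq_abs]
      gcongr
      exact h2.trans hκ1
    · rw [norm_smul, Real.norm_eq_abs]
      gcongr
  · obtain ⟨t, rfl⟩ := surjective_arc hζI x
    rw [(hξ t).2]
    have hn : 0 < ‖ζ.vel t‖ := norm_pos_iff.2 (hζI t)
    have h1 : ‖‖ζ.vel t‖⁻¹ • ζ.vel t - ζ.vel t‖ ≤ κ := by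
      rw [show ‖ζ.vel t‖⁻¹ • ζ.vel t - ζ.vel t = (‖ζ.vel t‖⁻¹ - 1) • ζ.vel t by
        rw [sub_smul, one_smul], norm_smul, Real.norm_eq_abs]
      nth_rewrite 2 [← abs_of_pos hn]
      rw [← abs_mul, sub_mul, inv_mul_cancel₀ hn.ne', one_mul, abs_sub_comm]
      exact hsp t
    have h2 := (hζ.2 t).le
    have h3 : ‖γ.vel (ζ.arc t) - γ.vel t‖ ≤ ε / 4 := by
      have := hvel t (ζ.arc t - t) ((harc t).trans_lt hκ2)
      rwa [add_sub_cancel] at this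
    rw [show ‖ζ.vel t‖⁻¹ • ζ.vel t - γ.vel (ζ.arc t) = (‖ζ.vel t‖⁻¹ • ζ.vel t - ζ.vel t) +
      (ζ.vel t - γ.vel t) - (γ.vel (ζ.arc t) - γ.vel t) by abel]
    refine ((norm_sub_le _ _).trans (add_le_add ((norm_add_le _ _).trans (add_le_add h1 h2))
      h3)).trans_lt (by linarith)

end C1Loop

namespace C1Loop

variable {γ ζ ξ : C1Loop}

theorem abs_arc_sub_bounds {a b : ℝ} (ha : ∀ t, a ≤ ‖ζ.vel t‖ / ζ.length)
    (hb : ∀ t, ‖ζ.vel t‖ / ζ.length ≤ b) (ha0 : 0 ≤ a) (x y : ℝ) :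
    a * |y - x| ≤ |ζ.arc y - ζ.arc x| ∧ |ζ.arc y - ζ.arc x| ≤ b * |y - x| := by
  have hd : Differentiable ℝ ζ.arc := fun t => (ζ.hasDerivAt_arc t).differentiableAt
  have hd' : ∀ t, deriv ζ.arc t = ‖ζ.vel t‖ / ζ.length := fun t => (ζ.hasDerivAt_arc t).deriv
  wlog hxy : x ≤ y generalizing x y
  · rw [abs_sub_comm, abs_sub_comm (ζ.arc y)]
    exact this y x (le_of_not_ge hxy)
  have h1 : a * (y - x) ≤ ζ.arc y - ζ.arc x :=
    mul_sub_le_image_sub_of_le_deriv hd (fun t => by rw [hd']; exact ha t) hxy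
  have h2 : ζ.arc y - ζ.arc x ≤ b * (y - x) :=
    image_sub_le_mul_sub_of_deriv_le hd (fun t => by rw [hd']; exact hb t) hxy
  have h0 : 0 ≤ a * (y - x) := mul_nonneg ha0 (sub_nonneg.2 hxy)
  rw [abs_of_nonneg (sub_nonneg.2 hxy), abs_of_nonneg (h0.trans h1)]
  exact ⟨h1, h2⟩

theorem arc_image_Ico (hζ : ζ.IsImmersion) : ζ.arc '' Ico 0 1 = Ico 0 1 := by
  ext x
  obtain ⟨t, rfl⟩ := surjective_arc hζ x
  rw [(strictMono_arc hζ).injective.mem_set_image, arc_mem_Ico_iff hζ]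

theorem _root_.Real.add_one_rpow_le {x q : ℝ} (hx : 0 ≤ x) (hq : 0 ≤ q) :
    (x + 1) ^ q ≤ 2 ^ q * (x ^ q + 1) := by
  have hxq : 0 ≤ x ^ q := Real.rpow_nonneg hx q
  have h2 : (0 : ℝ) ≤ 2 ^ q := by positivity
  rcases le_total x 1 with h | h
  · calc (x + 1) ^ q ≤ 2 ^ q := Real.rpow_le_rpow (by linarith) (by linarith) hq
      _ ≤ _ := le_mul_of_one_le_right h2 (by linarith)
  · calc (x + 1) ^ q ≤ (2 * x) ^ q := Real.rpow_le_rpow (by linarith) (by linarith) hq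
      _ = 2 ^ q * x ^ q := Real.mul_rpow (by norm_num) hx
      _ ≤ _ := by gcongr; linarith

/-- The Sobolev class is preserved if the curve is reparametrized by a bilipschitz change of
parameter and its velocity changes in a Lipschitz way. -/
theorem InSobolev.of_comp_arc {q : ℝ} (hq : 2 < q) (hS : γ.InSobolev q) (hζ : ζ.IsImmersion)
    (hlo : ∀ t, 1 / 2 ≤ ‖ζ.vel t‖ / ζ.length) (hhi : ∀ t, ‖ζ.vel t‖ / ζ.length ≤ 2)
    (hξ : ∀ t, ‖ξ.vel t‖ = 1) {K r : ℝ} (hr : 0 < r) (hr2 : r ≤ 1 / 2) (hK : 0 ≤ K)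
    (h : ∀ t w, |w| < r → ‖ξ.vel (ζ.arc (t + w)) - ξ.vel (ζ.arc t)‖ ≤
      K * (‖γ.vel (t + w) - γ.vel t‖ + |w|)) : ξ.InSobolev q := by
  have hq0 : 0 ≤ q := by linarith
  set A : ℝ → ℝ≥0∞ := fun x => ∫⁻ w in Icc (-(1 / 2) : ℝ) (1 / 2),
    ENNReal.ofReal (‖ξ.vel (x + w) - ξ.vel x‖ ^ q / |w| ^ q) with hA
  set B : ℝ → ℝ≥0∞ := fun t => ∫⁻ w in Icc (-(1 / 2) : ℝ) (1 / 2),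
    ENNReal.ofReal (‖γ.vel (t + w) - γ.vel t‖ ^ q / |w| ^ q) with hB
  set c₁ := ENNReal.ofReal (2 * (4 * K) ^ q) with hc₁
  set c₂ := ENNReal.ofReal ((2 / (r / 4)) ^ q) with hc₂
  have hvol : volume (Icc (-(1 / 2) : ℝ) (1 / 2)) = 1 := by
    rw [Real.volume_Icc]; norm_num
  have hbd := fun x y => abs_arc_sub_bounds hlo hhi (by norm_num) x y
  have hinj := (strictMono_arc hζ).injective
  have hpt : ∀ t, A (ζ.arc t) ≤ c₁ * (B t + 1) + c₂ := by
    intro t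
    have hsub : Icc (-(1 / 2) : ℝ) (1 / 2) ⊆ ((fun w => ζ.arc (t + w) - ζ.arc t) '' Ioo (-r) r) ∪
        {w ∈ Icc (-(1 / 2) : ℝ) (1 / 2) | r / 4 ≤ |w|} := by
      intro w hw
      rcases lt_or_ge |w| (r / 4) with h1 | h1
      · left
        obtain ⟨t', ht'⟩ := surjective_arc hζ (ζ.arc t + w)
        have h2 := (hbd t t').1
        rw [ht', add_sub_cancel_left] at h2
        refine ⟨t' - t, abs_lt.1 (by linarith), ?_⟩
        simp only [add_sub_cancel, ht', add_sub_cancel_left]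
      · exact Or.inr ⟨hw, h1⟩
    refine (lintegral_mono_set hsub).trans ((lintegral_union_le _ _ _).trans (add_le_add ?_ ?_))
    · have hd : ∀ w ∈ Ioo (-r) r, HasDerivWithinAt (fun w => ζ.arc (t + w) - ζ.arc t)
          (‖ζ.vel (t + w)‖ / ζ.length) (Ioo (-r) r) w := fun w _ =>
        (((ζ.hasDerivAt_arc (t + w)).comp_const_add t w).sub_const _).hasDerivWithinAt
      rw [lintegral_image_eq_lintegral_abs_deriv_mul measurableSet_Ioo hd
        (fun x _ y _ hxy => add_left_cancel (hinj (sub_left_injective hxy)))]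
      calc _ ≤ ∫⁻ w in Ioo (-r) r, c₁ *
            (ENNReal.ofReal (‖γ.vel (t + w) - γ.vel t‖ ^ q / |w| ^ q) + 1) := by
            refine setLIntegral_mono' measurableSet_Ioo fun w hw => ?_
            rw [← ENNReal.ofReal_one, ← ENNReal.ofReal_add (by positivity) zero_le_one, hc₁,
              ← ENNReal.ofReal_mul (abs_nonneg _), ← ENNReal.ofReal_mul (by positivity)]
            refine ENNReal.ofReal_le_ofReal ?_
            rw [add_sub_cancel]
            rcases eq_or_ne w 0 with rfl | hw0
            · have : (0 : ℝ) ^ q = 0 := Real.zero_rpow (by linarith)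
              simp only [add_zero, sub_self, norm_zero, abs_zero, this, div_zero, mul_zero,
                zero_add]
              positivity
            have hwp : 0 < |w| := abs_pos.2 hw0
            have hlow := (hbd t (t + w)).1
            rw [add_sub_cancel_left] at hlow
            have h1 := h t w (abs_lt.2 hw)
            set a := ‖γ.vel (t + w) - γ.vel t‖ with ha
            have ha0 : 0 ≤ a := norm_nonneg _
            calc |‖ζ.vel (t + w)‖ / ζ.length| * (‖ξ.vel (ζ.arc (t + w)) - ξ.vel (ζ.arc t)‖ ^ q /
                  |ζ.arc (t + w) - ζ.arc t| ^ q)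
                ≤ 2 * ((K * (a + |w|)) ^ q / (1 / 2 * |w|) ^ q) := by
                  gcongr
                  rw [abs_of_nonneg (by linarith [hlo (t + w)])]
                  exact hhi _
              _ = 2 * (2 * K) ^ q * (a / |w| + 1) ^ q := by
                  rw [← Real.div_rpow (by positivity) (by positivity), mul_assoc,
                    ← Real.mul_rpow (by positivity) (by positivity)]
                  congr 2
                  field_simp
              _ ≤ 2 * (2 * K) ^ q * (2 ^ q * ((a / |w|) ^ q + 1)) := by
                  gcongr
                  exact Real.add_one_rpow_le (by positivity) hq0
              _ = 2 * (4 * K) ^ q * (a ^ q / |w| ^ q + 1) := by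
                  rw [Real.div_rpow ha0 hwp.le, show 4 * K = 2 * (2 * K) by ring,
                    Real.mul_rpow (x := 2) (y := 2 * K) (by norm_num) (by positivity)]
                  ring
        _ ≤ ∫⁻ w in Icc (-(1 / 2) : ℝ) (1 / 2), c₁ *
            (ENNReal.ofReal (‖γ.vel (t + w) - γ.vel t‖ ^ q / |w| ^ q) + 1) :=
            lintegral_mono_set fun w hw => ⟨by linarith [hw.1], by linarith [hw.2]⟩
        _ = c₁ * (B t + 1) := by
            rw [lintegral_const_mul' _ _ ENNReal.ofReal_ne_top,
              lintegral_add_right _ measurable_const, setLIntegral_const, hvol, mul_one]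
    · calc _ ≤ ∫⁻ w in {w ∈ Icc (-(1 / 2) : ℝ) (1 / 2) | r / 4 ≤ |w|}, c₂ := by
            refine setLIntegral_mono measurable_const fun w hw => ENNReal.ofReal_le_ofReal ?_
            have hw' : r / 4 ≤ |w| := hw.2
            have h2 : ‖ξ.vel (ζ.arc t + w) - ξ.vel (ζ.arc t)‖ ≤ 2 := by
              refine (norm_sub_le _ _).trans ?_
              rw [hξ, hξ]; norm_num
            rw [← Real.div_rpow (norm_nonneg _) (abs_nonneg _)]
            gcongr
        _ ≤ ∫⁻ w in Icc (-(1 / 2) : ℝ) (1 / 2), c₂ := lintegral_mono_set fun w hw => hw.1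
        _ = c₂ := by rw [setLIntegral_const, hvol, mul_one]
  have hout : ∫⁻ x in Ico (0 : ℝ) 1, A x ≤
      ∫⁻ t in Ico (0 : ℝ) 1, ENNReal.ofReal 2 * (c₁ * (B t + 1) + c₂) := by
    rw [← arc_image_Ico hζ, lintegral_image_eq_lintegral_abs_deriv_mul measurableSet_Ico
      (fun t _ => (ζ.hasDerivAt_arc t).hasDerivWithinAt) hinj.injOn, arc_image_Ico hζ]
    refine lintegral_mono fun t => mul_le_mul' (ENNReal.ofReal_le_ofReal ?_) (hpt t)
    rw [abs_of_nonneg (by linarith [hlo t])]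
    exact hhi t
  have hvol' : volume (Ico (0 : ℝ) 1) = 1 := by simp
  refine hout.trans_lt ?_
  rw [lintegral_const_mul' _ _ ENNReal.ofReal_ne_top, lintegral_add_right _ measurable_const,
    lintegral_const_mul' _ _ ENNReal.ofReal_ne_top, lintegral_add_right _ measurable_const,
    setLIntegral_const, setLIntegral_const, hvol', mul_one, mul_one]
  exact ENNReal.mul_lt_top ENNReal.ofReal_lt_top (ENNReal.add_lt_top.2
    ⟨ENNReal.mul_lt_top ENNReal.ofReal_lt_top (ENNReal.add_lt_top.2 ⟨hS, ENNReal.one_lt_top⟩),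
      ENNReal.ofReal_lt_top⟩)

theorem _root_.norm_inv_norm_smul_sub_le {a b : ℂ} (ha : a ≠ 0) (hb : b ≠ 0) :
    ‖‖a‖⁻¹ • a - ‖b‖⁻¹ • b‖ ≤ 2 * ‖a‖⁻¹ * ‖a - b‖ := by
  have ha' := norm_pos_iff.2 ha
  have hb' := norm_pos_iff.2 hb
  have e : ‖a‖⁻¹ • a - ‖b‖⁻¹ • b = ‖a‖⁻¹ • (a - b) + (‖a‖⁻¹ - ‖b‖⁻¹) • b := by
    simp only [smul_sub, sub_smul]; abel
  have h1 : |‖a‖⁻¹ - ‖b‖⁻¹| * ‖b‖ = ‖a‖⁻¹ * |‖a‖ - ‖b‖| := by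
    rw [inv_sub_inv ha'.ne' hb'.ne', abs_div, abs_mul, abs_of_pos ha', abs_of_pos hb', abs_sub_comm]
    field_simp
  rw [e]
  refine (norm_add_le _ _).trans ?_
  rw [norm_smul, norm_smul, Real.norm_eq_abs, Real.norm_eq_abs, h1, abs_of_pos (inv_pos.2 ha')]
  have h2 := mul_le_mul_of_nonneg_left (abs_norm_sub_norm_le a b) (inv_pos.2 ha').le
  linarith

theorem IsNormalization.inSobolev {q : ℝ} (hq : 2 < q) (hS : γ.InSobolev q) (hζ : ζ.IsImmersion)
    (hξ : ζ.IsNormalization ξ) (hsp : ∀ t, |‖ζ.vel t‖ - 1| ≤ 1 / 4) {K r : ℝ} (hr : 0 < r)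
    (hr2 : r ≤ 1 / 2) (hK : 0 ≤ K) (h : ∀ t w, |w| < r → ‖ζ.vel (t + w) - ζ.vel t‖ ≤
      K * (‖γ.vel (t + w) - γ.vel t‖ + |w|)) : ξ.InSobolev q := by
  have hL := abs_le.1 (abs_arc_sub_le hζ (by norm_num) hsp).1
  have hL0 := length_pos hζ
  refine InSobolev.of_comp_arc hq hS hζ (fun t => ?_) (fun t => ?_) (hξ.norm_vel hζ) hr hr2
    (K := 4 * K) (by positivity) fun t w hw => ?_
  · have := abs_le.1 (hsp t)
    rw [le_div_iff₀ hL0]; linarith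
  · have := abs_le.1 (hsp t)
    rw [div_le_iff₀ hL0]; linarith
  · rw [(hξ _).2, (hξ _).2]
    refine (norm_inv_norm_smul_sub_le (hζ _) (hζ _)).trans ?_
    have h1 : ‖ζ.vel (t + w)‖⁻¹ ≤ 2 := by
      have := abs_le.1 (hsp (t + w))
      rw [inv_le_comm₀ (norm_pos_iff.2 (hζ _)) two_pos]
      linarith
    calc _ ≤ 2 * 2 * (K * (‖γ.vel (t + w) - γ.vel t‖ + |w|)) := by
          gcongr
          exact h t w hw
      _ = _ := by ring

theorem mem_selfIntParams_iff {u : ℝ} : u ∈ γ.selfIntParams ↔ ∃ p ∈ γ.dblPts, p.1 = u := by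
  constructor
  · rintro ⟨p, hp, rfl | rfl⟩
    · exact ⟨p, γ.selfInt_subset_dblPts hp, rfl⟩
    · exact ⟨p.swap, by rw [γ.dblPts_eq]; exact Or.inr (mem_image_of_mem _ hp), rfl⟩
  · rintro ⟨p, hp, rfl⟩
    exact fst_mem_selfIntParams hp

theorem IsNormalization.exists_of_mem_selfIntParams (hζ : ζ.IsImmersion)
    (hξ : ζ.IsNormalization ξ) {x : ℝ} (hx : x ∈ ξ.selfIntParams) :
    ∃ u ∈ ζ.selfIntParams, ζ.arc u = x := by
  obtain ⟨p, hp, rfl⟩ := mem_selfIntParams_iff.1 hx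
  rw [hξ.dblPts_eq hζ] at hp
  obtain ⟨p', hp', rfl⟩ := hp
  exact ⟨p'.1, mem_selfIntParams_iff.2 ⟨p', hp', rfl⟩, rfl⟩

theorem le_lam_of_unit (hU : ∀ t, ‖γ.vel t‖ = 1) {η : ℝ}
    (h : ∀ a ∈ γ.selfIntParams, ∀ b ∈ γ.selfIntParams, a ≠ b → ∀ k : ℤ, 2 * η ≤ |a - b - k|) :
    ENNReal.ofReal (2 * η) ≤ γ.Lam := by
  refine le_iInf₂ fun a ha => le_iInf₂ fun b hb => le_iInf fun hab => ENNReal.ofReal_le_ofReal ?_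
  refine le_ciInf fun k => ?_
  simp only [hU, intervalIntegral.integral_const, smul_eq_mul, mul_one]
  rw [abs_sub_comm, ← sub_sub]
  exact h a ha b hb hab k

theorem arc_sub_arc_of_const {u ρ : ℝ} (h : ∀ t, |t - u| ≤ ρ → ζ.vel t = ζ.vel u) {t : ℝ}
    (ht : |t - u| ≤ ρ) : ζ.arc t - ζ.arc u = (t - u) * (‖ζ.vel u‖ / ζ.length) := by
  rw [arc_sub_arc, intervalIntegral.integral_congr (g := fun _ => ‖ζ.vel u‖),
    intervalIntegral.integral_const, smul_eq_mul, mul_div_assoc]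
  intro x hx
  simp only
  rw [h x ((abs_sub_left_of_mem_uIcc hx).trans ht)]

theorem vel_eq_of_abs_sub_le {u ρ : ℝ} (hρ : 0 < ρ) (h : ∀ t, |t - u| < ρ → ζ.vel t = ζ.vel u)
    {t : ℝ} (ht : |t - u| ≤ ρ) : ζ.vel t = ζ.vel u := by
  have hcl : IsClosed {t | ζ.vel t = ζ.vel u} := isClosed_eq ζ.continuous_vel continuous_const
  have hsub : Metric.ball u ρ ⊆ {t | ζ.vel t = ζ.vel u} := fun t ht => h t ht
  have := hcl.closure_subset_iff.2 hsub
  rw [closure_ball u hρ.ne'] at this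
  exact this ht

/-- Normalization of a curve that is straight near its crossings and not slower than `1` there. -/
theorem IsNormalization.straight (hζ : ζ.IsImmersion) (hξ : ζ.IsNormalization ξ) {ρ η : ℝ}
    (hρ : 0 < ρ) (hη : η * ζ.length ≤ ρ)
    (hsep : ∀ a ∈ ζ.selfIntParams, ∀ b ∈ ζ.selfIntParams, a ≠ b → ∀ k : ℤ, 2 * ρ ≤ |a - b - k|)
    (hvel : ∀ u ∈ ζ.selfIntParams, 1 ≤ ‖ζ.vel u‖ ∧ ∀ t, |t - u| < ρ → ζ.vel t = ζ.vel u) :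
    ENNReal.ofReal (2 * η) ≤ ξ.Lam ∧
      ∀ u ∈ ξ.selfIntParams, ∃ p v : ℂ, ∀ t ∈ Ioo (u - η) (u + η), ξ t = p + (t - u) • v := by
  have hL := length_pos hζ
  have hη' : η ≤ ρ / ζ.length := (le_div_iff₀ hL).2 hη
  have hmono := (strictMono_arc hζ).monotone
  have hcl : ∀ u ∈ ζ.selfIntParams, ∀ t, |t - u| ≤ ρ → ζ.vel t = ζ.vel u := fun u hu t ht =>
    vel_eq_of_abs_sub_le hρ (hvel u hu).2 ht
  constructor
  · refine le_lam_of_unit (hξ.norm_vel hζ) fun a ha b hb hab k => ?_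
    obtain ⟨a, ha', rfl⟩ := hξ.exists_of_mem_selfIntParams hζ ha
    obtain ⟨b, hb', rfl⟩ := hξ.exists_of_mem_selfIntParams hζ hb
    have hs := hsep a ha' b hb' (fun h => hab (by rw [h])) k
    -- every arc of length `ρ` that starts at a crossing has normalized length at least `η`
    have hr : ∀ u ∈ ζ.selfIntParams, η ≤ ζ.arc (u + ρ) - ζ.arc u := by
      intro u hu
      rw [arc_sub_arc_of_const (hcl u hu) (by simp [abs_of_pos hρ]), add_sub_cancel_left]
      refine hη'.trans ?_
      rw [div_eq_mul_inv, div_eq_mul_inv, ← mul_assoc]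
      have := (hvel u hu).1
      gcongr
      exact le_mul_of_one_le_right hρ.le this
    have hl : ∀ u ∈ ζ.selfIntParams, η ≤ ζ.arc u - ζ.arc (u - ρ) := by
      intro u hu
      rw [← neg_sub (ζ.arc (u - ρ)),
        arc_sub_arc_of_const (hcl u hu) (by simp [abs_of_pos hρ]), ← neg_mul]
      refine hη'.trans ?_
      rw [div_eq_mul_inv, div_eq_mul_inv, ← mul_assoc]
      have := (hvel u hu).1
      gcongr
      nlinarith
    rw [sub_sub, ← arc_add_int hζ]
    rcases le_total (b + k) a with h | h
    · rw [sub_sub, abs_of_nonneg (by linarith)] at hs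
      refine le_trans ?_ (le_abs_self _)
      have h1 : ζ.arc (b + ρ + k) ≤ ζ.arc (a - ρ) := hmono (by linarith)
      rw [arc_add_int hζ] at h1 ⊢
      linarith [hr b hb', hl a ha']
    · rw [sub_sub, abs_of_nonpos (by linarith)] at hs
      refine le_trans ?_ (neg_le_abs _)
      have h1 : ζ.arc (a + ρ) ≤ ζ.arc (b - ρ + k) := hmono (by linarith)
      rw [arc_add_int hζ] at h1 ⊢
      linarith [hr a ha', hl b hb']
  · intro x hx
    obtain ⟨u, hu, rfl⟩ := hξ.exists_of_mem_selfIntParams hζ hx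
    have hcu := hcl u hu
    have h1 := (hvel u hu).1
    refine ⟨ξ (ζ.arc u), ξ.vel (ζ.arc u), fun x hx => ?_⟩
    have hx' : |x - ζ.arc u| < η := abs_lt.2 ⟨by linarith [hx.1], by linarith [hx.2]⟩
    have hη0 : 0 ≤ η := (abs_nonneg _).trans hx'.le
    set σ := ‖ζ.vel u‖ with hσ
    have hσ0 : 0 < σ := by linarith
    set t := u + (x - ζ.arc u) * (ζ.length / σ) with ht
    have htu : |t - u| ≤ ρ := by
      rw [ht, add_sub_cancel_left, abs_mul, abs_of_pos (div_pos hL hσ0)]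
      calc _ ≤ η * (ζ.length / 1) := by gcongr
        _ ≤ ρ := by rwa [div_one]
    have hx2 : ζ.arc t = x := by
      have := arc_sub_arc_of_const hcu htu
      rw [ht, add_sub_cancel_left, ← hσ, mul_assoc, div_mul_div_cancel₀ hσ0.ne',
        div_self hL.ne', mul_one] at this
      linarith
    have hζt : ζ t - ζ u = (t - u) • ζ.vel u := by
      have := intervalIntegral.integral_eq_sub_of_hasDerivAt (a := u) (b := t)
        (fun s _ => ζ.hasDerivAt s) (ζ.continuous_vel.intervalIntegrable _ _)
      rw [← this, intervalIntegral.integral_congr (g := fun _ => ζ.vel u),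
        intervalIntegral.integral_const]
      intro s hs
      exact hcu s ((abs_sub_left_of_mem_uIcc hs).trans htu)
    rw [← hx2, (hξ t).1, (hξ u).1, (hξ u).2, sub_eq_iff_eq_add'.1 hζt, smul_add, smul_smul,
      smul_smul, arc_sub_arc_of_const hcu htu, ← hσ]
    congr 2
    field_simp

end C1Loop

namespace C1Loop

/-! ### Perturbations of a curve -/

/-- The perturbed curve `γ + ε φ`. -/
noncomputable def perturb (γ φ : C1Loop) (ε : ℝ) : C1Loop where
  toFun t := γ t + ε • φ t
  periodic t := by simp only [γ.periodic t, φ.periodic t]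
  contDiff := γ.contDiff.add (φ.contDiff.const_smul ε)

theorem perturb_apply (γ φ : C1Loop) (ε t : ℝ) : γ.perturb φ ε t = γ t + ε • φ t := rfl

theorem vel_perturb (γ φ : C1Loop) (ε t : ℝ) :
    (γ.perturb φ ε).vel t = γ.vel t + ε • φ.vel t :=
  ((γ.hasDerivAt t).add ((φ.hasDerivAt t).const_smul ε)).deriv

theorem tendsto_perturb (γ φ : C1Loop) : Tendsto (γ.perturb φ) (𝓝 0) (𝓝 γ) := by
  obtain ⟨M, hM, h1, h2⟩ := φ.exists_norm_le
  rw [γ.hasBasis_nhds.tendsto_right_iff]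
  intro δ hδ
  filter_upwards [Metric.ball_mem_nhds (0 : ℝ) (div_pos hδ hM)] with ε hε
  rw [mem_ball_zero_iff, lt_div_iff₀ hM] at hε
  refine ⟨fun t => ?_, fun t => ?_⟩
  · rw [perturb_apply, add_sub_cancel_left, norm_smul]
    exact (mul_le_mul_of_nonneg_left (h1 t) (norm_nonneg _)).trans_lt hε
  · rw [vel_perturb, add_sub_cancel_left, norm_smul]
    exact (mul_le_mul_of_nonneg_left (h2 t) (norm_nonneg _)).trans_lt hε

/-- A perturbation that fixes the crossings and rotates the straight strands through them yields,
after normalization, admissible curves of the same compartment with the same crossings. -/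
theorem eventually_exists_competitor {γ φ : C1Loop} {ρ₀ ρ : ℝ} {jp jm s ω : ℤ} (hρ : 0 < ρ)
    (hρ₀ : ρ ≤ ρ₀) (hγ : γ ∈ admissible ρ₀ jp jm s ω) {q : ℝ} (hq : 2 < q) (hS : γ.InSobolev q)
    {K r : ℝ} (hr : 0 < r) (hr2 : r ≤ 1 / 2) (hK : 0 ≤ K)
    (hφ : ∀ t w, |w| < r → ‖φ.vel (t + w) - φ.vel t‖ ≤ K * (‖γ.vel (t + w) - γ.vel t‖ + |w|))
    (hcr : ∀ u ∈ γ.selfIntParams, φ u = 0 ∧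
      ∃ c : ℝ, ∀ t, |t - u| < ρ → φ.vel t = c • (Complex.I * γ.vel u)) :
    ∀ᶠ ε in 𝓝 (0 : ℝ), (γ.perturb φ ε).IsImmersion ∧ (γ.perturb φ ε).dblPts = γ.dblPts ∧
      ∀ η, η * (γ.perturb φ ε).length ≤ ρ → ∃ ξ ∈ admissible η jp jm s ω,
        JoinedIn (genericWith jp jm s ω) γ ξ ∧ ξ.InSobolev q ∧
        ξ.angleSum q = (γ.perturb φ ε).angleSum q := by
  have hU := hγ.2.1
  have ht := γ.tendsto_perturb φ
  have e1 := ht.eventually (eventually_stable γ hγ.1.1 one_pos)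
  have e2 := ht.eventually (eventually_normalization_mem hU (eventually_joinedIn_genericWith hγ.1))
  have e3 := ht.eventually (γ.eventually_near (ε := 1 / 4) (by norm_num))
  filter_upwards [e1, e2, e3, Metric.ball_mem_nhds (0 : ℝ) one_pos] with ε h1 h2 h3 h4
  set ζ := γ.perturb φ ε with hζ
  obtain ⟨hgen, f, hf, -⟩ := h1
  have hsub : γ.dblPts ⊆ ζ.dblPts := by
    intro p hp
    refine ⟨hp.1, hp.2.1, hp.2.2.1, ?_⟩
    rw [hζ, perturb_apply, perturb_apply, (hcr _ (fst_mem_selfIntParams hp)).1,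
      (hcr _ (snd_mem_selfIntParams hp)).1, hp.2.2.2]
  have hD : ζ.dblPts = γ.dblPts := by
    refine (eq_of_subset_of_ncard_le hsub ?_ hgen.finite_dblPts).symm
    rw [← hf.image_eq, hf.injOn.ncard_image]
  have hT : ∀ {u}, u ∈ ζ.selfIntParams → u ∈ γ.selfIntParams := fun hu => by
    rw [mem_selfIntParams_iff, hD] at hu
    exact mem_selfIntParams_iff.2 hu
  have hI := hgen.1
  refine ⟨hI, hD, fun η hη => ?_⟩
  obtain ⟨ξ, hξ⟩ := exists_isNormalization hI
  have hJ := h2 ξ hξ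
  have hstr := hξ.straight hI hρ hη
    (fun a ha b hb hab k => (by
      linarith [admissible_sep (hρ.trans_le hρ₀) hγ (hT ha) (hT hb) hab k]))
    (fun u hu => by
      obtain ⟨c, hc⟩ := (hcr u (hT hu)).2
      have hcu := hc u (by simpa using hρ)
      constructor
      · rw [hζ, vel_perturb, hcu, smul_smul, Complex.real_smul, ← mul_assoc,
          ← one_add_mul, norm_mul, hU, mul_one]
        refine le_trans (le_of_eq ?_) (Complex.abs_re_le_norm _)
        simp
      · intro t ht
        rw [hζ, vel_perturb, vel_perturb, hc t ht, hcu,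
          (admissible_affine (hρ.trans_le hρ₀) hγ (hT hu) (ht.trans_le hρ₀)).2])
  refine ⟨ξ, ⟨hJ.mem.2, hξ.norm_vel hI, hstr⟩, hJ, ?_, hξ.angleSum_eq hI q⟩
  have h4' : |ε| ≤ 1 := by
    rw [mem_ball_zero_iff] at h4
    exact h4.le
  refine hξ.inSobolev hq hS hI (fun t => ?_) hr hr2 (K := K + 1) (by positivity) fun t w hw => ?_
  · have := (abs_norm_sub_norm_le (ζ.vel t) (γ.vel t)).trans (h3.2 t).le
    rwa [hU t] at this
  · rw [hζ, vel_perturb, vel_perturb, add_sub_add_comm, ← smul_sub]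
    refine (norm_add_le _ _).trans ?_
    rw [norm_smul, Real.norm_eq_abs]
    have h5 := mul_le_mul h4' (hφ t w hw) (norm_nonneg _) zero_le_one
    have h6 := abs_nonneg w
    linarith

/-- A compactly supported `C¹` profile, translated to the parameter `c` and repeated with period
`1`, is a closed curve. -/
theorem exists_periodization {β : ℝ → ℂ} (hβ : ContDiff ℝ 1 β) {b : ℝ}
    (hb : b < 1 / 2) (h0 : ∀ x, b ≤ |x| → β x = 0 ∧ deriv β x = 0) (c : ℝ) :
    ∃ φ : C1Loop, (∀ (n : ℤ) (t : ℝ), |t - c - n| < 1 - b →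
        φ t = β (t - c - n) ∧ φ.vel t = deriv β (t - c - n)) ∧
      ∀ t, (∀ n : ℤ, b ≤ |t - c - n|) → φ t = 0 ∧ φ.vel t = 0 := by
  set f : ℝ → ℂ := fun t => β (t - c - round (t - c)) with hf
  have key : ∀ (n : ℤ) (t : ℝ), |t - c - n| < 1 - b → f t = β (t - c - n) := by
    intro n t ht
    rcases eq_or_ne (round (t - c)) n with h | h
    · simp only [hf, h]
    have h1 : (1 : ℝ) ≤ |(round (t - c) : ℝ) - n| := by
      have : 1 ≤ |round (t - c) - n| := Int.one_le_abs (sub_ne_zero.2 h)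
      exact_mod_cast this
    have h2 := abs_sub_round (t - c)
    have h3 := abs_sub_abs_le_abs_sub ((round (t - c) : ℝ) - n) (t - c - n)
    rw [sub_sub_sub_cancel_right, abs_sub_comm _ (t - c)] at h3
    rw [hf]
    simp only
    rw [(h0 _ (by linarith)).1, (h0 (t - c - n) (by linarith)).1]
  have hnear : ∀ t : ℝ, |t - c - round (t - c)| < 1 - b := fun t => by
    linarith [abs_sub_round (t - c)]
  have hd : ∀ (n : ℤ) (t : ℝ), |t - c - n| < 1 - b → HasDerivAt f (deriv β (t - c - n)) t := by
    intro n t ht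
    have h1 : HasDerivAt (fun t => β (t - c - n)) (deriv β (t - c - n)) t := by
      have := ((hβ.differentiable one_ne_zero (t - c - n)).hasDerivAt).scomp t
        (((hasDerivAt_id t).sub_const c).sub_const (n : ℝ))
      rw [one_smul] at this
      exact this
    refine h1.congr_of_eventuallyEq ?_
    have hc : Continuous fun t : ℝ => |t - c - n| := by fun_prop
    filter_upwards [hc.continuousAt.eventually_lt_const ht] with x hx using key n x hx
  have hβ' : Continuous (deriv β) := hβ.continuous_deriv le_rfl
  have hcd : ContDiff ℝ 1 f := by
    refine contDiff_one_iff_deriv.2 ⟨fun t => (hd _ t (hnear t)).differentiableAt, ?_⟩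
    rw [continuous_iff_continuousAt]
    intro t
    have hc : Continuous fun x : ℝ => |x - c - round (t - c)| := by fun_prop
    have h1 : ContinuousAt (fun x => deriv β (x - c - round (t - c))) t := by fun_prop
    refine h1.congr ?_
    filter_upwards [hc.continuousAt.eventually_lt_const (hnear t)] with x hx
    exact (hd _ x hx).deriv.symm
  have hper : Function.Periodic f 1 := fun t => by
    simp only [hf]
    rw [show t + 1 - c = t - c + 1 by ring, round_add_one]
    push_cast
    congr 1
    ring
  refine ⟨⟨f, hper, hcd⟩, fun n t ht => ⟨key n t ht, (hd n t ht).deriv⟩, fun t ht => ⟨?_, ?_⟩⟩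
  · exact (h0 _ (ht _)).1
  · exact (hd _ t (hnear t)).deriv.trans (h0 _ (ht _)).2

/-- A Lipschitz bound for the derivative of the profile carries over to its periodization. -/
theorem norm_vel_sub_le_of_periodization {γ φ : C1Loop} {β : ℝ → ℂ} {b c K : ℝ}
    (hφ : ∀ (n : ℤ) (t : ℝ), |t - c - n| < 1 - b → φ.vel t = deriv β (t - c - n))
    (hβ : ∀ x w, ‖deriv β (x + w) - deriv β x‖ ≤ K * (‖γ.vel (c + x + w) - γ.vel (c + x)‖ + |w|))
    (t w : ℝ) (hb : b < 1 / 2) (hw : |w| < 1 / 2 - b) :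
    ‖φ.vel (t + w) - φ.vel t‖ ≤ K * (‖γ.vel (t + w) - γ.vel t‖ + |w|) := by
  have h1 := abs_sub_round (t - c)
  set n := round (t - c) with hn
  have h2 : |t + w - c - n| < 1 - b := by
    rw [show t + w - c - n = (t - c - n) + w by ring]
    exact (abs_add_le _ _).trans_lt (by linarith)
  rw [hφ n t (by linarith), hφ n (t + w) h2, show t + w - c - n = (t - c - n) + w by ring]
  refine (hβ _ _).trans (le_of_eq ?_)
  have e1 : c + (t - c - n) = t + ((-n : ℤ) : ℝ) := by push_cast; ring
  have e2 : c + (t - c - n) + w = t + w + ((-n : ℤ) : ℝ) := by push_cast; ring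
  rw [e2, e1, γ.vel_add_int, γ.vel_add_int]

end C1Loop

namespace C1Loop

/-! ### Shortening a curve away from its crossings -/

theorem IsGeneric.finite_selfIntParams {γ : C1Loop} (hγ : γ.IsGeneric) :
    γ.selfIntParams.Finite := by
  have : γ.selfIntParams = Prod.fst '' γ.dblPts := by
    ext u
    rw [mem_selfIntParams_iff]
    rfl
  rw [this]
  exact hγ.finite_dblPts.image _

/-- A closed curve that is straight near its crossings has to bend somewhere else. -/
theorem exists_bending {γ : C1Loop} {η : ℝ} {jp jm s ω : ℤ} (hη : 0 < η)
    (hγ : γ ∈ admissible η jp jm s ω) :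
    ∃ t₀ b : ℝ, 0 < b ∧ b < 1 / 2 ∧
      (∀ u ∈ γ.selfIntParams, ∀ (k : ℤ) (t : ℝ), |t - t₀| < b → η ≤ |t - u - k|) ∧
      ∃ x, |x| < b ∧ γ.vel (t₀ + x) ≠ γ.vel t₀ := by
  by_contra! hcon
  have hT := hγ.1.1.finite_selfIntParams
  set O : Set ℝ := {t | ∀ u ∈ γ.selfIntParams, η < ‖((t - u : ℝ) : UnitAddCircle)‖} with hO
  have hOo : IsOpen O := by
    have : O = ⋂ u ∈ γ.selfIntParams, {t : ℝ | η < ‖((t - u : ℝ) : UnitAddCircle)‖} := by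
      ext t; simp [hO]
    rw [this]
    refine hT.isOpen_biInter fun u _ => isOpen_lt continuous_const ?_
    exact ((AddCircle.continuous_mk' 1).comp (continuous_id.sub continuous_const)).norm
  set E : Set ℝ := ⋃ u ∈ γ.selfIntParams, ⋃ k : ℤ, {u + k + η, u + k - η} with hE
  have hEc : E.Countable := hT.countable.biUnion fun u _ => countable_iUnion fun k =>
    (Set.toFinite _).countable
  have hloc : ∀ t, t ∉ E → ∀ᶠ x in 𝓝 t, γ.vel x = γ.vel t := by
    intro t htE
    by_cases ht : t ∈ O
    · obtain ⟨b, hb, hbO⟩ := Metric.isOpen_iff.1 hOo t ht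
      have hb' : 0 < min b (1 / 4) := lt_min hb (by norm_num)
      have h1 := hcon t (min b (1 / 4)) hb' ((min_le_right _ _).trans_lt (by norm_num)) (by
        intro u hu k x hx
        have h2 := hbO (show x ∈ Metric.ball t b from hx.trans_le (min_le_left _ _)) u hu
        rw [UnitAddCircle.norm_eq] at h2
        exact h2.le.trans (round_le (x - u) k))
      filter_upwards [Metric.ball_mem_nhds t hb'] with x hx
      have := h1 (x - t) hx
      rwa [add_sub_cancel] at this
    · simp only [hO, mem_ofPred_eq, not_forall, not_lt] at ht
      obtain ⟨u, hu, hle⟩ := ht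
      rw [UnitAddCircle.norm_eq] at hle
      set k := round (t - u) with hk
      have hne : |t - u - k| ≠ η := by
        intro h
        refine htE (mem_biUnion hu (mem_iUnion.2 ⟨k, ?_⟩))
        rcases abs_eq hη.le |>.1 h with h | h
        · exact Or.inl (by linarith)
        · exact Or.inr (by simp only [mem_singleton_iff]; linarith)
      have hlt : |t - u - k| < η := hle.lt_of_ne hne
      have hv : ∀ x, |x - u - k| < η → γ.vel x = γ.vel u := by
        intro x hx
        have h1 : x - k = x + ((-k : ℤ) : ℝ) := by push_cast; ring
        have h2 := (admissible_affine hη hγ hu (t := x - k)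
          (by rwa [show x - k - u = x - u - k by ring])).2
        rwa [h1, γ.vel_add_int] at h2
      have hc : Continuous fun x : ℝ => |x - u - k| := by fun_prop
      filter_upwards [hc.continuousAt.eventually_lt_const hlt] with x hx
      rw [hv x hx, hv t hlt]
  have hconst : ∀ t, γ.vel t = γ.vel 0 := by
    intro t
    have := integral_eq_of_hasDerivAt_off_countable γ.vel (fun _ => 0) (a := 0) (b := t) hEc
      γ.continuous_vel.continuousOn (fun x hx =>
        (hasDerivAt_const x (γ.vel x)).congr_of_eventuallyEq (hloc x hx.2)) (by simp)
    rw [intervalIntegral.integral_zero] at this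
    exact (sub_eq_zero.1 this.symm)
  have h1 := intervalIntegral.integral_eq_sub_of_hasDerivAt (a := 0) (b := 1)
    (fun t _ => γ.hasDerivAt t) (γ.continuous_vel.intervalIntegrable _ _)
  have h2 := γ.periodic 0
  rw [zero_add] at h2
  simp only [hconst, intervalIntegral.integral_const, h2, sub_zero, one_smul, sub_self] at h1
  exact hγ.1.1.1 0 h1

theorem length_lt_one {ζ : C1Loop} (h : ∀ t, ‖ζ.vel t‖ ≤ 1) (h' : ∃ t, ‖ζ.vel t‖ < 1) :
    ζ.length < 1 := by
  obtain ⟨t, ht⟩ := h'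
  have := intervalIntegral.integral_lt_integral_of_continuousOn_of_le_of_exists_lt (a := 0) (b := 1)
    one_pos ζ.continuous_vel.norm.continuousOn (continuousOn_const (c := (1 : ℝ)))
    (fun x _ => h x) ⟨Int.fract t, ⟨Int.fract_nonneg t, (Int.fract_lt_one t).le⟩, by
      rwa [ζ.vel_fract]⟩
  simpa [length] using this

/-- Where the curve bends, averaging its velocity shortens it. Rescaling then creates longer
straight strands through the crossings, at unchanged angles. -/
theorem exists_slack {γ : C1Loop} {η : ℝ} {jp jm s ω : ℤ} (hη : 0 < η)
    (hγ : γ ∈ admissible η jp jm s ω) {q : ℝ} (hq : 2 < q) (hS : γ.InSobolev q) :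
    ∃ η₁ > η, ∃ ξ ∈ admissible η₁ jp jm s ω, JoinedIn (genericWith jp jm s ω) γ ξ ∧
      ξ.InSobolev q ∧ ξ.angleSum q = γ.angleSum q := by
  have hU := hγ.2.1
  obtain ⟨t₀, b, hb0, hb, hav, x₀, hx₀, hbend⟩ := exists_bending hη hγ
  set κ : ℝ → ℝ := fun x => max 0 (b - |x|) with hκ
  have hκc : Continuous κ := by fun_prop
  have hκ0 : ∀ x, 0 ≤ κ x := fun x => le_max_left _ _
  have hκ1 : ∀ x, κ x ≤ 1 := fun x => max_le zero_le_one (by linarith [abs_nonneg x])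
  have hκz : ∀ x, b ≤ |x| → κ x = 0 := fun x hx => max_eq_left (by linarith)
  have hκp : ∀ x, |x| < b → 0 < κ x := fun x hx => lt_max_of_lt_right (by linarith)
  have hκL : ∀ x w, |κ (x + w) - κ x| ≤ |w| := by
    intro x w
    simp only [hκ, max_comm (0 : ℝ)]
    refine (abs_max_sub_max_le_abs _ _ _).trans ?_
    rw [sub_sub_sub_cancel_left]
    refine (abs_abs_sub_abs_le _ _).trans ?_
    rw [sub_add_cancel_left, abs_neg]
  have hvc : Continuous fun x => γ.vel (t₀ + x) := γ.continuous_vel.comp (by fun_prop)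
  set J := ∫ x in (-b)..b, κ x with hJ
  have hJ0 : 0 < J := intervalIntegral.intervalIntegral_pos_of_pos_on
    (hκc.intervalIntegrable _ _) (fun x hx => hκp x (abs_lt.2 hx)) (by linarith)
  set m : ℂ := J⁻¹ • ∫ x in (-b)..b, κ x • γ.vel (t₀ + x) with hm
  have hκv : Continuous fun x => κ x • γ.vel (t₀ + x) := hκc.smul hvc
  have hm1 : ‖m‖ ≤ 1 := by
    rw [hm, norm_smul, norm_inv, Real.norm_eq_abs, abs_of_pos hJ0, inv_mul_le_one₀ hJ0]
    refine (intervalIntegral.norm_integral_le_integral_norm (by linarith)).trans (le_of_eq ?_)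
    refine intervalIntegral.integral_congr fun x _ => ?_
    rw [norm_smul, hU, mul_one, Real.norm_eq_abs, abs_of_nonneg (hκ0 x)]
  set g : ℝ → ℂ := fun x => κ x • (m - γ.vel (t₀ + x)) with hg
  have hgc : Continuous g := hκc.smul (continuous_const.sub hvc)
  have hgi : ∀ a c, IntervalIntegrable g volume a c := fun a c => hgc.intervalIntegrable a c
  have hg0 : ∀ x, b ≤ |x| → g x = 0 := fun x hx => by simp only [hg, hκz x hx, zero_smul]
  have hgint : ∫ x in (-b)..b, g x = 0 := by
    simp only [hg, smul_sub]
    rw [intervalIntegral.integral_sub (f := fun x => κ x • m)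
      ((hκc.smul continuous_const).intervalIntegrable _ _)
      (hκv.intervalIntegrable _ _), intervalIntegral.integral_smul_const, ← hJ, hm, smul_smul,
      mul_inv_cancel₀ hJ0.ne', one_smul, sub_self]
  set β : ℝ → ℂ := fun x => ∫ y in (-b)..x, g y with hβ
  have hβd : ∀ x, HasDerivAt β (g x) x := fun x =>
    intervalIntegral.integral_hasDerivAt_right (hgi _ _)
      hgc.stronglyMeasurable.stronglyMeasurableAtFilter hgc.continuousAt
  have hβd' : deriv β = g := funext fun x => (hβd x).deriv
  have hβc : ContDiff ℝ 1 β := contDiff_one_iff_deriv.2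
    ⟨fun x => (hβd x).differentiableAt, by rw [hβd']; exact hgc⟩
  have hβ0 : ∀ x, b ≤ |x| → β x = 0 ∧ deriv β x = 0 := by
    intro x hx
    refine ⟨?_, by rw [hβd', hg0 x hx]⟩
    have hz : ∀ a, b ≤ |a| → (∀ y ∈ uIcc a x, b ≤ |y|) → ∫ y in a..x, g y = 0 := by
      intro a ha hy
      rw [intervalIntegral.integral_congr (g := fun _ => 0) fun y hy' => hg0 y (hy y hy')]
      simp
    rcases le_abs.1 hx with h | h
    · rw [hβ]
      simp only
      rw [← intervalIntegral.integral_add_adjacent_intervals (hgi (-b) b) (hgi b x), hgint,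
        zero_add]
      refine hz b (le_abs_self b) fun y hy => ?_
      rw [uIcc_of_le h] at hy
      exact hy.1.trans (le_abs_self y)
    · refine hz (-b) (by rw [abs_neg]; exact le_abs_self b) fun y hy => ?_
      rw [uIcc_of_ge (by linarith)] at hy
      exact (le_neg.1 hy.2).trans (neg_le_abs y)
  obtain ⟨φ, hφ, hφ0⟩ := exists_periodization hβc hb hβ0 t₀
  have hlip : ∀ t w, |w| < 1 / 2 - b →
      ‖φ.vel (t + w) - φ.vel t‖ ≤ 2 * (‖γ.vel (t + w) - γ.vel t‖ + |w|) := fun t w hw => by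
    refine norm_vel_sub_le_of_periodization (fun n t ht => (hφ n t ht).2) (fun x w => ?_) t w hb hw
    rw [hβd', hg]
    simp only
    rw [← add_assoc, show κ (x + w) • (m - γ.vel (t₀ + x + w)) - κ x • (m - γ.vel (t₀ + x)) =
      (κ (x + w) - κ x) • (m - γ.vel (t₀ + x + w)) -
        κ x • (γ.vel (t₀ + x + w) - γ.vel (t₀ + x)) by
      simp only [sub_smul, smul_sub]; abel]
    refine (norm_sub_le _ _).trans ?_
    rw [norm_smul, norm_smul, Real.norm_eq_abs, Real.norm_eq_abs, abs_of_nonneg (hκ0 x)]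
    have h1 : ‖m - γ.vel (t₀ + x + w)‖ ≤ 2 := by
      refine (norm_sub_le _ _).trans ?_
      rw [hU]; linarith
    have h2 := mul_le_mul (hκL x w) h1 (norm_nonneg _) (abs_nonneg _)
    have h3 := mul_le_of_le_one_left (norm_nonneg (γ.vel (t₀ + x + w) - γ.vel (t₀ + x))) (hκ1 x)
    have h4 := norm_nonneg (γ.vel (t₀ + x + w) - γ.vel (t₀ + x))
    linarith
  have hzero : ∀ u ∈ γ.selfIntParams, ∀ t, |t - u| < η → φ t = 0 ∧ φ.vel t = 0 := by
    intro u hu t ht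
    refine hφ0 t fun n => ?_
    by_contra! hlt
    have := hav u hu (-n) (t - n) (by rwa [show t - n - t₀ = t - t₀ - n by ring])
    push_cast at this
    rw [show t - n - u - -n = t - u by ring] at this
    linarith
  have hev := eventually_exists_competitor hη le_rfl hγ hq hS (φ := φ) (by linarith : 0 < 1 / 2 - b)
    (by linarith) zero_le_two hlip fun u hu => ⟨(hzero u hu u (by simpa using hη)).1, 0,
      fun t ht => by rw [(hzero u hu t ht).2, zero_smul]⟩
  obtain ⟨ε, ⟨hI, hD, hcomp⟩, hε0, hε1⟩ := ((hev.filter_mono nhdsWithin_le_nhds).and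
    (Ioo_mem_nhdsGT (one_pos (α := ℝ)))).exists
  -- on every period, the velocity is a convex combination of `γ'` and the mean velocity `m`
  have hvel : ∀ x, |x| ≤ 1 / 2 → (γ.perturb φ ε).vel (t₀ + x) =
      (1 - ε * κ x) • γ.vel (t₀ + x) + (ε * κ x) • m := by
    intro x hx
    rw [vel_perturb, (hφ 0 (t₀ + x) (by simp; linarith)).2, hβd', hg]
    simp only [Int.cast_zero, sub_zero, add_sub_cancel_left]
    simp only [smul_sub, sub_smul, one_smul, smul_smul]
    abel
  have hεκ : ∀ x, 0 ≤ ε * κ x ∧ ε * κ x ≤ 1 := fun x =>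
    ⟨mul_nonneg hε0.le (hκ0 x), mul_le_one₀ hε1.le (hκ0 x) (hκ1 x)⟩
  have hle : ∀ t, ‖(γ.perturb φ ε).vel t‖ ≤ 1 := by
    intro t
    have h1 := abs_sub_round (t - t₀)
    have h2 : (γ.perturb φ ε).vel t = (γ.perturb φ ε).vel (t₀ + (t - t₀ - round (t - t₀))) := by
      have := (γ.perturb φ ε).vel_add_int (t₀ + (t - t₀ - round (t - t₀))) (round (t - t₀))
      rwa [show t₀ + (t - t₀ - round (t - t₀)) + round (t - t₀) = t by ring] at this
    rw [h2, hvel _ h1]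
    refine (norm_add_le _ _).trans ?_
    obtain ⟨a1, a2⟩ := hεκ (t - t₀ - round (t - t₀))
    rw [norm_smul, norm_smul, hU, Real.norm_eq_abs, Real.norm_eq_abs, abs_of_nonneg a1,
      abs_of_nonneg (sub_nonneg.2 a2)]
    nlinarith
  obtain ⟨x₁, hx₁, hne⟩ : ∃ x, |x| < b ∧ γ.vel (t₀ + x) ≠ m := by
    by_contra! h
    refine hbend ?_
    rw [h x₀ hx₀]
    simpa using (h 0 (by simpa using hb0)).symm
  have hlt : ‖(γ.perturb φ ε).vel (t₀ + x₁)‖ < 1 := by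
    rw [hvel x₁ (by linarith)]
    have h1 : 0 < ε * κ x₁ := mul_pos hε0 (hκp x₁ hx₁)
    have h2 : ε * κ x₁ < 1 := (mul_le_of_le_one_right hε0.le (hκ1 x₁)).trans_lt hε1
    exact norm_combo_lt_of_ne (hU _).le hm1 hne (sub_pos.2 h2) h1 (by ring)
  have hlen := length_lt_one hle ⟨_, hlt⟩
  have hL0 := length_pos hI
  obtain ⟨ξ, hξ, hξJ, hξS, hξA⟩ := hcomp (η / (γ.perturb φ ε).length)
    (div_mul_cancel₀ _ hL0.ne').le
  refine ⟨_, ?_, ξ, hξ, hξJ, hξS, hξA.trans ?_⟩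
  · rw [gt_iff_lt, lt_div_iff₀ hL0]
    exact mul_lt_of_lt_one_right hη hlen
  · rw [angleSum, hD, angleSum]
    refine finsum_mem_congr rfl fun p hp => ?_
    have h1 := (hzero _ (fst_mem_selfIntParams hp) p.1 (by simpa using hη)).2
    have h2 := (hzero _ (snd_mem_selfIntParams hp) p.2 (by simpa using hη)).2
    rw [velCos, velCos, vel_perturb, vel_perturb, h1, h2]
    simp

end C1Loop

namespace C1Loop

/-! ### Turning a strand, and the minimizers -/

/-- There are no triple points, for parameters in arbitrary order. -/
theorem IsGeneric.eq_of_apply_eq {γ : C1Loop} (hγ : γ.IsGeneric) {a b c : ℝ}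
    (ha : a ∈ Ico (0 : ℝ) 1) (hb : b ∈ Ico (0 : ℝ) 1) (hc : c ∈ Ico (0 : ℝ) 1)
    (hab : γ a = γ b) (hac : γ a = γ c) (h1 : a ≠ b) (h2 : a ≠ c) : b = c := by
  by_contra h3
  have key : ∀ x y z : ℝ, 0 ≤ x → x < y → y < z → z < 1 → γ x = γ y → γ y = γ z → False :=
    fun x y z h0 h1 h2 h3 h4 h5 => hγ.2.2.2 x y z ⟨h0, h1, h2, h3, h4, h5⟩
  have hbc := hab.symm.trans hac
  rcases lt_or_gt_of_ne h1 with l1 | l1 <;> rcases lt_or_gt_of_ne h2 with l2 | l2 <;>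
    rcases lt_or_gt_of_ne h3 with l3 | l3
  · exact key a b c ha.1 l1 l3 hc.2 hab hbc
  · exact key a c b ha.1 l2 l3 hb.2 hac hbc.symm
  · linarith
  · exact key c a b hc.1 l2 l1 hb.2 hac.symm hab
  · exact key b a c hb.1 l1 l2 hc.2 hab.symm hac
  · linarith
  · exact key b c a hb.1 l3 l2 ha.2 hbc hac.symm
  · exact key c b a hc.1 l3 l1 ha.2 hbc.symm hab.symm

/-- Turning one of two transverse unit vectors towards the normal of the other one. -/
theorem abs_cos_angle_rotate_lt {a v : ℂ} (ha : ‖a‖ = 1) (hv : ‖v‖ = 1)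
    (h0 : Real.cos (InnerProductGeometry.angle a v) ≠ 0)
    (h1 : |Real.cos (InnerProductGeometry.angle a v)| < 1) :
    ∃ c : ℝ, ∀ ε ∈ Ioo (0 : ℝ) 1,
      |Real.cos (InnerProductGeometry.angle a (v + ε • c • (Complex.I * v)))| <
        |Real.cos (InnerProductGeometry.angle a v)| := by
  have hin : ∀ w : ℂ, inner ℝ a w = (starRingEnd ℂ a * w).re := fun w => by
    rw [Complex.inner, mul_comm]
  rw [InnerProductGeometry.cos_angle, ha, hv, hin, mul_one, div_one] at h0 h1 ⊢
  set z := starRingEnd ℂ a * v with hz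
  have hzn : z.re ^ 2 + z.im ^ 2 = 1 := by
    have : Complex.normSq z = 1 := by
      rw [Complex.normSq_eq_norm_sq, hz, norm_mul, Complex.norm_conj, ha, hv]; norm_num
    rw [Complex.normSq_apply] at this
    linarith
  have him : 0 < z.im ^ 2 := by
    have := (sq_lt_one_iff_abs_lt_one _).2 h1
    linarith
  have him1 : z.im ^ 2 ≤ 1 := by nlinarith [sq_nonneg z.re]
  refine ⟨z.re * z.im, fun ε hε => ?_⟩
  set w := v + ε • (z.re * z.im) • (Complex.I * v) with hw
  have hwn : 1 ≤ ‖w‖ := by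
    have : w = (1 + (ε * (z.re * z.im) : ℝ) * Complex.I) * v := by
      rw [hw, Complex.real_smul, Complex.real_smul]; push_cast; ring
    rw [this, norm_mul, hv, mul_one]
    refine le_trans (le_of_eq ?_) (Complex.abs_re_le_norm _)
    simp
  have hre : (starRingEnd ℂ a * w).re = z.re * (1 - ε * z.im ^ 2) := by
    have : starRingEnd ℂ a * w = z + (ε * (z.re * z.im) : ℝ) * (Complex.I * z) := by
      rw [hw, hz, Complex.real_smul, Complex.real_smul]; push_cast; ring
    rw [this, Complex.add_re, Complex.re_ofReal_mul, Complex.I_mul_re]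
    ring
  rw [InnerProductGeometry.cos_angle, ha, one_mul, hin, hre, abs_div, abs_norm,
    div_lt_iff₀ (by linarith), abs_mul]
  have h2 : ε * z.im ^ 2 ≤ 1 := by nlinarith [hε.1, hε.2]
  rw [abs_of_nonneg (by linarith : 0 ≤ 1 - ε * z.im ^ 2)]
  have h3 : 0 < |z.re| := abs_pos.2 h0
  have h4 : 0 < ε * z.im ^ 2 := mul_pos hε.1 him
  nlinarith [mul_pos h3 h4]

/-- With some slack around the crossings, a crossing that is not orthogonal can be improved. -/
theorem exists_angleSum_lt {γ : C1Loop} {η η₁ : ℝ} {jp jm s ω : ℤ} (hη : 0 < η) (hη₁ : η < η₁)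
    (hγ : γ ∈ admissible η₁ jp jm s ω) {q : ℝ} (hq : 2 < q) (hS : γ.InSobolev q) {p₀ : ℝ × ℝ}
    (hp₀ : p₀ ∈ γ.dblPts) (hcos : γ.velCos p₀ ≠ 0) :
    ∃ ξ ∈ admissible η jp jm s ω, JoinedIn (genericWith jp jm s ω) γ ξ ∧ ξ.InSobolev q ∧
      ξ.angleSum q < γ.angleSum q := by
  have hU := hγ.2.1
  have hη₁0 : 0 < η₁ := hη.trans hη₁
  have hb := admissible_le_quarter hη₁0 hγ hp₀
  set v₀ := p₀.2 with hv₀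
  have hv₀T : v₀ ∈ γ.selfIntParams := snd_mem_selfIntParams hp₀
  have hgen := hγ.1.1
  obtain ⟨c, hc⟩ := abs_cos_angle_rotate_lt (hU p₀.1) (hU p₀.2) hcos
    (abs_velCos_lt_one (hgen.linearIndependent hp₀))
  set ρ := (η + η₁) / 2 with hρ
  have hρ0 : 0 < ρ := by positivity
  let f : ContDiffBump (0 : ℝ) := ⟨ρ, (ρ + η₁) / 2, hρ0, by linarith⟩
  set d : ℂ := c • (Complex.I * γ.vel v₀) with hd
  set β : ℝ → ℂ := fun x => (f x * x) • d with hβ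
  have hβc : ContDiff ℝ 2 β := (f.contDiff.mul contDiff_id).smul contDiff_const
  have hcs : HasCompactSupport β := by
    have : HasCompactSupport fun x => f x * x := f.hasCompactSupport.mul_right
    exact this.smul_right
  obtain ⟨K, hK⟩ := ContDiff.lipschitzWith_of_hasCompactSupport hcs.deriv
    (ContDiff.iterate_deriv' 1 1 hβc) one_ne_zero
  have hβ0 : ∀ x, η₁ ≤ |x| → β x = 0 ∧ deriv β x = 0 := by
    have hz : ∀ x, (ρ + η₁) / 2 ≤ |x| → β x = 0 := fun x hx => by
      simp only [hβ]
      rw [f.zero_of_le_dist (by rw [Real.dist_eq, sub_zero]; exact hx), zero_mul, zero_smul]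
    intro x hx
    refine ⟨hz x (by linarith), ?_⟩
    have : β =ᶠ[𝓝 x] fun _ => 0 := by
      filter_upwards [continuous_abs.continuousAt.eventually_const_lt
        (show (ρ + η₁) / 2 < |x| by linarith)] with y hy using hz y hy.le
    rw [this.deriv_eq, deriv_const]
  have hβ1 : ∀ x, |x| < ρ → deriv β x = d := by
    intro x hx
    have : β =ᶠ[𝓝 x] fun x => x • d := by
      filter_upwards [continuous_abs.continuousAt.eventually_lt_const hx] with y hy
      simp only [hβ]
      rw [f.one_of_mem_closedBall (by simpa using hy.le), one_mul]
    rw [this.deriv_eq]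
    simpa using ((hasDerivAt_id x).smul_const d).deriv
  obtain ⟨φ, hφ, hφ0⟩ := exists_periodization (hβc.of_le one_le_two) (by linarith) hβ0 v₀
  have hlip : ∀ t w, |w| < 1 / 2 - η₁ →
      ‖φ.vel (t + w) - φ.vel t‖ ≤ K * (‖γ.vel (t + w) - γ.vel t‖ + |w|) := fun t w hw => by
    refine norm_vel_sub_le_of_periodization (fun n t ht => (hφ n t ht).2) (fun x w => ?_) t w
      (by linarith) hw
    have h1 := hK.norm_sub_le (x + w) x
    rw [add_sub_cancel_left, Real.norm_eq_abs] at h1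
    refine h1.trans (mul_le_mul_of_nonneg_left ?_ K.2)
    exact le_add_of_nonneg_left (norm_nonneg _)
  have hv₀φ : φ v₀ = 0 ∧ ∀ t, |t - v₀| < ρ → φ.vel t = d := by
    refine ⟨?_, fun t ht => ?_⟩
    · rw [(hφ 0 v₀ (by simp; linarith)).1]
      simp [hβ]
    · rw [(hφ 0 t (by simp; linarith)).2, Int.cast_zero, sub_zero, hβ1 _ ht]
  have hother : ∀ u ∈ γ.selfIntParams, u ≠ v₀ → ∀ t, |t - u| < ρ → φ t = 0 ∧ φ.vel t = 0 := by
    intro u hu huv t ht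
    refine hφ0 t fun n => ?_
    have h1 := admissible_sep hη₁0 hγ hu hv₀T huv n
    have h2 := abs_sub_abs_le_abs_sub (u - v₀ - n) (u - t)
    rw [show u - v₀ - n - (u - t) = t - v₀ - n by ring, abs_sub_comm u t] at h2
    linarith
  have hev := eventually_exists_competitor hρ0 (by linarith) hγ hq hS (φ := φ)
    (by linarith : 0 < 1 / 2 - η₁) (by linarith) K.2 hlip fun u hu => by
      rcases eq_or_ne u v₀ with rfl | huv
      · exact ⟨hv₀φ.1, c, hv₀φ.2⟩
      · exact ⟨(hother u hu huv u (by simpa using hρ0)).1, 0, fun t ht => by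
          rw [(hother u hu huv t ht).2, zero_smul]⟩
  have hlen : ∀ᶠ ε in 𝓝 (0 : ℝ), η * (γ.perturb φ ε).length ≤ ρ := by
    have hκ : 0 < min (1 / 2) (ρ / η - 1) := by
      refine lt_min (by norm_num) (sub_pos.2 ((one_lt_div hη).2 (by linarith)))
    filter_upwards [(γ.tendsto_perturb φ).eventually (γ.eventually_near hκ), hev] with ε h1 h2
    have h3 := (abs_arc_sub_le h2.1 (min_le_left _ _) (κ := min (1 / 2) (ρ / η - 1)) fun t => by
      have := (abs_norm_sub_norm_le ((γ.perturb φ ε).vel t) (γ.vel t)).trans (h1.2 t).le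
      rwa [hU t] at this).1
    have h4 := (le_abs_self _).trans (h3.trans (min_le_right _ _))
    rw [← le_div_iff₀' hη]
    linarith
  obtain ⟨ε, ⟨⟨hI, hD, hcomp⟩, hlenε⟩, hε⟩ := (((hev.and hlen).filter_mono
    nhdsWithin_le_nhds).and (Ioo_mem_nhdsGT (one_pos (α := ℝ)))).exists
  obtain ⟨ξ, hξ, hξJ, hξS, hξA⟩ := hcomp η hlenε
  refine ⟨ξ, hξ, hξJ, hξS, ?_⟩
  have hvv : (γ.perturb φ ε).vel v₀ = γ.vel v₀ + ε • d := by
    rw [vel_perturb, hv₀φ.2 v₀ (by simpa using hρ0)]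
  have hvo : ∀ u ∈ γ.selfIntParams, u ≠ v₀ → (γ.perturb φ ε).vel u = γ.vel u := fun u hu huv => by
    rw [vel_perturb, (hother u hu huv u (by simpa using hρ0)).2, smul_zero, add_zero]
  have hlt : |(γ.perturb φ ε).velCos p₀| < |γ.velCos p₀| := by
    have := hc ε hε
    rw [velCos, velCos, ← hv₀, hvv, hvo _ (fst_mem_selfIntParams hp₀) hp₀.2.2.1]
    exact this
  have hElt : crossEnergy q ((γ.perturb φ ε).velCos p₀) < crossEnergy q (γ.velCos p₀) := by
    rw [← crossEnergy_abs q (γ.velCos p₀), ← crossEnergy_abs q ((γ.perturb φ ε).velCos p₀)]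
    have h1 := abs_velCos_lt_one (hgen.linearIndependent hp₀)
    exact strictMonoOn_crossEnergy hq ⟨abs_nonneg _, hlt.trans h1⟩ ⟨abs_nonneg _, h1⟩ hlt
  have hle : ∀ p ∈ γ.dblPts, crossEnergy q ((γ.perturb φ ε).velCos p) ≤
      crossEnergy q (γ.velCos p) := by
    intro p hp
    by_cases h2 : p.2 = v₀
    · have : p = p₀ := by
        refine Prod.ext ?_ h2
        refine hgen.eq_of_apply_eq hp.2.1 hp.1 hp₀.1 hp.2.2.2.symm ?_ hp.2.2.1.symm ?_
        · rw [h2]; exact hp₀.2.2.2.symm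
        · rw [h2]; exact hp₀.2.2.1.symm
      rw [this]
      exact hElt.le
    by_cases h1 : p.1 = v₀
    · have : p = p₀.swap := by
        refine Prod.ext h1 ?_
        refine hgen.eq_of_apply_eq hp.1 hp.2.1 hp₀.1 hp.2.2.2 ?_ hp.2.2.1 ?_
        · rw [h1]; exact hp₀.2.2.2.symm
        · rw [h1]; exact hp₀.2.2.1.symm
      rw [this, velCos_swap, velCos_swap]
      exact hElt.le
    · rw [velCos, velCos, hvo _ (fst_mem_selfIntParams hp) h1, hvo _ (snd_mem_selfIntParams hp) h2]
  rw [hξA, angleSum, hD, hgen.angleSum_eq_sum,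
    finsum_mem_eq_finite_toFinset_sum _ hgen.finite_dblPts]
  exact Finset.sum_lt_sum (fun p hp => hle p (hgen.finite_dblPts.mem_toFinset.1 hp))
    ⟨p₀, hgen.finite_dblPts.mem_toFinset.2 hp₀, hElt⟩

theorem crossEnergy_zero_lt {q c : ℝ} (hq : 2 < q) (hc : |c| < 1) (h0 : c ≠ 0) :
    crossEnergy q 0 < crossEnergy q c := by
  rw [← crossEnergy_abs q c]
  exact strictMonoOn_crossEnergy hq ⟨le_rfl, one_pos⟩ ⟨abs_nonneg _, hc⟩ (abs_pos.2 h0)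

theorem crossEnergy_zero_le {q c : ℝ} (hq : 2 < q) (hc : |c| < 1) :
    crossEnergy q 0 ≤ crossEnergy q c := by
  rcases eq_or_ne c 0 with rfl | h
  · exact le_rfl
  · exact (crossEnergy_zero_lt hq hc h).le

theorem IsGeneric.ncard_mul_le_angleSum {γ : C1Loop} (hγ : γ.IsGeneric) {q : ℝ} (hq : 2 < q) :
    γ.dblPts.ncard * crossEnergy q 0 ≤ γ.angleSum q := by
  rw [hγ.angleSum_eq_sum, ncard_eq_toFinset_card _ hγ.finite_dblPts, ← nsmul_eq_mul]
  exact Finset.card_nsmul_le_sum _ _ _ fun p hp => crossEnergy_zero_le hq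
    (abs_velCos_lt_one (hγ.linearIndependent (hγ.finite_dblPts.mem_toFinset.1 hp)))

theorem IsGeneric.angleSum_of_velCos_eq_zero {γ : C1Loop} (hγ : γ.IsGeneric) (q : ℝ)
    (h : ∀ p ∈ γ.dblPts, γ.velCos p = 0) : γ.angleSum q = γ.dblPts.ncard * crossEnergy q 0 := by
  rw [hγ.angleSum_eq_sum, ncard_eq_toFinset_card _ hγ.finite_dblPts, ← nsmul_eq_mul,
    ← Finset.sum_const]
  exact Finset.sum_congr rfl fun p hp => by rw [h p (hγ.finite_dblPts.mem_toFinset.1 hp)]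

theorem IsGeneric.ncard_mul_lt_angleSum {γ : C1Loop} (hγ : γ.IsGeneric) {q : ℝ} (hq : 2 < q)
    {p : ℝ × ℝ} (hp : p ∈ γ.dblPts) (h : γ.velCos p ≠ 0) :
    γ.dblPts.ncard * crossEnergy q 0 < γ.angleSum q := by
  rw [hγ.angleSum_eq_sum, ncard_eq_toFinset_card _ hγ.finite_dblPts, ← nsmul_eq_mul,
    ← Finset.sum_const]
  exact Finset.sum_lt_sum (fun p hp => crossEnergy_zero_le hq
    (abs_velCos_lt_one (hγ.linearIndependent (hγ.finite_dblPts.mem_toFinset.1 hp))))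
    ⟨p, hγ.finite_dblPts.mem_toFinset.2 hp,
      crossEnergy_zero_lt hq (abs_velCos_lt_one (hγ.linearIndependent hp)) h⟩

theorem forall_velCos_eq_zero_iff (γ : C1Loop) :
    (∀ p ∈ γ.dblPts, γ.velCos p = 0) ↔ ∀ p ∈ γ.selfInt, γ.intAngle p = Real.pi / 2 := by
  simp only [intAngle_eq_pi_div_two_iff, dblPts_eq, mem_union, or_imp, forall_and,
    forall_mem_image, velCos_swap, and_self]

end C1Loop

theorem theorem1p4 (jp jm s ω : ℤ) (C : Set C1Loop) (hC : C1Loop.IsCompartment C jp jm s ω)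
    (η : ℝ) (hη0 : 0 < η) (hη1 : η < 1) (q : ℝ) (hq : 2 < q)
    (X : Set C1Loop)
    (hX : X = C1Loop.admissible η jp jm s ω ∩ C ∩ {γ : C1Loop | γ.InSobolev q}) :
    -- the limit that defines the renormalized energy exists
    (∀ γ ∈ X, Tendsto (fun δ : ℝ => γ.rescaledTP q δ) (𝓝[>] 0) (𝓝 (γ.renormTP q))) ∧
    -- Gamma convergence on the class with the C¹ topology
    GammaConverges (X := X) (𝓝[>] (0 : ℝ)) (fun δ γ => (γ : C1Loop).rescaledTP q δ)
      (fun γ => (γ : C1Loop).renormTP q) ∧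
    -- the renormalized energy depends only on the intersection angles, by this formula
    (∀ γ ∈ X, γ.renormTP q = ENNReal.ofReal
      ((2 : ℝ) ^ (q + 2) / (q - 2) * ∑ᶠ p ∈ γ.selfInt, angleF q (γ.intAngle p))) ∧
    -- minimizers are exactly the curves whose intersection angles are all right angles
    (∀ γ ∈ X, (∀ ξ ∈ X, γ.renormTP q ≤ ξ.renormTP q) ↔
      ∀ p ∈ γ.selfInt, γ.intAngle p = Real.pi / 2) := by
  obtain ⟨γ₀, -, hC⟩ := hC
  have hmem : ∀ γ, γ ∈ X ↔ γ ∈ C1Loop.admissible η jp jm s ω ∧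
      JoinedIn (C1Loop.genericWith jp jm s ω) γ₀ γ ∧ γ.InSobolev q := by
    intro γ
    rw [hX, hC, and_assoc.symm]
    rfl
  have hval : ∀ γ ∈ X, γ.renormTP q =
      ENNReal.ofReal ((2 : ℝ) ^ (q + 1) / (q - 2) * γ.angleSum q) := fun γ hγ =>
    C1Loop.renormTP_eq hη0 ((hmem γ).1 hγ).1 hq ((hmem γ).1 hγ).2.2
  have hc : 0 < (2 : ℝ) ^ (q + 1) / (q - 2) := div_pos (by positivity) (by linarith)
  refine ⟨fun γ hγ => ?_, C1Loop.gammaConverges_rescaledTP hη0 hq fun γ hγ =>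
    ⟨((hmem γ).1 hγ).1, ((hmem γ).1 hγ).2.2⟩, fun γ hγ => ?_, fun γ hγ => ?_⟩
  · rw [hval γ hγ]
    exact C1Loop.tendsto_rescaledTP hη0 ((hmem γ).1 hγ).1 hq ((hmem γ).1 hγ).2.2
  · rw [hval γ hγ, ((hmem γ).1 hγ).1.1.1.angleSum_eq hq, show q + 2 = q + 1 + 1 by ring,
      Real.rpow_add_one two_ne_zero (q + 1)]
    congr 1
    ring
  · obtain ⟨ha, hJ, hS⟩ := (hmem γ).1 hγ
    rw [← C1Loop.forall_velCos_eq_zero_iff]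
    constructor
    · intro hmin
      by_contra! hcon
      obtain ⟨p, hp, hcos⟩ := hcon
      obtain ⟨η₁, hη₁, γ₁, ha₁, hJ₁, hS₁, hA₁⟩ := C1Loop.exists_slack hη0 ha hq hS
      -- the longer strands leave some crossing of `γ₁` oblique, as its energy is not the least one
      have hlt : γ₁.dblPts.ncard * crossEnergy q 0 < γ₁.angleSum q := by
        rw [hA₁, C1Loop.ncard_dblPts_eq_of_joinedIn hJ₁]
        exact ha.1.1.ncard_mul_lt_angleSum hq hp hcos
      obtain ⟨p₁, hp₁, hcos₁⟩ : ∃ p ∈ γ₁.dblPts, γ₁.velCos p ≠ 0 := by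
        by_contra! h
        exact hlt.ne' (ha₁.1.1.angleSum_of_velCos_eq_zero q h)
      obtain ⟨ξ, ha₂, hJ₂, hS₂, hA₂⟩ :=
        C1Loop.exists_angleSum_lt hη0 hη₁ ha₁ hq hS₁ hp₁ hcos₁
      have hξ : ξ ∈ X := (hmem ξ).2 ⟨ha₂, (hJ.trans hJ₁).trans hJ₂, hS₂⟩
      have h1 := hmin ξ hξ
      rw [hval γ hγ, hval ξ hξ, ENNReal.ofReal_le_ofReal_iff
        (mul_nonneg hc.le (ha₂.1.1.angleSum_nonneg hq)), mul_le_mul_iff_right₀ hc] at h1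
      linarith
    · intro h ξ hξ
      obtain ⟨ha', hJ', hS'⟩ := (hmem ξ).1 hξ
      rw [hval γ hγ, hval ξ hξ, ha.1.1.angleSum_of_velCos_eq_zero q h,
        C1Loop.ncard_dblPts_eq_of_joinedIn (hJ'.symm.trans hJ)]
      exact ENNReal.ofReal_le_ofReal
        (mul_le_mul_of_nonneg_left (ha'.1.1.ncard_mul_le_angleSum hq) hc.le)
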